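/- Let $k$ be an algebraically closed field of characteristic $0$ and let $\mathcal C$ be a (smooth projective) curve of genus $2$ over $k$, with function field $K = k(\mathcal C)$ and automorphism group $\mathrm{Aut}(\mathcal C) := \mathrm{Aut}(K/k)$. Let $D_8$ and $D_{12}$ denote the dihedral groups of order $8$ and $12$. Then: (i) $\mathrm{Aut}(\mathcal C) \cong D_8$ if and only if $\mathcal C$ is isomorphic over $k$ to (the smooth projective model of) the curve $Y^2 = X^5 + X^3 + tX$ for some $t \in k \setminus \{0, \tfrac14, \tfrac{9}{100}\}$. (ii) $\mathrm{Aut}(\mathcal C) \cong D_{12}$ if and only if $\mathcal C$ is isomorphic over $k$ to (the smooth projective model of) the curve $Y^2 = X^6 + X^3 + t$ for some $t \in k \setminus \{0, \tfrac14, -\tfrac{1}{50}\}$. -/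

import Mathlib

open Polynomial
open scoped WithZero

namespace Curve

section FunctionFields

variable (k K : Type*) [Field k] [Field K] [Algebra k K]

/-- `K` is an algebraic function field in one variable over `k`: a finite extension of `k(x)`
for some `x` transcendental over `k`. Smooth projective curves over an algebraically closed
field `k` correspond to such extensions, a curve `C` to its field of rational functions `k(C)`,
and isomorphisms of curves to `k`-isomorphisms of fields. -/
def IsFunctionField : Prop :=
  ∃ x : K, Transcendental k x ∧ Module.Finite (IntermediateField.adjoin k {x}) K

/-- The automorphism group `Aut(C) = Aut(K/k)` of the curve with function field `K`. -/
abbrev Aut : Type _ := K ≃ₐ[k] K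

/-- A place of `K/k`, that is, a point of the curve: a normalized discrete valuation of `K`
that is trivial on `k`. It is written multiplicatively: `v f = exp (-ord f)`. -/
structure Place where
  /-- the valuation -/
  val : Valuation K ℤᵐ⁰
  surjective : Function.Surjective val
  le_one : ∀ c : k, val (algebraMap k K c) ≤ 1

/-- Divisors: finite formal integral combinations of places. -/
abbrev Divisor : Type _ := Place k K →₀ ℤ

variable {k K}

/-- The degree of a divisor. Over an algebraically closed `k`, the only case in which it is used,
every place has residue field `k`, hence degree one. -/
def Divisor.degree (D : Divisor k K) : ℤ := D.sum fun _ n => n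

/-- The Riemann-Roch space `L(D)`: all `f` with `f = 0` or `ord_P f ≥ -D(P)` at every place. -/
def riemannRochSpace (D : Divisor k K) : Submodule k K where
  carrier := {f | ∀ P : Place k K, P.val f ≤ WithZero.exp (D P)}
  zero_mem' P := by simp
  add_mem' hf hg P := (P.val.map_add _ _).trans (max_le (hf P) (hg P))
  smul_mem' c f hf P := by
    rw [Algebra.smul_def, map_mul]
    exact (mul_le_mul' (P.le_one c) (hf P)).trans (one_mul _).le

variable (k K)

/-- `g` is the genus of the function field `K/k` (with `k` algebraically closed), in Riemann's
definition: the maximum of `deg D + 1 - ℓ(D)` over all divisors `D`, with `ℓ(D) = dim L(D)`. -/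
def HasGenus (g : ℕ) : Prop :=
  IsGreatest
    {n : ℤ | ∃ D : Divisor k K, n = D.degree + 1 - (Module.finrank k (riemannRochSpace D) : ℤ)}
    (g : ℤ)

end FunctionFields

section Models

variable {k : Type*} [Field k]

/-- The coordinate ring `k[X, Y] / (Y ^ 2 - f(X))`; the inner polynomial variable is `X`,
the outer one `Y`. -/
abbrev CoordinateRing (f : k[X]) : Type _ := AdjoinRoot (X ^ 2 - C f : k[X][X])

/-- The function field of the affine plane curve `Y ^ 2 = f(X)` (a field whenever `f` is not a
square in `k[X]`). -/
abbrev EqnFunctionField (f : k[X]) : Type _ := FractionRing (CoordinateRing f)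

end Models

/-- The curve with function field `K` is isomorphic over `k` to (the smooth projective model of)
the curve `Y ^ 2 = f(X)`. -/
def IsIsoToEqn (k K : Type*) [Field k] [Field K] [Algebra k K] (f : k[X]) : Prop :=
  Nonempty (K ≃ₐ[k] EqnFunctionField f)

end Curve

open scoped IntermediateField.algebraAdjoinAdjoin

namespace Curve

/-! ### Places, integral closures of `k[x]`, and existence of poles. -/

section Places

variable {k K : Type*} [Field k] [Field K] [Algebra k K]

/-! A curve of genus two has a two-dimensional space of holomorphic differentials. The ratio `x` of
a basis has degree two, so `K = k(x, y)` with `y² = f(x)` and `f` squarefree of degree 5 or 6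
(`exists_isModel`, `IsModel.natDegree_eq`). The space of differentials is canonical, so every
automorphism acts on `x` by a Möbius map (`exists_mobius`) and sends `y` to `l y / (c x + d)³`
(`IsModel.exists_eigenvalue`). Thus the automorphism group, modulo the central hyperelliptic
involution, consists of the Möbius maps that preserve the binary sextic of `f` up to a scalar;
`IsModel.exists_algEquiv_of_sexticSubst` turns such maps back into automorphisms. The differentials
are Weil's, functionals on adeles, and the Riemann-Roch count
(`finrank_quotient_boundedAddPrincipal`) is derived from Riemann's definition of the genus.

From the equation to the group: a binary sextic has a covariant quadratic form of degree three in
its coefficients. For the two normal forms it is `xz` times `9 - 100t`, respectively `9(1 + 50t)`.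
When this factor is nonzero every symmetry preserves the pair of points zero and infinity, hence is
diagonal or antidiagonal. Comparing coefficients leaves only the group generated by a rotation `x ↦
αx` and an involution `x ↦ s/x`, lifted to `K`, which is dihedral.

From the group to the equation: a suitable rotation (of order four, respectively three) acts on the
line as a nontrivial map of finite order, so in a good coordinate it is `x ↦ αx`. Then `f` is an
eigenvector of this substitution and has at most three monomials. Squarefreeness makes the outer
coefficients nonzero, the group structure the middle one, and rescaling `x` and `y` gives the normal
form. The values 0 and 1/4 of `t` are excluded by squarefreeness. The third value makes the
covariant vanish; there an explicit extra automorphism, incompatible with the given group, is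
exhibited (`IsModel.quintic_ne`, `IsModel.sextic_ne`). -/

lemma transcendental_of_notMem_range [IsAlgClosed k] {x : K}
    (hx : x ∉ Set.range (algebraMap k K)) : Transcendental k x := fun h =>
  hx (minpoly.mem_range_of_degree_eq_one k x
    (IsAlgClosed.degree_eq_one_of_irreducible k (minpoly.irreducible h.isIntegral)))

lemma notMem_range_of_transcendental {x : K} (hx : Transcendental k x) :
    x ∉ Set.range (algebraMap k K) := by
  rintro ⟨c, rfl⟩
  exact hx (isAlgebraic_algebraMap c)

lemma Place.map_algebraMap (P : Place k K) {c : k} (hc : c ≠ 0) :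
    P.val (algebraMap k K c) = 1 := by
  refine le_antisymm (P.le_one c) ?_
  have h := P.le_one c⁻¹
  rw [map_inv₀, map_inv₀] at h
  have h0 : 0 < P.val (algebraMap k K c) := by simpa [zero_lt_iff] using hc
  exact (inv_le_one₀ h0).1 h

lemma Place.exists_uniformizer (P : Place k K) (n : ℤ) : ∃ e : K, P.val e = WithZero.exp n :=
  P.surjective _

lemma exists_exp_of_ne_zero {a : ℤᵐ⁰} (ha : a ≠ 0) : ∃ n : ℤ, a = WithZero.exp n :=
  ⟨WithZero.log a, (WithZero.exp_log ha).symm⟩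

lemma Place.ext_val {P Q : Place k K} (h : ∀ z, P.val z = Q.val z) : P = Q := by
  cases P; cases Q
  congr
  exact Valuation.ext h

/-- The normalization leaves no room for rescaling: both valuations have the same elements of value
below 1, and a uniformizer is an element of greatest value among these. -/
lemma Place.eq_of_le_one_iff {P Q : Place k K} (h : ∀ z, P.val z ≤ 1 ↔ Q.val z ≤ 1) : P = Q := by
  have he : P.val.IsEquiv Q.val := Valuation.isEquiv_of_val_le_one (fun {z} => h z)
  obtain ⟨π, hπ⟩ := P.exists_uniformizer (-1)
  obtain ⟨π', hπ'⟩ := Q.exists_uniformizer (-1)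
  have hlt : ∀ {a : ℤᵐ⁰}, a < 1 ↔ a ≤ WithZero.exp (-1) := by
    intro a
    rcases eq_or_ne a 0 with rfl | ha
    · simp
    · obtain ⟨n, rfl⟩ := exists_exp_of_ne_zero ha
      rw [← WithZero.exp_zero, WithZero.exp_lt_exp, WithZero.exp_le_exp]
      omega
  have hQ : Q.val π = WithZero.exp (-1) := by
    apply le_antisymm
    · rw [← hlt, ← he.lt_one_iff_lt_one, hlt, hπ]
    · rw [← hπ', ← he.le_iff_le, hπ, ← hlt, he.lt_one_iff_lt_one, hlt, hπ']
  apply Place.ext_val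
  intro z
  rcases eq_or_ne z 0 with rfl | hz
  · simp
  obtain ⟨n, hn⟩ := exists_exp_of_ne_zero ((P.val.ne_zero_iff).2 hz)
  have h1 : P.val (z * π ^ n) = 1 := by
    rw [map_mul, map_zpow₀, hn, hπ, ← WithZero.exp_zsmul, ← WithZero.exp_add]; simp
  have h2 := he.eq_one_iff_eq_one.1 h1
  rw [map_mul, map_zpow₀, hQ, ← WithZero.exp_zsmul] at h2
  rw [hn, eq_div_of_mul_eq (by simp) h2, one_div, ← WithZero.exp_neg]; simp

lemma essFiniteType (hK : IsFunctionField k K) : Algebra.EssFiniteType k K := by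
  obtain ⟨x, hx, hfin⟩ := hK
  have : Algebra.EssFiniteType k (IntermediateField.adjoin k {x}) :=
    IntermediateField.essFiniteType_iff.2 ⟨{x}, by simp⟩
  exact Algebra.EssFiniteType.comp k (IntermediateField.adjoin k {x}) K

/-- The element given by the definition bounds the transcendence degree by one, so any
transcendental element is a transcendence basis; finite generation of `K` turns algebraic into
finite. -/
lemma finite_adjoin (hK : IsFunctionField k K) {x : K} (hx : Transcendental k x) :
    Module.Finite (IntermediateField.adjoin k {x}) K := by
  have := essFiniteType hK
  obtain ⟨x₀, hx₀, hfin⟩ := hK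
  have hle : Algebra.trdeg k K ≤ 1 := by
    have h0 : Algebra.IsAlgebraic (Algebra.adjoin k {x₀}) K :=
      (IsFractionRing.comap_isAlgebraic_iff (A := Algebra.adjoin k {x₀})
        (K := IntermediateField.adjoin k {x₀}) (C := K)).2 inferInstance
    simpa using Algebra.IsAlgebraic.trdeg_le_cardinalMk k ({x₀} : Set K)
  have hind : AlgebraicIndependent k ![x] := by
    rw [algebraicIndependent_unique_type_iff]; simpa using hx
  have hb := hind.isTranscendenceBasis_of_lift_trdeg_le_of_finite (by simpa using hle)
  have halg := hb.isAlgebraic_field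
  have : Set.range ![x] = {x} := by simp
  rw [this] at halg
  have : Algebra.EssFiniteType (IntermediateField.adjoin k {x}) K :=
    Algebra.EssFiniteType.of_comp k _ _
  exact Algebra.finite_of_essFiniteType_of_isAlgebraic


/-- The ring of functions integral over `k[x]`. -/
abbrev integralOver (k : Type*) {K : Type*} [Field k] [Field K] [Algebra k K] (x : K) :=
  integralClosure (Algebra.adjoin k {x}) K

lemma isPrincipalIdealRing_adjoin (x : K) : IsPrincipalIdealRing (Algebra.adjoin k {x}) := by
  have hs : Function.Surjective ((aeval x : k[X] →ₐ[k] K).rangeRestrict) :=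
    (aeval x : k[X] →ₐ[k] K).rangeRestrict_surjective
  rw [Algebra.adjoin_singleton_eq_range_aeval]
  exact IsPrincipalIdealRing.of_surjective (aeval x : k[X] →ₐ[k] K).rangeRestrict.toRingHom hs

/-- Characteristic zero makes `K/k(x)` separable, and the integral closure of the principal ideal
domain `k[x]` in a finite separable extension is Dedekind. -/
lemma isDedekindDomain_integralOver [CharZero k] (hK : IsFunctionField k K) {x : K}
    (hx : Transcendental k x) : IsDedekindDomain (integralOver k x) := by
  have := isPrincipalIdealRing_adjoin (k := k) x
  have := finite_adjoin hK hx
  have : CharZero (IntermediateField.adjoin k {x}) := charZero_of_injective_algebraMap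
    (algebraMap k _).injective
  exact integralClosure.isDedekindDomain (Algebra.adjoin k {x}) (IntermediateField.adjoin k {x}) K

lemma isFractionRing_integralOver (hK : IsFunctionField k K) {x : K}
    (hx : Transcendental k x) : IsFractionRing (integralOver k x) K := by
  have := finite_adjoin hK hx
  exact integralClosure.isFractionRing_of_finite_extension (IntermediateField.adjoin k {x}) K

lemma mem_integralOver (x : K) : IsIntegral (Algebra.adjoin k {x}) x :=
  isIntegral_algebraMap (x := (⟨x, Algebra.self_mem_adjoin_singleton k x⟩ : Algebra.adjoin k {x}))

lemma Place.le_one_of_isIntegral (P : Place k K) {x : K} (hx : P.val x ≤ 1) {z : K}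
    (hz : IsIntegral (Algebra.adjoin k {x}) z) : P.val z ≤ 1 := by
  have hA : ∀ a : Algebra.adjoin k {x}, (a : K) ∈ P.val.integer := by
    rintro ⟨a, ha⟩
    induction ha using Algebra.adjoin_induction with
    | mem y hy => obtain rfl := Set.mem_singleton_iff.1 hy; exact hx
    | algebraMap c => exact P.le_one c
    | add a b _ _ ha hb => exact add_mem ha hb
    | mul a b _ _ ha hb => exact mul_mem ha hb
  obtain ⟨p, hp, hpz⟩ := hz
  have hint : IsIntegral P.val.integer z := by
    refine ⟨p.map ((algebraMap (Algebra.adjoin k {x}) K).codRestrict P.val.integer hA), hp.map _, ?_⟩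
    rw [eval₂_map]
    exact hpz
  exact (Valuation.integer.integers P.val).mem_of_integral hint

/-- The place of `K` attached to a prime of the ring of functions integral over `k[x]`. -/
noncomputable def placeOfPrime [CharZero k] (hK : IsFunctionField k K) {x : K}
    (hx : Transcendental k x)
    (p : letI := isDedekindDomain_integralOver hK hx
      IsDedekindDomain.HeightOneSpectrum (integralOver k x)) : Place k K :=
  letI := isDedekindDomain_integralOver hK hx
  letI := isFractionRing_integralOver hK hx
  { val := p.valuation K
    surjective := p.valuation_surjective K
    le_one := fun c => p.valuation_le_one (algebraMap k (integralOver k x) c) }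

/-- A Dedekind domain is the intersection of its localizations at the nonzero primes, and each of
these primes gives a place where `x` is regular. -/
lemma isIntegral_of_forall_le_one [CharZero k] (hK : IsFunctionField k K) {x : K}
    (hx : Transcendental k x) {z : K} (hz : ∀ P : Place k K, P.val x ≤ 1 → P.val z ≤ 1) :
    IsIntegral (Algebra.adjoin k {x}) z := by
  have := isDedekindDomain_integralOver hK hx
  have := isFractionRing_integralOver hK hx
  obtain ⟨y, hy⟩ := IsDedekindDomain.HeightOneSpectrum.mem_integers_of_valuation_le_one
    (R := integralOver k x) K z (fun p => hz (placeOfPrime hK hx p)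
      (p.valuation_le_one (⟨x, mem_integralOver x⟩ : integralOver k x)))
  rw [← hy]
  exact y.2

/-- A function without poles would be integral over `k[z⁻¹]`; lying in `k(z⁻¹)`, it would be a
polynomial in `z⁻¹`. -/
lemma exists_pole [CharZero k] (hK : IsFunctionField k K) {z : K}
    (hz : Transcendental k z) : ∃ P : Place k K, 1 < P.val z := by
  by_contra! h
  have hz' : Transcendental k z⁻¹ := by
    intro h
    exact hz (by simpa using h.inv)
  have hint := isIntegral_of_forall_le_one hK hz' (z := z) (fun P _ => h P)
  have := isPrincipalIdealRing_adjoin (k := k) z⁻¹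
  have hmem : z ∈ IntermediateField.adjoin k {z⁻¹} := by
    rw [← inv_inv z, inv_inv z⁻¹]
    exact inv_mem (IntermediateField.mem_adjoin_simple_self k z⁻¹)
  have hint' : IsIntegral (Algebra.adjoin k {z⁻¹}) (⟨z, hmem⟩ : IntermediateField.adjoin k {z⁻¹}) :=
    (isIntegral_algebraMap_iff (algebraMap (IntermediateField.adjoin k {z⁻¹}) K).injective).1 hint
  obtain ⟨⟨y, hyA⟩, hy⟩ := (IsIntegrallyClosed.isIntegral_iff).1 hint'
  have hyz : y = z := congrArg Subtype.val hy
  rw [Algebra.adjoin_singleton_eq_range_aeval] at hyA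
  obtain ⟨q, hq⟩ := hyA
  have h0 : z⁻¹ ≠ 0 := by
    intro h0
    rw [h0] at hz'
    exact hz' isAlgebraic_zero
  -- From `z = q(z⁻¹)`, the element `z⁻¹` is a root of `X q - 1`, which takes the value -1 at 0.
  refine hz' ⟨X * q - 1, ?_, ?_⟩
  · intro h1
    have := congrArg (eval 0) h1
    simp at this
  · have : aeval z⁻¹ q = z := hq.trans hyz
    rw [map_sub, map_mul, this, aeval_X, map_one, inv_mul_cancel₀ (by simpa using h0), sub_self]

end Places

end Curve

namespace Curve

/-! ### Centers of places, finiteness of poles, and residue fields. -/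

section Poles

variable {k K : Type*} [Field k] [Field K] [Algebra k K]

/-- Elements of negative valuation in a ring of functions that are regular at `P`. -/
def Place.center (P : Place k K) {R : Type*} [CommRing R] [Algebra R K]
    (hR : ∀ r : R, P.val (algebraMap R K r) ≤ 1) : Ideal R where
  carrier := {r | P.val (algebraMap R K r) < 1}
  zero_mem' := by simp
  add_mem' ha hb := by
    simp only [Set.mem_ofPred_eq, map_add] at *
    exact P.val.map_add_lt ha hb
  smul_mem' c r hr := by
    simp only [Set.mem_ofPred_eq, smul_eq_mul, map_mul] at *
    exact (mul_le_of_le_one_left' (hR c)).trans_lt hr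

lemma Place.isPrime_center (P : Place k K) {R : Type*} [CommRing R] [Algebra R K]
    (hR : ∀ r : R, P.val (algebraMap R K r) ≤ 1) : (P.center hR).IsPrime where
  ne_top' := by
    rw [Ideal.ne_top_iff_one]
    change ¬ (P.val (algebraMap R K 1) < 1)
    simp
  mem_or_mem' {a b} h := by
    change P.val (algebraMap R K (a * b)) < 1 at h
    change P.val (algebraMap R K a) < 1 ∨ P.val (algebraMap R K b) < 1
    by_contra! hab
    rw [map_mul, map_mul] at h
    exact absurd h (not_lt.2 (one_le_mul hab.1 hab.2))

/-- A fraction integral at `p` has a denominator outside `p`, a unit for both valuations; so the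
center determines the valuation ring. -/
lemma Place.le_one_iff_of_center_eq (P : Place k K) {R : Type*} [CommRing R] [IsDedekindDomain R]
    [Algebra R K] [IsFractionRing R K] (hR : ∀ r : R, P.val (algebraMap R K r) ≤ 1)
    (p : IsDedekindDomain.HeightOneSpectrum R) (hp : p.asIdeal = P.center hR) (w : K) :
    P.val w ≤ 1 ↔ p.valuation K w ≤ 1 := by
  have hd : ∀ d : p.asIdeal.primeCompl, P.val (algebraMap R K d) = 1 := by
    rintro ⟨d, hd⟩
    refine le_antisymm (hR d) (not_lt.1 fun h => hd ?_)
    rw [hp]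
    exact h
  have h1 : ∀ w, p.valuation K w ≤ 1 → P.val w ≤ 1 := by
    intro w hw
    obtain ⟨n, d, hnd⟩ := p.exists_primeCompl_mul_eq_of_integer w hw
    have := congrArg P.val hnd
    rw [map_mul, hd, mul_one] at this
    rw [this]
    exact hR n
  have h2 : ∀ w, p.valuation K w < 1 → P.val w < 1 := by
    intro w hw
    obtain ⟨n, d, hnd⟩ := p.exists_primeCompl_mul_eq_of_integer w hw.le
    have h3 := congrArg P.val hnd
    rw [map_mul, hd, mul_one] at h3
    have h4 := congrArg (p.valuation K) hnd
    rw [map_mul, p.valuation_of_algebraMap, p.valuation_of_algebraMap,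
      (p.intValuation_eq_one_iff_mem_primeCompl d).2 d.2, mul_one] at h4
    rw [h4, p.intValuation_lt_one_iff_mem, hp] at hw
    rw [h3]
    exact hw
  refine ⟨fun h => not_lt.1 fun hlt => ?_, h1 w⟩
  have := h2 w⁻¹ (by rw [map_inv₀]; exact inv_lt_one_of_one_lt₀ hlt)
  rw [map_inv₀] at this
  have hw0 : 0 < P.val w := by
    rw [zero_lt_iff]
    intro h0
    rw [Valuation.zero_iff] at h0
    simp [h0] at hlt
  exact absurd h (not_le.2 ((inv_lt_one₀ hw0).1 this))

/-- Poles of `z` are zeros of `z⁻¹`: their centers in the integral closure of `k[z⁻¹]` divide the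
ideal of `z⁻¹`, which has finitely many prime factors, and a place is recovered from its center. -/
lemma finite_poles [IsAlgClosed k] [CharZero k] (hK : IsFunctionField k K) (z : K) :
    {P : Place k K | 1 < P.val z}.Finite := by
  by_cases hz : z ∈ Set.range (algebraMap k K)
  · obtain ⟨c, rfl⟩ := hz
    convert Set.finite_empty
    ext P
    simpa using P.le_one c
  have hz1 := transcendental_of_notMem_range hz
  have hx : Transcendental k z⁻¹ := fun h => hz1 (by simpa using h.inv)
  have := isDedekindDomain_integralOver hK hx
  have := isFractionRing_integralOver hK hx
  have hle : ∀ P : Place k K, 1 < P.val z →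
      ∀ r : integralOver k z⁻¹, P.val (algebraMap (integralOver k z⁻¹) K r) ≤ 1 := fun P hP r =>
    P.le_one_of_isIntegral (by rw [map_inv₀]; exact (inv_lt_one_of_one_lt₀ hP).le) r.2
  have hz0 : z ≠ 0 := fun h => hz (h ▸ ⟨0, map_zero _⟩)
  set x : integralOver k z⁻¹ := ⟨z⁻¹, mem_integralOver _⟩
  have hx0 : x ≠ 0 := fun h => inv_ne_zero hz0 (congrArg Subtype.val h)
  have hmem : ∀ (P : Place k K) (hP : 1 < P.val z), x ∈ P.center (hle P hP) := fun P hP => by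
    change P.val z⁻¹ < 1
    rw [map_inv₀]; exact inv_lt_one_of_one_lt₀ hP
  have hfin := Ideal.finite_factors (I := Ideal.span {x}) (by simpa using hx0)
  rw [← Set.finite_coe_iff] at hfin ⊢
  let c : {P : Place k K | 1 < P.val z} →
      {v : IsDedekindDomain.HeightOneSpectrum (integralOver k z⁻¹) |
        v.asIdeal ∣ Ideal.span {x}} := fun P =>
    ⟨⟨P.1.center (hle P.1 P.2), P.1.isPrime_center _, fun h => hx0 (by
      have := hmem P.1 P.2
      rw [h] at this
      exact this)⟩, by
      rw [Set.mem_ofPred_eq, Ideal.dvd_span_singleton]; exact hmem P.1 P.2⟩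
  refine Finite.of_injective c ?_
  rintro ⟨P, hP⟩ ⟨Q, hQ⟩ hPQ
  refine Subtype.ext (Place.eq_of_le_one_iff fun w => ?_)
  rw [P.le_one_iff_of_center_eq (hle P hP) (c ⟨P, hP⟩).1 rfl,
    Q.le_one_iff_of_center_eq (hle Q hQ) (c ⟨Q, hQ⟩).1 rfl, hPQ]

/-- This says that the residue field is `k`. Otherwise every `w - c` would be a unit at `P`, so by
factorization every nonzero element of `k(w)` too, and by integrality all of `K` would be regular at
`P`, against surjectivity of the valuation. -/
lemma Place.val_sub_algebraMap_lt_one [IsAlgClosed k] (hK : IsFunctionField k K)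
    (P : Place k K) {w : K} (hw : P.val w ≤ 1) : ∃ c : k, P.val (w - algebraMap k K c) < 1 := by
  by_cases hz : w ∈ Set.range (algebraMap k K)
  · obtain ⟨c, rfl⟩ := hz
    exact ⟨c, by simp⟩
  have hw1 := transcendental_of_notMem_range hz
  by_contra! hc
  have h1 : ∀ c : k, P.val (w - algebraMap k K c) = 1 := fun c =>
    le_antisymm ((P.val.map_sub _ _).trans (max_le hw (P.le_one c))) (hc c)
  have hq : ∀ q : k[X], q ≠ 0 → P.val (aeval w q) = 1 := by
    intro q hq
    rw [(IsAlgClosed.splits q).eq_prod_roots]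
    rw [map_mul, map_multiset_prod, Multiset.map_map, map_mul, map_multiset_prod, Multiset.map_map,
      aeval_C, P.map_algebraMap (leadingCoeff_ne_zero.2 hq), one_mul]
    apply Multiset.prod_eq_one
    intro a ha
    obtain ⟨c, -, rfl⟩ := Multiset.mem_map.1 ha
    simp [h1]
  have hF : ∀ a ∈ IntermediateField.adjoin k {w}, P.val a ≤ 1 := by
    intro a ha
    obtain ⟨r, s, rfl⟩ := IntermediateField.mem_adjoin_simple_iff k a |>.1 ha
    rcases eq_or_ne r 0 with rfl | hr
    · simp
    rcases eq_or_ne s 0 with rfl | hs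
    · simp
    rw [map_div₀, hq r hr, hq s hs, div_one]
  have hall : ∀ a : K, P.val a ≤ 1 := by
    intro a
    have := finite_adjoin hK hw1
    obtain ⟨p, hp, hpz⟩ := (Algebra.IsIntegral.isIntegral
      (R := IntermediateField.adjoin k {w}) a)
    have hint : IsIntegral P.val.integer a := by
      refine ⟨p.map ((algebraMap (IntermediateField.adjoin k {w}) K).codRestrict P.val.integer
        fun a => hF a a.2), hp.map _, ?_⟩
      rw [eval₂_map]
      exact hpz
    exact (Valuation.integer.integers P.val).mem_of_integral hint
  obtain ⟨e, he⟩ := P.surjective (WithZero.exp 1)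
  have := hall e
  rw [he, ← WithZero.exp_zero, WithZero.exp_le_exp] at this
  omega

/-- Two functions of the same pole order at `P`, the second nonzero, differ by a constant multiple
up to lower order. -/
lemma Place.exists_val_sub_smul_lt [IsAlgClosed k] (hK : IsFunctionField k K)
    (P : Place k K) {e w : K} {n : ℤ} (he : P.val e = WithZero.exp n) (hw : P.val w ≤ WithZero.exp n) :
    ∃ c : k, P.val (w - c • e) ≤ WithZero.exp (n - 1) := by
  have he0 : e ≠ 0 := by
    rintro rfl
    exact WithZero.exp_ne_zero (he.symm.trans (map_zero _))
  obtain ⟨c, hc⟩ := P.val_sub_algebraMap_lt_one hK (w := w / e) (by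
    rw [map_div₀, he]; exact div_le_one_of_le₀ hw zero_le)
  refine ⟨c, ?_⟩
  have : w - c • e = (w / e - algebraMap k K c) * e := by
    rw [sub_mul, div_mul_cancel₀ _ he0, Algebra.smul_def]
  rw [this, map_mul, he]
  rcases eq_or_ne (P.val (w / e - algebraMap k K c)) 0 with h0 | h0
  · simp [h0]
  obtain ⟨m, hm⟩ := exists_exp_of_ne_zero h0
  rw [hm, ← WithZero.exp_zero, WithZero.exp_lt_exp] at hc
  rw [hm, ← WithZero.exp_add, WithZero.exp_le_exp]
  omega

/-- The divisor of poles of a function. -/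
lemma exists_poleDivisor [IsAlgClosed k] [CharZero k] (hK : IsFunctionField k K) (z : K) :
    ∃ D : Divisor k K, ∀ P, WithZero.exp (D P) = max 1 (P.val z) := by
  refine ⟨Finsupp.ofSupportFinite (fun P => WithZero.log (max 1 (P.val z))) ?_, fun P => ?_⟩
  · refine (finite_poles hK z).subset fun P hP => ?_
    rw [Set.mem_ofPred_eq]
    by_contra! h
    rw [Function.mem_support, max_eq_left h] at hP
    simp at hP
  · exact WithZero.exp_log (zero_lt_one.trans_le (le_max_left _ _)).ne'

end Poles

end Curve

namespace Curve

/-! ### Divisors, their degrees, and Riemann-Roch spaces. -/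

section Divisors

variable {k K : Type*} [Field k] [Field K] [Algebra k K]

lemma Divisor.degree_add (D E : Divisor k K) : (D + E).degree = D.degree + E.degree :=
  Finsupp.sum_add_index' (fun _ => rfl) (fun _ _ _ => rfl)

@[simp] lemma Divisor.degree_zero : (0 : Divisor k K).degree = 0 := Finsupp.sum_zero_index

@[simp] lemma Divisor.degree_single (P : Place k K) (n : ℤ) :
    Divisor.degree (Finsupp.single P n) = n := Finsupp.sum_single_index rfl

lemma Divisor.degree_sub (D E : Divisor k K) : (D - E).degree = D.degree - E.degree := by
  have := Divisor.degree_add (D - E) E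
  rw [sub_add_cancel] at this
  omega

lemma Divisor.degree_neg (D : Divisor k K) : (-D).degree = -D.degree := by
  rw [← zero_sub, Divisor.degree_sub, Divisor.degree_zero, zero_sub]

lemma Divisor.degree_nsmul (n : ℕ) (D : Divisor k K) : (n • D).degree = n * D.degree := by
  induction n with
  | zero => simp
  | succ n ih => rw [succ_nsmul, Divisor.degree_add, ih]; push_cast; ring

lemma Divisor.degree_nonneg {D : Divisor k K} (hD : 0 ≤ D) : 0 ≤ D.degree :=
  Finset.sum_nonneg fun P _ => hD P

lemma Divisor.degree_mono {D E : Divisor k K} (h : D ≤ E) : D.degree ≤ E.degree := by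
  have := Divisor.degree_nonneg (sub_nonneg.2 h)
  rw [Divisor.degree_sub] at this
  omega

lemma Divisor.exists_lt {D E : Divisor k K} (h : D ≤ E) (hne : D ≠ E) :
    ∃ P, D + Finsupp.single P 1 ≤ E := by
  classical
  by_contra! hc
  refine hne (le_antisymm h fun P => not_lt.1 fun hlt => hc P fun Q => ?_)
  rw [Finsupp.add_apply, Finsupp.single_apply]
  split_ifs with hPQ
  · subst hPQ; exact hlt
  · simpa using h Q

lemma Divisor.le_induction {p : Divisor k K → Prop} (D : Divisor k K) (h0 : p D)
    (hs : ∀ E, D ≤ E → ∀ P, p E → p (E + Finsupp.single P 1)) : ∀ D', D ≤ D' → p D' := by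
  suffices h : ∀ n : ℕ, ∀ D', D ≤ D' → (D' - D).degree ≤ n → p D' from fun D' hD' =>
    h (D' - D).degree.toNat D' hD' (Int.self_le_toNat _)
  intro n
  induction n with
  | zero =>
    intro D' hD' hn
    by_cases hne : D = D'
    · exact hne ▸ h0
    obtain ⟨P, hP⟩ := Divisor.exists_lt hD' hne
    have := Divisor.degree_mono hP
    rw [Divisor.degree_add, Divisor.degree_single] at this
    rw [Divisor.degree_sub] at hn
    push_cast at hn
    omega
  | succ n ih =>
    intro D' hD' hn
    by_cases hne : D = D'
    · exact hne ▸ h0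
    obtain ⟨P, hP⟩ := Divisor.exists_lt hD' hne
    have := hs (D' - Finsupp.single P 1) (le_sub_iff_add_le.2 hP) P
      (ih _ (le_sub_iff_add_le.2 hP) (by
        rw [Divisor.degree_sub, Divisor.degree_sub, Divisor.degree_single]
        rw [Divisor.degree_sub] at hn
        push_cast at hn
        omega))
    rwa [sub_add_cancel] at this

lemma add_single_apply_of_ne {D : Divisor k K} {P Q : Place k K} (h : Q ≠ P) :
    (D + Finsupp.single P 1 : Divisor k K) Q = D Q := by
  rw [Finsupp.add_apply, Finsupp.single_eq_of_ne h, add_zero]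

lemma add_single_apply_same (D : Divisor k K) (P : Place k K) :
    (D + Finsupp.single P 1 : Divisor k K) P = D P + 1 := by
  rw [Finsupp.add_apply, Finsupp.single_eq_same]

lemma le_add_single (D : Divisor k K) (P : Place k K) : D ≤ D + Finsupp.single P 1 :=
  le_add_of_nonneg_right (by simp)

lemma riemannRochSpace_mono {D E : Divisor k K} (h : D ≤ E) :
    riemannRochSpace D ≤ riemannRochSpace E := fun _ hf P =>
  (hf P).trans (WithZero.exp_le_exp.2 (h P))

lemma mem_riemannRochSpace_of_add_single {D : Divisor k K} {P : Place k K} {z : K}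
    (hz : z ∈ riemannRochSpace (D + Finsupp.single P 1)) (hP : P.val z ≤ WithZero.exp (D P)) :
    z ∈ riemannRochSpace D := fun Q => by
  rcases eq_or_ne Q P with rfl | h
  · exact hP
  · rw [← add_single_apply_of_ne h]; exact hz Q

lemma val_eq_of_notMem {D : Divisor k K} {P : Place k K} {z : K}
    (hz : z ∈ riemannRochSpace (D + Finsupp.single P 1)) (hz' : z ∉ riemannRochSpace D) :
    P.val z = WithZero.exp (D P + 1) := by
  have h1 := hz P
  rw [add_single_apply_same] at h1
  refine le_antisymm h1 ?_
  have h2 : ¬ P.val z ≤ WithZero.exp (D P) := fun h => hz' (mem_riemannRochSpace_of_add_single hz h)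
  have h0 : P.val z ≠ 0 := fun h => h2 (by rw [h]; exact zero_le)
  obtain ⟨m, hm⟩ := exists_exp_of_ne_zero h0
  rw [hm, WithZero.exp_le_exp] at h2 ⊢
  omega

lemma mul_mem_riemannRochSpace {D E : Divisor k K} {f g : K} (hf : f ∈ riemannRochSpace D)
    (hg : g ∈ riemannRochSpace E) : f * g ∈ riemannRochSpace (D + E) := fun P => by
  rw [map_mul, Finsupp.add_apply, WithZero.exp_add]
  exact mul_le_mul' (hf P) (hg P)

lemma one_mem_riemannRochSpace {D : Divisor k K} (hD : 0 ≤ D) : (1 : K) ∈ riemannRochSpace D :=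
  fun P => by
    rw [map_one, ← WithZero.exp_zero, WithZero.exp_le_exp]
    exact hD P

end Divisors

/-! ### Dimensions when a subspace grows by one vector. -/

section LinearAlgebra

variable {k T : Type*} [Field k] [AddCommGroup T] [Module k T]

lemma finrank_quotient_sup_span_singleton {V V' : Submodule k T} {e : T} (he : e ∉ V)
    (hV : V' = V ⊔ Submodule.span k {e}) [Module.Finite k (T ⧸ V')] :
    Module.Finite k (T ⧸ V) ∧ Module.finrank k (T ⧸ V) = Module.finrank k (T ⧸ V') + 1 := by
  have hle : V ≤ V' := hV ▸ le_sup_left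
  have hmap : V'.map V.mkQ = Submodule.span k {V.mkQ e} := by
    rw [hV, Submodule.map_sup, Submodule.map_span, Set.image_singleton]
    simp
  have eqv := Submodule.quotientQuotientEquivQuotient V V' hle
  rw [hmap] at eqv
  have h1 : Module.Finite k ((T ⧸ V) ⧸ Submodule.span k {V.mkQ e}) := Module.Finite.equiv eqv.symm
  have h2 : Module.Finite k (T ⧸ V) := Module.Finite.of_submodule_quotient (Submodule.span k {V.mkQ e})
  refine ⟨h2, ?_⟩
  rw [← Submodule.finrank_quotient_add_finrank (Submodule.span k {V.mkQ e}), eqv.finrank_eq,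
    finrank_span_singleton]
  simpa using he

lemma finrank_sup_span_singleton {V V' : Submodule k T} {e : T} (he : e ∉ V)
    (hV : V' = V ⊔ Submodule.span k {e}) [Module.Finite k V] :
    Module.finrank k V' = Module.finrank k V + 1 := by
  have := Submodule.finrank_sup_add_finrank_inf_eq V (Submodule.span k {e})
  rw [← hV, finrank_span_singleton (by rintro rfl; exact he V.zero_mem)] at this
  have hinf : V ⊓ Submodule.span k {e} = ⊥ := by
    rw [← disjoint_iff, Submodule.disjoint_span_singleton]
    exact fun h => absurd h he
  rw [hinf, finrank_bot] at this
  omega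

end LinearAlgebra

/-! ### Adeles, and the effect of adding one point to a divisor. -/

section Adeles

variable {k K : Type*} [Field k] [IsAlgClosed k] [CharZero k] [Field K] [Algebra k K]

/-- The ring of adeles (repartitions) of `K`, as a `K`-module. -/
def adeles (hK : IsFunctionField k K) : Submodule K (Place k K → K) where
  carrier := {a | ∃ D : Divisor k K, ∀ P, P.val (a P) ≤ WithZero.exp (D P)}
  zero_mem' := ⟨0, fun P => by simp⟩
  add_mem' := by
    rintro a b ⟨D, hD⟩ ⟨E, hE⟩
    refine ⟨D ⊔ E, fun P => (P.val.map_add _ _).trans (max_le ?_ ?_)⟩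
    · exact (hD P).trans (WithZero.exp_le_exp.2 (le_sup_left (a := D) (b := E) P))
    · exact (hE P).trans (WithZero.exp_le_exp.2 (le_sup_right (a := D) (b := E) P))
  smul_mem' := by
    rintro c a ⟨D, hD⟩
    obtain ⟨E, hE⟩ := exists_poleDivisor hK c
    refine ⟨E + D, fun P => ?_⟩
    rw [Pi.smul_apply, smul_eq_mul, map_mul, Finsupp.add_apply, WithZero.exp_add]
    exact mul_le_mul' ((le_max_right _ _).trans (hE P).ge) (hD P)

variable (hK : IsFunctionField k K)

/-- The adeles with poles bounded by `D`. -/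
def boundedAdeles (D : Divisor k K) : Submodule k (adeles hK) where
  carrier := {a | ∀ P, P.val (a.1 P) ≤ WithZero.exp (D P)}
  zero_mem' P := by simp
  add_mem' ha hb P := (P.val.map_add _ _).trans (max_le (ha P) (hb P))
  smul_mem' c a ha P := by
    change P.val ((c • a.1) P) ≤ _
    rw [Pi.smul_apply, Algebra.smul_def, map_mul]
    exact (mul_le_mul' (P.le_one c) (ha P)).trans (one_mul _).le

/-- The principal adele of a function. -/
def principalAdele : K →ₗ[K] adeles hK where
  toFun z := ⟨fun _ => z, by
    obtain ⟨E, hE⟩ := exists_poleDivisor hK z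
    exact ⟨E, fun P => (le_max_right _ _).trans (hE P).ge⟩⟩
  map_add' _ _ := rfl
  map_smul' _ _ := rfl

open scoped Classical in
/-- The adele with value `z` at `P` and `0` elsewhere. -/
noncomputable def singleAdele (P : Place k K) (z : K) : adeles hK :=
  ⟨Pi.single P z, by
    obtain ⟨E, hE⟩ := exists_poleDivisor hK z
    refine ⟨E, fun Q => ?_⟩
    rcases eq_or_ne Q P with rfl | h
    · rw [Pi.single_eq_same]; exact (le_max_right _ _).trans (hE Q).ge
    · rw [Pi.single_eq_of_ne h]; simp⟩

@[simp] lemma singleAdele_same (P : Place k K) (z : K) : (singleAdele hK P z).1 P = z := by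
  simp [singleAdele]

lemma singleAdele_of_ne {P Q : Place k K} (h : Q ≠ P) (z : K) : (singleAdele hK P z).1 Q = 0 := by
  simp [singleAdele, h]

/-- `A(D) + K`, whose quotient in the adeles is the first cohomology of `D`. -/
def boundedAddPrincipal (D : Divisor k K) : Submodule k (adeles hK) :=
  boundedAdeles hK D ⊔ (LinearMap.range (principalAdele hK)).restrictScalars k

variable {hK}

lemma boundedAdeles_mono {D E : Divisor k K} (h : D ≤ E) :
    boundedAdeles hK D ≤ boundedAdeles hK E := fun _ ha P =>
  (ha P).trans (WithZero.exp_le_exp.2 (h P))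

lemma boundedAddPrincipal_mono {D E : Divisor k K} (h : D ≤ E) :
    boundedAddPrincipal hK D ≤ boundedAddPrincipal hK E :=
  sup_le_sup_right (boundedAdeles_mono h) _

lemma mem_boundedAddPrincipal {D : Divisor k K} {a : adeles hK} :
    a ∈ boundedAddPrincipal hK D ↔
      ∃ b ∈ boundedAdeles hK D, ∃ z : K, b + principalAdele hK z = a := by
  simp [boundedAddPrincipal, Submodule.mem_sup]

lemma principalAdele_mem_boundedAdeles {D : Divisor k K} {z : K} :
    principalAdele hK z ∈ boundedAdeles hK D ↔ z ∈ riemannRochSpace D := Iff.rfl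

lemma principalAdele_mem (D : Divisor k K) (z : K) :
    principalAdele hK z ∈ boundedAddPrincipal hK D :=
  le_sup_right (a := boundedAdeles hK D) ⟨z, rfl⟩

lemma riemannRochSpace_add_single {D : Divisor k K} {P : Place k K} {z : K}
    (hK : IsFunctionField k K)
    (hz : z ∈ riemannRochSpace (D + Finsupp.single P 1)) (hz' : z ∉ riemannRochSpace D) :
    riemannRochSpace (D + Finsupp.single P 1) = riemannRochSpace D ⊔ Submodule.span k {z} := by
  refine le_antisymm (fun w hw => ?_) (sup_le (riemannRochSpace_mono (le_add_single D P)) ?_)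
  · have h1 := hw P
    rw [add_single_apply_same] at h1
    obtain ⟨c, hc⟩ := P.exists_val_sub_smul_lt hK (val_eq_of_notMem hz hz') h1
    rw [add_sub_cancel_right] at hc
    rw [Submodule.mem_sup]
    exact ⟨w - c • z, mem_riemannRochSpace_of_add_single (sub_mem hw (Submodule.smul_mem _ c hz)) hc,
      c • z, Submodule.smul_mem _ _ (Submodule.mem_span_singleton_self z), sub_add_cancel _ _⟩
  · rwa [Submodule.span_singleton_le_iff_mem]

lemma exists_sub_smul_mem_boundedAdeles {D : Divisor k K} {P : Place k K} {e : K}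
    (he : P.val e = WithZero.exp (D P + 1)) {a : adeles hK}
    (ha : a ∈ boundedAdeles hK (D + Finsupp.single P 1)) :
    ∃ c : k, a - c • singleAdele hK P e ∈ boundedAdeles hK D := by
  have h1 := ha P
  rw [add_single_apply_same] at h1
  obtain ⟨c, hc⟩ := P.exists_val_sub_smul_lt hK he h1
  rw [add_sub_cancel_right] at hc
  refine ⟨c, fun Q => ?_⟩
  change Q.val (a.1 Q - c • (singleAdele hK P e).1 Q) ≤ _
  rcases eq_or_ne Q P with rfl | h
  · rw [singleAdele_same]; exact hc
  · rw [singleAdele_of_ne hK h, smul_zero, sub_zero, ← add_single_apply_of_ne h]; exact ha Q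

lemma singleAdele_mem {D : Divisor k K} {P : Place k K} {e : K} :
    singleAdele hK P e ∈ boundedAdeles hK D ↔ P.val e ≤ WithZero.exp (D P) := by
  refine ⟨fun h => by simpa using h P, fun h Q => ?_⟩
  rcases eq_or_ne Q P with rfl | hQ
  · rwa [singleAdele_same]
  · rw [singleAdele_of_ne hK hQ]; simp

lemma boundedAddPrincipal_add_single {D : Divisor k K} {P : Place k K} {e : K}
    (he : P.val e = WithZero.exp (D P + 1)) :
    boundedAddPrincipal hK (D + Finsupp.single P 1) =
      boundedAddPrincipal hK D ⊔ Submodule.span k {singleAdele hK P e} := by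
  refine le_antisymm (fun a ha => ?_) (sup_le (boundedAddPrincipal_mono (le_add_single D P)) ?_)
  · obtain ⟨b, hb, z, rfl⟩ := mem_boundedAddPrincipal.1 ha
    obtain ⟨c, hc⟩ := exists_sub_smul_mem_boundedAdeles he hb
    rw [Submodule.mem_sup]
    refine ⟨b - c • singleAdele hK P e + principalAdele hK z,
      mem_boundedAddPrincipal.2 ⟨_, hc, z, rfl⟩, c • singleAdele hK P e,
      Submodule.smul_mem _ _ (Submodule.mem_span_singleton_self _), by abel⟩
  · rw [Submodule.span_singleton_le_iff_mem]
    refine le_sup_left (α := Submodule k (adeles hK)) (singleAdele_mem.2 ?_)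
    rw [he, add_single_apply_same]

/-- The function `z` already supplies the new pole: its principal adele and the adele equal to `z`
at `P` alone differ by an element of `A(D)`. -/
lemma boundedAddPrincipal_add_single_of_notMem {D : Divisor k K} {P : Place k K} {z : K}
    (hz : z ∈ riemannRochSpace (D + Finsupp.single P 1)) (hz' : z ∉ riemannRochSpace D) :
    boundedAddPrincipal hK (D + Finsupp.single P 1) = boundedAddPrincipal hK D := by
  have he := val_eq_of_notMem hz hz'
  rw [boundedAddPrincipal_add_single he, sup_eq_left, Submodule.span_singleton_le_iff_mem,
    mem_boundedAddPrincipal]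
  refine ⟨singleAdele hK P z - principalAdele hK z, fun Q => ?_, z, sub_add_cancel _ _⟩
  change Q.val ((singleAdele hK P z).1 Q - z) ≤ _
  rcases eq_or_ne Q P with rfl | h
  · rw [singleAdele_same]; simp
  · rw [singleAdele_of_ne hK h, zero_sub, Valuation.map_neg, ← add_single_apply_of_ne h]; exact hz Q

/-- If the adele were `b + z` with `b` in `A(D)`, then `z` would lie in `L(D + P) = L(D)`, and `e`
would have too small a pole at `P`. -/
lemma singleAdele_notMem_of_riemannRochSpace_eq {D : Divisor k K} {P : Place k K} {e : K}
    (he : P.val e = WithZero.exp (D P + 1))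
    (h : riemannRochSpace (D + Finsupp.single P 1) ≤ riemannRochSpace D) :
    singleAdele hK P e ∉ boundedAddPrincipal hK D := by
  intro hmem
  obtain ⟨b, hb, z, hbz⟩ := mem_boundedAddPrincipal.1 hmem
  have hz : z ∈ riemannRochSpace D := by
    apply h
    rw [← principalAdele_mem_boundedAdeles (hK := hK), eq_sub_of_add_eq' hbz]
    refine sub_mem (singleAdele_mem.2 ?_) (boundedAdeles_mono (le_add_single D P) hb)
    rw [he, add_single_apply_same]
  have := singleAdele_mem.1 (hbz ▸ add_mem hb (principalAdele_mem_boundedAdeles.2 hz))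
  rw [he, WithZero.exp_le_exp] at this
  omega

end Adeles

end Curve

namespace Curve

/-! ### Riemann-Roch for the quotient of the adeles by `A(D) + K`. -/

section RiemannRoch

variable {k K : Type*} [Field k] [IsAlgClosed k] [CharZero k] [Field K] [Algebra k K]

lemma mem_range_of_forall_le_one (hK : IsFunctionField k K) {z : K}
    (hz : ∀ P : Place k K, P.val z ≤ 1) : z ∈ Set.range (algebraMap k K) := by
  by_contra h
  obtain ⟨P, hP⟩ := exists_pole hK (transcendental_of_notMem_range h)
  exact absurd hP (not_lt.2 (hz P))

lemma riemannRochSpace_zero (hK : IsFunctionField k K) :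
    riemannRochSpace (0 : Divisor k K) = Submodule.span k {1} := by
  refine le_antisymm (fun z hz => ?_) ?_
  · obtain ⟨c, rfl⟩ := mem_range_of_forall_le_one hK (z := z) fun P => by simpa using hz P
    exact Submodule.mem_span_singleton.2 ⟨c, (Algebra.algebraMap_eq_smul_one c).symm⟩
  · rw [Submodule.span_singleton_le_iff_mem]
    exact one_mem_riemannRochSpace le_rfl

lemma finrank_riemannRochSpace_zero (hK : IsFunctionField k K) :
    Module.finrank k (riemannRochSpace (0 : Divisor k K)) = 1 := by
  rw [riemannRochSpace_zero hK, finrank_span_singleton one_ne_zero]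

lemma finite_riemannRochSpace (hK : IsFunctionField k K) (D : Divisor k K) :
    Module.Finite k (riemannRochSpace D) := by
  have h : ∀ E : Divisor k K, 0 ≤ E → Module.Finite k (riemannRochSpace E) := by
    refine Divisor.le_induction 0 ?_ ?_
    · rw [riemannRochSpace_zero hK]; infer_instance
    · intro E _ P hE
      by_cases hc : riemannRochSpace (E + Finsupp.single P 1) ≤ riemannRochSpace E
      · rwa [le_antisymm hc (riemannRochSpace_mono (le_add_single E P))]
      · obtain ⟨z, hz, hz'⟩ := Set.not_subset.1 hc
        rw [riemannRochSpace_add_single hK hz hz']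
        infer_instance
  have := h (D ⊔ 0) le_sup_right
  exact Submodule.finiteDimensional_of_le (riemannRochSpace_mono (le_sup_left (a := D) (b := 0)))

/-- The index of speciality `ℓ(D) - deg D - 1 + g`. -/
noncomputable def speciality (g : ℕ) (D : Divisor k K) : ℤ :=
  Module.finrank k (riemannRochSpace D) - D.degree - 1 + g

/-- The dichotomy behind Riemann-Roch: one more point either adds a function or kills one dimension
of the adeles modulo `A(D) + K`. The speciality drops exactly in the second case. -/
lemma step_add_single (hK : IsFunctionField k K) (g : ℕ) (D : Divisor k K) (P : Place k K) :
    (boundedAddPrincipal hK (D + Finsupp.single P 1) = boundedAddPrincipal hK D ∧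
      speciality g (D + Finsupp.single P 1) = speciality g D) ∨
    (∃ e ∉ boundedAddPrincipal hK D, boundedAddPrincipal hK (D + Finsupp.single P 1) =
        boundedAddPrincipal hK D ⊔ Submodule.span k {e} ∧
      speciality g (D + Finsupp.single P 1) = speciality g D - 1) := by
  have := finite_riemannRochSpace hK D
  by_cases hc : riemannRochSpace (D + Finsupp.single P 1) ≤ riemannRochSpace D
  · right
    obtain ⟨e, he⟩ := P.surjective (WithZero.exp (D P + 1))
    refine ⟨singleAdele hK P e, singleAdele_notMem_of_riemannRochSpace_eq he hc,
      boundedAddPrincipal_add_single he, ?_⟩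
    unfold speciality
    rw [le_antisymm hc (riemannRochSpace_mono (le_add_single D P)), Divisor.degree_add,
      Divisor.degree_single]
    ring
  · left
    obtain ⟨z, hz, hz'⟩ := Set.not_subset.1 hc
    refine ⟨boundedAddPrincipal_add_single_of_notMem hz hz', ?_⟩
    unfold speciality
    rw [finrank_sup_span_singleton hz' (riemannRochSpace_add_single hK hz hz'), Divisor.degree_add,
      Divisor.degree_single]
    push_cast
    ring

lemma speciality_anti (hK : IsFunctionField k K) (g : ℕ) {D E : Divisor k K} (h : D ≤ E) :
    speciality g E ≤ speciality g D := by
  refine Divisor.le_induction (p := fun E => speciality g E ≤ speciality g D) D le_rfl ?_ E h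
  intro E _ P hE
  rcases step_add_single hK g E P with ⟨-, h⟩ | ⟨-, -, -, h⟩ <;> omega

lemma finrank_le_degree_add_one (hK : IsFunctionField k K) {D : Divisor k K} (h : 0 ≤ D) :
    (Module.finrank k (riemannRochSpace D) : ℤ) ≤ D.degree + 1 := by
  have := speciality_anti hK 0 h
  unfold speciality at this
  rw [finrank_riemannRochSpace_zero hK, Divisor.degree_zero] at this
  push_cast at this
  omega

lemma speciality_nonneg {g : ℕ} (hg : HasGenus k K g) (D : Divisor k K) : 0 ≤ speciality g D := by
  have := hg.2 ⟨D, rfl⟩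
  unfold speciality
  omega

lemma exists_speciality_eq_zero {g : ℕ} (hg : HasGenus k K g) :
    ∃ D : Divisor k K, speciality g D = 0 := by
  obtain ⟨D, hD⟩ := hg.1
  refine ⟨D, ?_⟩
  unfold speciality
  omega

/-- A vanishing speciality cannot drop further, so `A(E) + K` is constant for `E ≥ D`; and every
adele is bounded by some such `E`. -/
lemma boundedAddPrincipal_eq_top (hK : IsFunctionField k K) {g : ℕ} (hg : HasGenus k K g)
    {D : Divisor k K} (hD : speciality g D = 0) : boundedAddPrincipal hK D = ⊤ := by
  have key : ∀ E, D ≤ E → boundedAddPrincipal hK E = boundedAddPrincipal hK D ∧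
      speciality g E = 0 := by
    refine Divisor.le_induction D ⟨rfl, hD⟩ ?_
    rintro E - P ⟨hE, hE0⟩
    rcases step_add_single hK g E P with ⟨h1, h2⟩ | ⟨-, -, -, h2⟩
    · exact ⟨h1.trans hE, h2.trans hE0⟩
    · have := speciality_nonneg hg (E + Finsupp.single P 1)
      omega
  rw [eq_top_iff]
  rintro a -
  obtain ⟨E, hE⟩ := a.2
  rw [← (key (D ⊔ E) le_sup_left).1]
  exact le_sup_left (α := Submodule k (adeles hK)) (boundedAdeles_mono le_sup_right (fun P => hE P))

lemma speciality_eq_zero_of_boundedAddPrincipal_eq_top (hK : IsFunctionField k K) {g : ℕ}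
    (hg : HasGenus k K g) {D : Divisor k K} (hD : boundedAddPrincipal hK D = ⊤) :
    speciality g D = 0 := by
  have key : ∀ E, D ≤ E → boundedAddPrincipal hK E = ⊤ ∧
      speciality g E = speciality g D := by
    refine Divisor.le_induction D ⟨hD, rfl⟩ ?_
    rintro E - P ⟨hE, hE0⟩
    rcases step_add_single hK g E P with ⟨h1, h2⟩ | ⟨e, he, -, -⟩
    · exact ⟨h1.trans hE, h2.trans hE0⟩
    · rw [hE] at he
      exact absurd Submodule.mem_top he
  obtain ⟨E, hE⟩ := exists_speciality_eq_zero hg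
  rw [← (key (D ⊔ E) le_sup_left).2]
  exact le_antisymm (hE ▸ speciality_anti hK g le_sup_right) (speciality_nonneg hg _)

/-- Above `D` there is a nonspecial divisor, where both sides vanish. Going down from it to `D`,
each removed point changes both sides equally. -/
lemma finrank_quotient_boundedAddPrincipal (hK : IsFunctionField k K) {g : ℕ}
    (hg : HasGenus k K g) (D : Divisor k K) :
    Module.Finite k (adeles hK ⧸ boundedAddPrincipal hK D) ∧
      (Module.finrank k (adeles hK ⧸ boundedAddPrincipal hK D) : ℤ) = speciality g D := by
  have key : ∀ E, D ≤ E → Module.Finite k (adeles hK ⧸ boundedAddPrincipal hK E) →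
      Module.Finite k (adeles hK ⧸ boundedAddPrincipal hK D) ∧
      (Module.finrank k (adeles hK ⧸ boundedAddPrincipal hK D) : ℤ) =
        Module.finrank k (adeles hK ⧸ boundedAddPrincipal hK E) +
          (speciality g D - speciality g E) := by
    refine Divisor.le_induction D (fun h => ⟨h, by ring⟩) ?_
    rintro E - P hE hfin
    rcases step_add_single hK g E P with ⟨h1, h2⟩ | ⟨e, he, h1, h2⟩
    · rw [h1] at hfin ⊢
      rw [h2]
      exact hE hfin
    · obtain ⟨h3, h4⟩ := finrank_quotient_sup_span_singleton he h1
      obtain ⟨h5, h6⟩ := hE h3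
      refine ⟨h5, ?_⟩
      rw [h6, h4, h2]
      push_cast
      ring
  obtain ⟨E, hE⟩ := exists_speciality_eq_zero hg
  have h0 : speciality g (D ⊔ E) = 0 :=
    le_antisymm (hE ▸ speciality_anti hK g le_sup_right) (speciality_nonneg hg _)
  have htop := boundedAddPrincipal_eq_top hK hg h0
  have hsub : Subsingleton (adeles hK ⧸ boundedAddPrincipal hK (D ⊔ E)) :=
    Submodule.Quotient.subsingleton_iff.2 htop
  obtain ⟨h1, h2⟩ := key (D ⊔ E) le_sup_left inferInstance
  refine ⟨h1, ?_⟩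
  rw [h2, h0, Module.finrank_zero_of_subsingleton]
  simp

/-- Multiplication of adeles by a function. -/
def mulAdele (hK : IsFunctionField k K) (f : K) : adeles hK →ₗ[k] adeles hK :=
  Algebra.lsmul k k (adeles hK) f

lemma mulAdele_apply (hK : IsFunctionField k K) (f : K) (a : adeles hK) (P : Place k K) :
    (mulAdele hK f a).1 P = f * a.1 P := rfl

lemma mulAdele_principalAdele (hK : IsFunctionField k K) (f z : K) :
    mulAdele hK f (principalAdele hK z) = principalAdele hK (f * z) := rfl

lemma mulAdele_mulAdele (hK : IsFunctionField k K) (f g : K) (a : adeles hK) :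
    mulAdele hK f (mulAdele hK g a) = mulAdele hK (f * g) a :=
  (mul_smul f g a).symm

lemma mulAdele_one (hK : IsFunctionField k K) (a : adeles hK) : mulAdele hK 1 a = a :=
  one_smul K a

lemma mulAdele_mem {hK : IsFunctionField k K} {D E : Divisor k K} {f : K}
    (hf : f ∈ riemannRochSpace E) {a : adeles hK} (ha : a ∈ boundedAdeles hK D) :
    mulAdele hK f a ∈ boundedAdeles hK (E + D) := fun P => by
  rw [mulAdele_apply, map_mul, Finsupp.add_apply, WithZero.exp_add]
  exact mul_le_mul' (hf P) (ha P)

lemma mulAdele_mem_boundedAddPrincipal {hK : IsFunctionField k K} {D E : Divisor k K} {f : K}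
    (hf : f ∈ riemannRochSpace E) {a : adeles hK} (ha : a ∈ boundedAddPrincipal hK D) :
    mulAdele hK f a ∈ boundedAddPrincipal hK (E + D) := by
  obtain ⟨b, hb, z, rfl⟩ := mem_boundedAddPrincipal.1 ha
  exact mem_boundedAddPrincipal.2 ⟨_, mulAdele_mem hf hb, f * z, by
    rw [map_add, mulAdele_principalAdele]⟩

/-- Large multiples of a nonzero effective divisor are nonspecial. -/
lemma exists_forall_speciality_nsmul_eq_zero (hK : IsFunctionField k K) {g : ℕ}
    (hg : HasGenus k K g) {D : Divisor k K} (hD : 0 ≤ D) (hD0 : D ≠ 0) :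
    ∃ N : ℕ, ∀ n ≥ N, speciality g (n • D) = 0 := by
  obtain ⟨E, hE⟩ := exists_speciality_eq_zero hg
  have hdeg : 1 ≤ D.degree := by
    obtain ⟨P, hP⟩ := Divisor.exists_lt hD hD0.symm
    have := Divisor.degree_mono hP
    rwa [zero_add, Divisor.degree_single] at this
  refine ⟨(E.degree + g + 1).toNat, fun n hn => ?_⟩
  -- Riemann's inequality provides a nonzero `f` in `L(nD - E)`. Multiplication by `f` is bijective
  -- on adeles and carries `A(E) + K`, which is everything, into `A(nD) + K`.
  have h1 := speciality_nonneg hg (n • D - E)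
  unfold speciality at h1
  rw [Divisor.degree_sub, Divisor.degree_nsmul] at h1
  have hn' : E.degree + g + 1 ≤ n := Int.toNat_le.1 hn
  have h2 : (n : ℤ) ≤ n * D.degree := by nlinarith
  have h3 : 0 < Module.finrank k (riemannRochSpace (n • D - E)) := by omega
  have := finite_riemannRochSpace hK (n • D - E)
  have h4 := Module.finrank_pos_iff_exists_ne_zero.1 h3
  obtain ⟨⟨f, hf⟩, hf0⟩ := h4
  have hf0' : f ≠ 0 := fun h => hf0 (Subtype.ext h)
  apply speciality_eq_zero_of_boundedAddPrincipal_eq_top hK hg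
  rw [eq_top_iff]
  rintro a -
  have := mulAdele_mem_boundedAddPrincipal hf (D := E) (a := mulAdele hK f⁻¹ a)
    (by rw [boundedAddPrincipal_eq_top hK hg hE]; trivial)
  rwa [mulAdele_mulAdele, mul_inv_cancel₀ hf0', mulAdele_one, sub_add_cancel] at this

end RiemannRoch

end Curve

namespace Curve

/-! ### Two-dimensional spaces and a dimension count for linear relations. -/

section LinearAlgebra

variable {k M A : Type*} [Field k] [AddCommGroup M] [Module k M] [AddCommGroup A] [Module k A]

lemma exists_mem_ne_zero_of_finrank_pos {V : Submodule k M} (h : 0 < Module.finrank k V) :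
    ∃ u ∈ V, u ≠ 0 := by
  apply Submodule.exists_mem_ne_zero_of_ne_bot
  rintro rfl
  simp at h

lemma exists_pair_of_finrank_eq_two {V : Submodule k M} (h : Module.finrank k V = 2) :
    ∃ u ∈ V, ∃ v ∈ V, u ≠ 0 ∧ v ≠ 0 ∧ ∀ c : k, c • u ≠ v := by
  have := Module.finite_of_finrank_pos (R := k) (M := V) (by omega)
  obtain ⟨u, hu, hu0⟩ := exists_mem_ne_zero_of_finrank_pos (V := V) (by omega)
  have hne : (⟨u, hu⟩ : V) ≠ 0 := fun h => hu0 (congrArg Subtype.val h)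
  obtain ⟨⟨v, hv⟩, hind⟩ := exists_linearIndependent_pair_of_one_lt_finrank
    (R := k) (M := V) (by omega) hne
  exact ⟨u, hu, v, hv, hu0, fun h => hind.ne_zero 1 (Subtype.ext h), fun c hc =>
    (LinearIndependent.pair_iff' hne).1 hind c (Subtype.ext hc)⟩

lemma finrank_span_pair {u v : M} (hu0 : u ≠ 0) (h : ∀ c : k, c • u ≠ v) :
    Module.finrank k (Submodule.span k {u, v}) = 2 := by
  have := finrank_span_eq_card ((LinearIndependent.pair_iff' hu0).2 h)
  rwa [Matrix.range_cons, Matrix.range_cons, Matrix.range_empty, Set.union_empty,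
    Set.singleton_union, Fintype.card_fin] at this

lemma span_pair_of_finrank_eq_two {V : Submodule k M} (hV : Module.finrank k V = 2) {u v : M}
    (hu : u ∈ V) (hv : v ∈ V) (hu0 : u ≠ 0) (h : ∀ c : k, c • u ≠ v) {w : M} (hw : w ∈ V) :
    ∃ a b : k, a • u + b • v = w := by
  have := Module.finite_of_finrank_pos (R := k) (M := V) (by omega)
  have hle : Submodule.span k {u, v} ≤ V := by
    rw [Submodule.span_le]
    rintro _ (rfl | rfl)
    exacts [hu, hv]
  rw [← Submodule.eq_of_le_of_finrank_eq hle ((finrank_span_pair hu0 h).trans hV.symm),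
    Submodule.mem_span_pair] at hw
  exact hw

lemma exists_add_eq_zero_of_finrank_lt [Module.Finite k A] {V : Submodule k M} [Module.Finite k V]
    {φ ψ : A →ₗ[k] M} (hφ : ∀ a, φ a ∈ V) (hψ : ∀ a, ψ a ∈ V)
    (h : Module.finrank k V < 2 * Module.finrank k A) :
    ∃ a b, (a, b) ≠ 0 ∧ φ a + ψ b = 0 := by
  let f : A × A →ₗ[k] V := LinearMap.coprod (φ.codRestrict V hφ) (ψ.codRestrict V hψ)
  have hlt : Module.finrank k V < Module.finrank k (A × A) := by
    rw [Module.finrank_prod]; omega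
  obtain ⟨⟨a, b⟩, hker, hne0⟩ :=
    Submodule.exists_mem_ne_zero_of_ne_bot (LinearMap.ker_ne_bot_of_finrank_lt (f := f) hlt)
  exact ⟨a, b, hne0, congrArg Subtype.val (LinearMap.mem_ker.1 hker)⟩

end LinearAlgebra

/-! ### Weil differentials and the function of degree two. -/

section Differentials

variable {k K : Type*} [Field k] [IsAlgClosed k] [CharZero k] [Field K] [Algebra k K]

/-- The Weil differentials with divisor at least `D`. -/
def differentials (hK : IsFunctionField k K) (D : Divisor k K) :
    Submodule k (Module.Dual k (adeles hK)) :=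
  (boundedAddPrincipal hK D).dualAnnihilator

/-- These functionals are the dual of the quotient of the adeles by `A(D) + K`. -/
lemma finrank_differentials (hK : IsFunctionField k K) {g : ℕ} (hg : HasGenus k K g)
    (D : Divisor k K) : Module.Finite k (differentials hK D) ∧
      (Module.finrank k (differentials hK D) : ℤ) = speciality g D := by
  obtain ⟨h1, h2⟩ := finrank_quotient_boundedAddPrincipal hK hg D
  have e := (boundedAddPrincipal hK D).dualQuotEquivDualAnnihilator
  refine ⟨Module.Finite.equiv e, ?_⟩
  rw [← h2, ← Subspace.dual_finrank_eq]
  exact_mod_cast e.finrank_eq.symm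

lemma mem_differentials {hK : IsFunctionField k K} {D : Divisor k K}
    {ω : Module.Dual k (adeles hK)} : ω ∈ differentials hK D ↔
      (∀ a ∈ boundedAdeles hK D, ω a = 0) ∧ ∀ z, ω (principalAdele hK z) = 0 := by
  unfold differentials
  rw [Submodule.mem_dualAnnihilator]
  refine ⟨fun h => ⟨fun a ha => h a (le_sup_left (α := Submodule k (adeles hK)) ha),
    fun z => h _ (principalAdele_mem D z)⟩, fun h a ha => ?_⟩
  obtain ⟨b, hb, z, rfl⟩ := mem_boundedAddPrincipal.1 ha
  rw [map_add, h.1 b hb, h.2 z, add_zero]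

/-- The product of a differential with functions. -/
def mulDifferential {hK : IsFunctionField k K} (ω : Module.Dual k (adeles hK)) :
    K →ₗ[k] Module.Dual k (adeles hK) where
  toFun f := ω ∘ₗ mulAdele hK f
  map_add' f g := by
    ext a
    change ω ((f + g) • a) = ω (f • a) + ω (g • a)
    rw [add_smul, map_add]
  map_smul' c f := by
    ext a
    change ω ((c • f) • a) = c • ω (f • a)
    rw [smul_assoc, map_smul]

lemma mulDifferential_apply {hK : IsFunctionField k K} (ω : Module.Dual k (adeles hK)) (f : K)
    (a : adeles hK) : mulDifferential ω f a = ω (mulAdele hK f a) := rfl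

lemma mulDifferential_one {hK : IsFunctionField k K} (ω : Module.Dual k (adeles hK)) :
    mulDifferential ω 1 = ω := by
  ext a
  rw [mulDifferential_apply, mulAdele_one]

lemma mulDifferential_mulDifferential {hK : IsFunctionField k K} (ω : Module.Dual k (adeles hK))
    (f g : K) : mulDifferential (mulDifferential ω f) g = mulDifferential ω (f * g) := by
  ext a
  rw [mulDifferential_apply, mulDifferential_apply, mulDifferential_apply, mulAdele_mulAdele]

lemma mulDifferential_injective {hK : IsFunctionField k K} {ω : Module.Dual k (adeles hK)}
    (hω : ω ≠ 0) : Function.Injective (mulDifferential ω) := by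
  rw [injective_iff_map_eq_zero]
  intro f hf
  by_contra hf0
  apply hω
  rw [← mulDifferential_one ω, ← mul_inv_cancel₀ hf0, ← mulDifferential_mulDifferential, hf]
  ext a
  rfl

lemma mulDifferential_mem {hK : IsFunctionField k K} {ω : Module.Dual k (adeles hK)}
    {D E : Divisor k K} (hω : ω ∈ differentials hK (E + D)) {f : K} (hf : f ∈ riemannRochSpace E) :
    mulDifferential ω f ∈ differentials hK D := by
  rw [mem_differentials] at hω ⊢
  exact ⟨fun a ha => hω.1 _ (mulAdele_mem hf ha), fun z => hω.2 (f * z)⟩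

lemma differentials_anti {hK : IsFunctionField k K} {D E : Divisor k K} (h : D ≤ E) :
    differentials hK E ≤ differentials hK D :=
  Submodule.dualAnnihilator_anti (boundedAddPrincipal_mono h)

lemma exists_place (hK : IsFunctionField k K) : Nonempty (Place k K) := by
  obtain ⟨x, hx, -⟩ := id hK
  obtain ⟨P, -⟩ := exists_pole hK hx
  exact ⟨P⟩

lemma riemannRochSpace_eq_bot (hK : IsFunctionField k K) {D : Divisor k K} (hD : D ≤ 0)
    {P : Place k K} (hP : D P < 0) : riemannRochSpace D = ⊥ := by
  rw [eq_bot_iff]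
  intro f hf
  have hf' := riemannRochSpace_mono hD hf
  obtain ⟨c, rfl⟩ := mem_range_of_forall_le_one hK (z := f) fun P => by simpa using hf' P
  rw [Submodule.mem_bot]
  by_contra hc
  have h1 := hf P
  rw [P.map_algebraMap (by rintro rfl; simp at hc), ← WithZero.exp_zero, WithZero.exp_le_exp] at h1
  omega

lemma finrank_differentials_zero (hK : IsFunctionField k K) {g : ℕ} (hg : HasGenus k K g) :
    Module.finrank k (differentials hK 0) = g := by
  have := (finrank_differentials hK hg 0).2
  unfold speciality at this
  rw [finrank_riemannRochSpace_zero hK, Divisor.degree_zero] at this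
  push_cast at this
  omega

/-- Two independent holomorphic differentials have a nonconstant ratio. -/
lemma exists_ratio (hK : IsFunctionField k K) (hg : HasGenus k K 2) :
    ∃ ω ∈ differentials hK 0, ω ≠ 0 ∧ ∃ h ∉ Set.range (algebraMap k K),
      mulDifferential ω h ∈ differentials hK 0 := by
  have hfin := (finrank_differentials hK hg 0).1
  have h2 := finrank_differentials_zero hK hg
  obtain ⟨P⟩ := exists_place hK
  obtain ⟨ω₁, hω₁, ω₂, hω₂, hω₁0, hω₂0, hind⟩ := exists_pair_of_finrank_eq_two h2
  -- In degree 4 the count succeeds: pairs of functions from `L(B)` form a space of dimension at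
  -- least 6, while the differentials with divisor at least `-B` have dimension 5. This forces a
  -- relation `f₁ω₁ + f₂ω₂ = 0`.
  set B : Divisor k K := Finsupp.single P 4 with hB
  have hBdeg : B.degree = 4 := Divisor.degree_single P 4
  have hmem : ∀ {ω}, ω ∈ differentials hK 0 → ∀ f : riemannRochSpace B,
      mulDifferential ω f ∈ differentials hK (-B) := fun hω f =>
    mulDifferential_mem (by rwa [add_neg_cancel]) f.2
  have hfB := finite_riemannRochSpace hK B
  have hfD := (finrank_differentials hK hg (-B)).1
  have hlt : Module.finrank k (differentials hK (-B)) <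
      2 * Module.finrank k (riemannRochSpace B) := by
    have h3 := (finrank_differentials hK hg (-B)).2
    have h4 := speciality_nonneg hg B
    unfold speciality at h3 h4
    rw [riemannRochSpace_eq_bot hK (P := P) (by rw [hB, neg_nonpos]; simp) (by simp [hB]),
      finrank_bot, Divisor.degree_neg, hBdeg] at h3
    rw [hBdeg] at h4
    push_cast at h3 h4
    omega
  obtain ⟨⟨f₁, hf₁⟩, ⟨f₂, hf₂⟩, hne0, hrel⟩ := exists_add_eq_zero_of_finrank_lt
    (φ := (mulDifferential ω₁).comp (riemannRochSpace B).subtype)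
    (ψ := (mulDifferential ω₂).comp (riemannRochSpace B).subtype) (hmem hω₁) (hmem hω₂) hlt
  replace hrel : mulDifferential ω₁ f₁ + mulDifferential ω₂ f₂ = 0 := hrel
  have hf₂0 : f₂ ≠ 0 := by
    rintro rfl
    rw [map_zero, add_zero] at hrel
    have : f₁ = 0 := mulDifferential_injective hω₁0 (by rw [hrel, map_zero])
    subst this
    exact hne0 rfl
  have hω : ω₂ = mulDifferential ω₁ (-f₁ * f₂⁻¹) := by
    rw [← mulDifferential_mulDifferential, map_neg, neg_eq_of_add_eq_zero_right hrel,
      mulDifferential_mulDifferential, mul_inv_cancel₀ hf₂0, mulDifferential_one]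
  refine ⟨ω₁, hω₁, hω₁0, _, ?_, hω ▸ hω₂⟩
  rintro ⟨c, hc⟩
  rw [← hc, Algebra.algebraMap_eq_smul_one, map_smul, mulDifferential_one] at hω
  exact hind c hω.symm

/-- Multiplication by `ω` embeds `L(D)` into the two-dimensional space of holomorphic differentials,
so `ℓ(D) ≤ 2`; the existence of `ω` makes the speciality of `D` positive, which bounds the degree.
-/
lemma degree_le_two (hK : IsFunctionField k K) (hg : HasGenus k K 2) {D : Divisor k K}
    {ω : Module.Dual k (adeles hK)} (hω : ω ∈ differentials hK D) (hω0 : ω ≠ 0) :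
    D.degree ≤ 2 := by
  obtain ⟨hf, hr⟩ := finrank_differentials hK hg D
  have hf0 := (finrank_differentials hK hg 0).1
  have hpos : 0 < Module.finrank k (differentials hK D) :=
    Module.finrank_pos_iff_exists_ne_zero.2 ⟨⟨ω, hω⟩, fun h => hω0 (congrArg Subtype.val h)⟩
  let φ : riemannRochSpace D →ₗ[k] differentials hK 0 :=
    ((mulDifferential ω).comp (riemannRochSpace D).subtype).codRestrict _
      (fun f => mulDifferential_mem (by rwa [add_zero]) f.2)
  have hφ : Function.Injective φ := fun f g h =>
    Subtype.ext (mulDifferential_injective hω0 (congrArg Subtype.val h))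
  have hle := LinearMap.finrank_le_finrank_of_injective hφ
  rw [finrank_differentials_zero hK hg] at hle
  unfold speciality at hr
  push_cast at hr
  omega

/-- A curve of genus two carries a nonconstant function with at most two poles. -/
lemma exists_degree_le_two (hK : IsFunctionField k K) (hg : HasGenus k K 2) :
    ∃ x ∉ Set.range (algebraMap k K), ∃ D : Divisor k K, 0 ≤ D ∧ D.degree ≤ 2 ∧
      x ∈ riemannRochSpace D := by
  obtain ⟨ω, hω, hω0, h, hh, hhω⟩ := exists_ratio hK hg
  -- An effective `D` of largest degree plays the role of the divisor of `ω`. Were the pole of `h`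
  -- at some `P` worse than `D` allows, `ω` would vanish even on `A(D + P)`, against maximality.
  obtain ⟨n, ⟨D, hD0, hD, rfl⟩, hmax⟩ := Int.exists_greatest_of_bdd
    (P := fun n => ∃ D : Divisor k K, 0 ≤ D ∧ ω ∈ differentials hK D ∧ D.degree = n)
    ⟨2, by rintro _ ⟨D, -, hD, rfl⟩; exact degree_le_two hK hg hD hω0⟩ ⟨0, 0, le_rfl, hω, by simp⟩
  refine ⟨h, hh, D, hD0, degree_le_two hK hg hD hω0, fun P => not_lt.1 fun hlt => ?_⟩
  have hh0 : h ≠ 0 := by rintro rfl; exact hh ⟨0, map_zero _⟩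
  have hmem : ω ∈ differentials hK (D + Finsupp.single P 1) := by
    rw [mem_differentials] at hD hhω ⊢
    refine ⟨fun a ha => ?_, hD.2⟩
    have h1 : a - singleAdele hK P (a.1 P) ∈ boundedAdeles hK D := fun Q => by
      change Q.val (a.1 Q - (singleAdele hK P (a.1 P)).1 Q) ≤ _
      rcases eq_or_ne Q P with rfl | hQ
      · rw [singleAdele_same, sub_self]; simp
      · rw [singleAdele_of_ne hK hQ, sub_zero, ← add_single_apply_of_ne hQ]; exact ha Q
    -- The pole of `a` at `P` has order at most `D P + 1`, and dividing by `h` removes it. So the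
    -- value of `ω` on this adele is a value of the holomorphic `hω` on `A(0)`, namely zero.
    have h2 : mulAdele hK h⁻¹ (singleAdele hK P (a.1 P)) ∈ boundedAdeles hK 0 := fun Q => by
      rw [mulAdele_apply, map_mul, map_inv₀]
      rcases eq_or_ne Q P with rfl | hQ
      · rw [singleAdele_same, Finsupp.coe_zero, Pi.zero_apply, WithZero.exp_zero]
        have h3 := ha Q
        rw [add_single_apply_same] at h3
        obtain ⟨m, hm⟩ := exists_exp_of_ne_zero (Q.val.ne_zero_iff.2 hh0)
        rw [hm, WithZero.exp_lt_exp] at hlt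
        rw [hm, ← WithZero.exp_neg]
        refine (mul_le_mul_right (h3.trans (WithZero.exp_le_exp.2 (Int.add_one_le_of_lt hlt))) _).trans ?_
        rw [← WithZero.exp_add, neg_add_cancel, WithZero.exp_zero]
      · rw [singleAdele_of_ne hK hQ]; simp
    have h4 := hhω.1 _ h2
    rw [mulDifferential_apply, mulAdele_mulAdele, mul_inv_cancel₀ hh0, mulAdele_one] at h4
    have h5 := hD.1 _ h1
    rwa [map_sub, h4, sub_zero] at h5
  have := hmax _ ⟨_, hD0.trans (le_add_single D P), hmem, rfl⟩
  rw [Divisor.degree_add, Divisor.degree_single] at this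
  omega

/-- `L(D)` contains 1 and `x`, so Riemann-Roch in degree at most two leaves a nonzero `ω` with
divisor at least `D`. Then `ω` and `xω` are holomorphic and independent, hence a basis. -/
lemma exists_differentials_eq_span (hK : IsFunctionField k K) (hg : HasGenus k K 2) {x : K}
    (hx : x ∉ Set.range (algebraMap k K)) {D : Divisor k K} (hD0 : 0 ≤ D) (hD : D.degree ≤ 2)
    (hxD : x ∈ riemannRochSpace D) : ∃ ω : Module.Dual k (adeles hK), ω ≠ 0 ∧
      ω ∈ differentials hK 0 ∧ mulDifferential ω x ∈ differentials hK 0 ∧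
      ∀ η ∈ differentials hK 0, ∃ a b : k,
        η = mulDifferential ω (algebraMap k K a * x + algebraMap k K b) := by
  have hfinD := finite_riemannRochSpace hK D
  have hind : ∀ a : k, a • (1 : K) ≠ x := fun a ha =>
    hx ⟨a, by rw [Algebra.algebraMap_eq_smul_one, ha]⟩
  have hl : 2 ≤ Module.finrank k (riemannRochSpace D) := by
    rw [← finrank_span_pair (k := k) (one_ne_zero (α := K)) hind]
    apply Submodule.finrank_mono
    rw [Submodule.span_le]
    rintro _ (rfl | rfl)
    exacts [one_mem_riemannRochSpace hD0, hxD]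
  obtain ⟨hf, hr⟩ := finrank_differentials hK hg D
  unfold speciality at hr
  have hpos : 0 < Module.finrank k (differentials hK D) := by push_cast at hr; omega
  obtain ⟨ω, hω, hω0⟩ := exists_mem_ne_zero_of_finrank_pos hpos
  have hx' : mulDifferential ω x ∈ differentials hK 0 := mulDifferential_mem (by rwa [add_zero]) hxD
  refine ⟨ω, hω0, differentials_anti hD0 hω, hx', fun η hη => ?_⟩
  obtain ⟨b, a, h⟩ := span_pair_of_finrank_eq_two (finrank_differentials_zero hK hg)
    (differentials_anti hD0 hω) hx' hω0 (fun c hc => hind c (mulDifferential_injective hω0 (by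
      rw [map_smul, mulDifferential_one, hc]))) hη
  refine ⟨a, b, ?_⟩
  rw [← h, map_add, ← Algebra.smul_def, map_smul, Algebra.algebraMap_eq_smul_one, map_smul,
    mulDifferential_one, add_comm]

end Differentials

/-! ### The action of automorphisms on holomorphic differentials. -/

section Automorphisms

variable {k K : Type*} [Field k] [Field K] [Algebra k K]

/-- The image of a place under an automorphism. -/
def Place.pull (σ : K ≃ₐ[k] K) (P : Place k K) : Place k K where
  val := P.val.comap (σ : K →+* K)
  surjective := P.surjective.comp σ.surjective
  le_one c := by
    rw [Valuation.comap_apply]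
    change P.val (σ (algebraMap k K c)) ≤ 1
    rw [AlgEquiv.commutes]
    exact P.le_one c

lemma Place.pull_val (σ : K ≃ₐ[k] K) (P : Place k K) (z : K) : (P.pull σ).val z = P.val (σ z) := rfl

lemma Place.pull_symm_pull (σ : K ≃ₐ[k] K) (P : Place k K) : (P.pull σ).pull σ.symm = P :=
  Place.ext_val fun z => by rw [Place.pull_val, Place.pull_val, AlgEquiv.apply_symm_apply]

lemma Place.pull_injective (σ : K ≃ₐ[k] K) : Function.Injective (Place.pull (k := k) σ) :=
  Function.LeftInverse.injective (Place.pull_symm_pull σ)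

variable [IsAlgClosed k] [CharZero k]

/-- The action of an automorphism on adeles. -/
noncomputable def pullAdele (hK : IsFunctionField k K) (σ : K ≃ₐ[k] K) : adeles hK →ₗ[k] adeles hK where
  toFun a := ⟨fun P => σ (a.1 (P.pull σ)), by
    obtain ⟨D, hD⟩ := a.2
    exact ⟨D.comapDomain (Place.pull σ) (Place.pull_injective σ).injOn, fun P => hD (P.pull σ)⟩⟩
  map_add' a b := Subtype.ext (funext fun P => map_add σ _ _)
  map_smul' c a := Subtype.ext (funext fun P => map_smul σ c _)

lemma pullAdele_apply (hK : IsFunctionField k K) (σ : K ≃ₐ[k] K) (a : adeles hK) (P : Place k K) :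
    (pullAdele hK σ a).1 P = σ (a.1 (P.pull σ)) := rfl

lemma pullAdele_surjective (hK : IsFunctionField k K) (σ : K ≃ₐ[k] K) :
    Function.Surjective (pullAdele hK σ) := fun a =>
  ⟨pullAdele hK σ.symm a, Subtype.ext (funext fun P => by
    rw [pullAdele_apply, pullAdele_apply, AlgEquiv.apply_symm_apply, Place.pull_symm_pull])⟩

lemma pull_mem_differentials {hK : IsFunctionField k K} (σ : K ≃ₐ[k] K)
    {ω : Module.Dual k (adeles hK)} (hω : ω ∈ differentials hK 0) :
    ω.comp (pullAdele hK σ) ∈ differentials hK 0 := by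
  rw [mem_differentials] at hω ⊢
  exact ⟨fun a ha => hω.1 _ fun P => ha (P.pull σ), fun z => hω.2 (σ z)⟩

lemma mulDifferential_comp_pullAdele {hK : IsFunctionField k K} (σ : K ≃ₐ[k] K)
    (ω : Module.Dual k (adeles hK)) (f : K) :
    (mulDifferential ω (σ f)).comp (pullAdele hK σ) =
      mulDifferential (ω.comp (pullAdele hK σ)) f := by
  ext a
  change ω _ = ω _
  congr 1
  exact Subtype.ext (funext fun P => (map_mul σ _ _).symm)

/-- Automorphisms of a curve of genus two act by Möbius transformations on a function of degree
at most two. -/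
lemma exists_mobius (hK : IsFunctionField k K) (hg : HasGenus k K 2) {x : K}
    (hx : x ∉ Set.range (algebraMap k K)) {D : Divisor k K} (hD0 : 0 ≤ D) (hD : D.degree ≤ 2)
    (hxD : x ∈ riemannRochSpace D) (σ : K ≃ₐ[k] K) :
    ∃ a b c d : k, algebraMap k K c * x + algebraMap k K d ≠ 0 ∧
      (algebraMap k K c * x + algebraMap k K d) * σ x = algebraMap k K a * x + algebraMap k K b := by
  obtain ⟨ω, hω0, hω, hωx, hspan⟩ := exists_differentials_eq_span hK hg hx hD0 hD hxD
  -- The transports of `ω` and `xω` are again holomorphic, hence `ω` times affine functions of `x`;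
  -- their ratio is `σ x`.
  obtain ⟨c, d, hcd⟩ := hspan _ (pull_mem_differentials σ.symm hω)
  obtain ⟨a, b, hab⟩ := hspan _ (pull_mem_differentials σ.symm hωx)
  have h := mulDifferential_comp_pullAdele σ.symm ω (σ x)
  rw [AlgEquiv.symm_apply_apply, hab, hcd, mulDifferential_mulDifferential] at h
  refine ⟨a, b, c, d, fun h0 => hω0 ?_, (mulDifferential_injective hω0 h).symm⟩
  rw [h0, map_zero] at hcd
  ext e
  obtain ⟨e, rfl⟩ := pullAdele_surjective hK σ.symm e
  exact congrArg (fun φ : Module.Dual k (adeles hK) => φ e) hcd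

end Automorphisms

end Curve

namespace Curve

/-! ### Models `y² = f(x)` and their function fields. -/

section Models

variable {k K : Type*} [Field k] [Field K] [Algebra k K]

/-- `x` and `y` generate `K` over `k`, and satisfy the equation `y ^ 2 = f(x)` of an irreducible
hyperelliptic curve. -/
structure IsModel (x y : K) (f : k[X]) : Prop where
  transcendental : Transcendental k x
  squarefree : Squarefree f
  sq : y ^ 2 = aeval x f
  notMem : y ∉ IntermediateField.adjoin k {x}
  span : ∀ z : K, ∃ u ∈ IntermediateField.adjoin k {x}, ∃ v ∈ IntermediateField.adjoin k {x},
    z = u + v * y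

lemma aeval_mem_adjoin (x : K) (p : k[X]) : aeval x p ∈ IntermediateField.adjoin k {x} :=
  IntermediateField.algebra_adjoin_le_adjoin k {x} (aeval_mem_adjoin_singleton k x)

lemma exists_isCoprime_of_mem_adjoin {x u : K} (hx : Transcendental k x)
    (hu : u ∈ IntermediateField.adjoin k {x}) :
    ∃ r s : k[X], IsCoprime r s ∧ s ≠ 0 ∧ u * aeval x s = aeval x r := by
  obtain ⟨r, s, rfl⟩ := (IntermediateField.mem_adjoin_simple_iff k u).1 hu
  rcases eq_or_ne s 0 with rfl | hs
  · exact ⟨0, 1, isCoprime_one_right, one_ne_zero, by simp⟩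
  obtain ⟨s', r', g, hrs, rfl, rfl⟩ := UniqueFactorizationMonoid.exists_reduced_factors s hs r
  have hg : g ≠ 0 := left_ne_zero_of_mul hs
  have hs' : s' ≠ 0 := right_ne_zero_of_mul hs
  have hg' : aeval x g ≠ 0 := fun h => hg ((transcendental_iff.1 hx) g h)
  have hs'' : aeval x s' ≠ 0 := fun h => hs' ((transcendental_iff.1 hx) s' h)
  refine ⟨r', s', hrs.isCoprime.symm, hs', ?_⟩
  rw [map_mul, map_mul]
  field_simp

/-- For `y = r/s` in lowest terms, `f s² = r²` makes `s²` a unit and, `f` being squarefree, gives `f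
∣ r`. Hence `f` divides the unit `s²`, although its degree is positive. -/
lemma notMem_adjoin_of_sq {x y : K} {f : k[X]} (hx : Transcendental k x) (hf : Squarefree f)
    (hf0 : 0 < f.natDegree) (hy : y ^ 2 = aeval x f) : y ∉ IntermediateField.adjoin k {x} := by
  intro hmem
  obtain ⟨r, s, hrs, hs, h⟩ := exists_isCoprime_of_mem_adjoin hx hmem
  have h1 : f * s ^ 2 = r ^ 2 := by
    apply (transcendental_iff_injective.1 hx)
    rw [map_mul, map_pow, map_pow, ← h, ← hy, mul_pow]
  have h2 : IsUnit (s ^ 2) := by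
    refine (hrs.symm.pow (m := 2) (n := 2)).isUnit_of_dvd' dvd_rfl ⟨f, by rw [← h1]; ring⟩
  have h3 : f ∣ r := (hf.dvd_pow_iff_dvd (n := 2) two_ne_zero).1 ⟨s ^ 2, h1.symm⟩
  obtain ⟨t, rfl⟩ := h3
  have h4 : s ^ 2 = f * t ^ 2 := mul_left_cancel₀ hf.ne_zero (by rw [h1]; ring)
  have h5 : IsUnit f := isUnit_of_dvd_unit ⟨_, h4⟩ h2
  rw [natDegree_eq_zero_of_isUnit h5] at hf0
  exact lt_irrefl _ hf0

/-- The elements `u + v y` already form a field: inverses come from the norm `u² - v² g`, nonzero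
because `y` is not in `k(x)`. -/
lemma exists_add_mul_of_mem_adjoin_pair {x y g : K} (hy : y ^ 2 = g)
    (hg : g ∈ IntermediateField.adjoin k {x})
    (hyx : y ∉ IntermediateField.adjoin k {x}) {z : K} (hz : z ∈ IntermediateField.adjoin k {x, y}) :
    ∃ u ∈ IntermediateField.adjoin k {x}, ∃ v ∈ IntermediateField.adjoin k {x}, z = u + v * y := by
  set F := IntermediateField.adjoin k {x}
  induction hz using IntermediateField.adjoin_induction with
  | mem z hz =>
    rcases hz with rfl | rfl
    · exact ⟨z, IntermediateField.mem_adjoin_simple_self k z, 0, zero_mem _, by simp⟩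
    · exact ⟨0, zero_mem _, 1, one_mem _, by simp⟩
  | algebraMap c => exact ⟨_, F.algebraMap_mem c, 0, zero_mem _, by simp⟩
  | add z w _ _ hz hw =>
    obtain ⟨u, hu, v, hv, rfl⟩ := hz
    obtain ⟨u', hu', v', hv', rfl⟩ := hw
    exact ⟨u + u', add_mem hu hu', v + v', add_mem hv hv', by ring⟩
  | inv z _ hz =>
    obtain ⟨u, hu, v, hv, rfl⟩ := hz
    by_cases h0 : u + v * y = 0
    · exact ⟨0, zero_mem _, 0, zero_mem _, by simp [h0]⟩
    have hc : u - v * y ≠ 0 := by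
      intro hc
      have hv0 : v ≠ 0 := by
        rintro rfl
        apply h0
        linear_combination hc
      apply hyx
      have : y = u / v := by rw [eq_div_iff hv0]; linear_combination -hc
      rw [this]
      exact div_mem hu hv
    have hn : (u + v * y) * (u - v * y) = u ^ 2 - v ^ 2 * g := by rw [← hy]; ring
    have hnm : u ^ 2 - v ^ 2 * g ∈ F := sub_mem (pow_mem hu 2) (mul_mem (pow_mem hv 2) hg)
    refine ⟨u / (u ^ 2 - v ^ 2 * g), div_mem hu hnm, -v / (u ^ 2 - v ^ 2 * g),
      div_mem (neg_mem hv) hnm, ?_⟩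
    rw [← hn]
    field_simp
    ring
  | mul z w _ _ hz hw =>
    obtain ⟨u, hu, v, hv, rfl⟩ := hz
    obtain ⟨u', hu', v', hv', rfl⟩ := hw
    refine ⟨u * u' + v * v' * g, add_mem (mul_mem hu hu') (mul_mem (mul_mem hv hv') hg),
      u * v' + v * u', add_mem (mul_mem hu hv') (mul_mem hv hu'), ?_⟩
    rw [← hy]; ring

lemma isModel_of_adjoin_eq_top {x y : K} {f : k[X]} (hx : Transcendental k x) (hf : Squarefree f)
    (hf0 : 0 < f.natDegree) (hy : y ^ 2 = aeval x f)
    (h : IntermediateField.adjoin k {x, y} = ⊤) : IsModel x y f where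
  transcendental := hx
  squarefree := hf
  sq := hy
  notMem := notMem_adjoin_of_sq hx hf hf0 hy
  span _ := exists_add_mul_of_mem_adjoin_pair hy (aeval_mem_adjoin x f)
    (notMem_adjoin_of_sq hx hf hf0 hy) (h ▸ IntermediateField.mem_top)

lemma IsModel.adjoin_eq_top {x y : K} {f : k[X]} (h : IsModel x y f) :
    IntermediateField.adjoin k {x, y} = ⊤ := by
  rw [eq_top_iff]
  rintro z -
  obtain ⟨u, hu, v, hv, rfl⟩ := h.span z
  have hle : IntermediateField.adjoin k {x} ≤ IntermediateField.adjoin k {x, y} :=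
    IntermediateField.adjoin.mono k _ _ (by simp)
  exact add_mem (hle hu) (mul_mem (hle hv) (IntermediateField.subset_adjoin k _ (by simp)))

lemma IsModel.eq_zero {x y : K} {f : k[X]} (h : IsModel x y f) {u v : K}
    (hu : u ∈ IntermediateField.adjoin k {x}) (hv : v ∈ IntermediateField.adjoin k {x})
    (h0 : u + v * y = 0) : u = 0 ∧ v = 0 := by
  have hv0 : v = 0 := by
    by_contra hv0
    apply h.notMem
    have : y = -u / v := by rw [eq_div_iff hv0]; linear_combination h0
    rw [this]
    exact div_mem (neg_mem hu) hv
  subst hv0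
  exact ⟨by simpa using h0, rfl⟩

/-- The map from the coordinate ring of `y ^ 2 = f(x)` given by a solution. -/
noncomputable def coordinateRingLift (x y : K) (f : k[X]) (h : y ^ 2 = aeval x f) :
    CoordinateRing f →ₐ[k] K :=
  AdjoinRoot.liftAlgHom _ (aeval x) y (by
    rw [eval₂_sub, eval₂_pow, eval₂_X, eval₂_C, h]
    exact sub_self _)

lemma coordinateRing_eq (f : k[X]) (z : CoordinateRing f) : ∃ a b : k[X],
    z = AdjoinRoot.of _ a + AdjoinRoot.of _ b * AdjoinRoot.root (X ^ 2 - C f : k[X][X]) := by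
  obtain ⟨p, rfl⟩ := AdjoinRoot.mk_surjective z
  have hm : (X ^ 2 - C f : k[X][X]).Monic := monic_X_pow_sub_C f two_ne_zero
  have h1 : AdjoinRoot.mk (X ^ 2 - C f) p = AdjoinRoot.mk (X ^ 2 - C f) (p %ₘ (X ^ 2 - C f)) := by
    rw [AdjoinRoot.mk_eq_mk]
    exact ⟨p /ₘ (X ^ 2 - C f), by
      nth_rewrite 1 [← modByMonic_add_div p (X ^ 2 - C f)]; ring⟩
  have hdeg : (p %ₘ (X ^ 2 - C f)).natDegree ≤ 1 := by
    have := natDegree_modByMonic_lt p hm (by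
      intro h
      have := congrArg natDegree h
      rw [natDegree_X_pow_sub_C, natDegree_one] at this
      omega)
    rw [natDegree_X_pow_sub_C] at this
    omega
  obtain ⟨b, a, hab⟩ := exists_eq_X_add_C_of_natDegree_le_one hdeg
  refine ⟨a, b, ?_⟩
  rw [h1, hab, map_add, map_mul, AdjoinRoot.mk_C, AdjoinRoot.mk_C, AdjoinRoot.mk_X, add_comm]

lemma coordinateRingLift_apply (x y : K) (f : k[X]) (h : y ^ 2 = aeval x f) (a b : k[X]) :
    coordinateRingLift x y f h
      (AdjoinRoot.of _ a + AdjoinRoot.of _ b * AdjoinRoot.root (X ^ 2 - C f : k[X][X])) =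
      aeval x a + aeval x b * y := by
  rw [map_add, map_mul]
  unfold coordinateRingLift
  rw [AdjoinRoot.liftAlgHom_root, AdjoinRoot.liftAlgHom_of, AdjoinRoot.liftAlgHom_of]

/-- The function field of the curve is determined by its equation. -/
lemma IsModel.exists_algEquiv_eqnFunctionField {x y : K} {f : k[X]} (h : IsModel x y f) :
    ∃ e : EqnFunctionField f ≃ₐ[k] K, ∀ z : CoordinateRing f,
      e (algebraMap _ _ z) = coordinateRingLift x y f h.sq z := by
  let φ := coordinateRingLift x y f h.sq
  let : Algebra (CoordinateRing f) K := φ.toRingHom.toAlgebra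
  have htower : IsScalarTower k (CoordinateRing f) K :=
    IsScalarTower.of_algebraMap_eq fun c => (φ.commutes c).symm
  have hinj : Function.Injective (algebraMap (CoordinateRing f) K) := by
    rw [injective_iff_map_eq_zero]
    intro z hz
    obtain ⟨a, b, rfl⟩ := coordinateRing_eq f z
    replace hz := (coordinateRingLift_apply x y f h.sq a b).symm.trans hz
    obtain ⟨ha, hb⟩ := h.eq_zero (aeval_mem_adjoin x a) (aeval_mem_adjoin x b) hz
    rw [transcendental_iff.1 h.transcendental a ha, transcendental_iff.1 h.transcendental b hb]
    simp
  have : FaithfulSMul (CoordinateRing f) K := (faithfulSMul_iff_algebraMap_injective _ _).2 hinj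
  have hfrac : IsFractionRing (CoordinateRing f) K := by
    refine IsFractionRing.of_field _ _ fun z => ?_
    obtain ⟨u, hu, v, hv, rfl⟩ := h.span z
    obtain ⟨r, s, -, hs, hrs⟩ := exists_isCoprime_of_mem_adjoin h.transcendental hu
    obtain ⟨r', s', -, hs', hrs'⟩ := exists_isCoprime_of_mem_adjoin h.transcendental hv
    have hs1 : aeval x s ≠ 0 := fun h' => hs (transcendental_iff.1 h.transcendental s h')
    have hs2 : aeval x s' ≠ 0 := fun h' => hs' (transcendental_iff.1 h.transcendental s' h')
    refine ⟨_, AdjoinRoot.of _ (s * s') + AdjoinRoot.of _ 0 * AdjoinRoot.root _, eq_div_of_mul_eq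
      (c := φ _) (a := u + v * y) (b := φ (AdjoinRoot.of _ (r * s') + AdjoinRoot.of _ (r' * s) * AdjoinRoot.root _)) ?_ ?_⟩
    · change coordinateRingLift x y f h.sq _ ≠ 0
      rw [coordinateRingLift_apply]
      simp [hs1, hs2]
    · change _ * coordinateRingLift x y f h.sq _ = coordinateRingLift x y f h.sq _
      rw [coordinateRingLift_apply, coordinateRingLift_apply]
      simp only [map_mul, map_zero, ← hrs, ← hrs']
      ring
  exact ⟨(FractionRing.algEquiv (CoordinateRing f) K).restrictScalars k, fun z =>
    (FractionRing.algEquiv (CoordinateRing f) K).commutes z⟩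

lemma IsModel.isIsoToEqn {x y : K} {f : k[X]} (h : IsModel x y f) : IsIsoToEqn k K f := by
  obtain ⟨e, -⟩ := h.exists_algEquiv_eqnFunctionField
  exact ⟨e.symm⟩

/-- Two models with the same equation are exchanged by an isomorphism. -/
lemma IsModel.exists_algEquiv {x y x' y' : K} {f : k[X]} (h : IsModel x y f)
    (h' : IsModel x' y' f) : ∃ σ : K ≃ₐ[k] K, σ x = x' ∧ σ y = y' := by
  obtain ⟨e, he⟩ := h.exists_algEquiv_eqnFunctionField
  obtain ⟨e', he'⟩ := h'.exists_algEquiv_eqnFunctionField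
  have key : ∀ z, (e.symm.trans e') (coordinateRingLift x y f h.sq z) =
      coordinateRingLift x' y' f h'.sq z := fun z => by
    rw [AlgEquiv.trans_apply, ← he, AlgEquiv.symm_apply_apply, he']
  refine ⟨e.symm.trans e', ?_, ?_⟩
  · have := key (AdjoinRoot.of _ X + AdjoinRoot.of _ 0 * AdjoinRoot.root _)
    rw [coordinateRingLift_apply, coordinateRingLift_apply] at this
    simpa using this
  · have := key (AdjoinRoot.of _ 0 + AdjoinRoot.of _ 1 * AdjoinRoot.root _)
    rw [coordinateRingLift_apply, coordinateRingLift_apply] at this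
    simpa using this

lemma exists_isModel_of_isIsoToEqn [IsAlgClosed k] (hK : IsFunctionField k K) {f : k[X]}
    (hf : Squarefree f) (hf0 : 0 < f.natDegree) (h : IsIsoToEqn k K f) :
    ∃ x y : K, IsModel x y f := by
  obtain ⟨e⟩ := h
  let ψ : CoordinateRing f →ₐ[k] K :=
    (e.symm : EqnFunctionField f →ₐ[k] K).comp (IsScalarTower.toAlgHom k _ _)
  set x := ψ (AdjoinRoot.of _ X)
  set y := ψ (AdjoinRoot.root _)
  have hx : ∀ p : k[X], ψ (AdjoinRoot.of _ p) = aeval x p := fun p => by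
    have : (ψ.comp (AdjoinRoot.ofAlgHom k (X ^ 2 - C f : k[X][X]))) = aeval x := by
      ext
      simp [x]
    exact congrArg (fun φ : k[X] →ₐ[k] K => φ p) this
  have hy : y ^ 2 = aeval x f := by
    have h1 : (AdjoinRoot.root (X ^ 2 - C f : k[X][X])) ^ 2 = AdjoinRoot.of _ f := by
      have := AdjoinRoot.eval₂_root (X ^ 2 - C f : k[X][X])
      rwa [eval₂_sub, eval₂_pow, eval₂_X, eval₂_C, sub_eq_zero] at this
    rw [← hx, ← h1, map_pow]
  have hmem : ∀ z, ψ z ∈ IntermediateField.adjoin k {x, y} := fun z => by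
    obtain ⟨a, b, rfl⟩ := coordinateRing_eq f z
    have hle : IntermediateField.adjoin k {x} ≤ IntermediateField.adjoin k {x, y} :=
      IntermediateField.adjoin.mono k _ _ (by simp)
    rw [map_add, map_mul, hx, hx]
    exact add_mem (hle (aeval_mem_adjoin x a)) (mul_mem (hle (aeval_mem_adjoin x b))
      (IntermediateField.subset_adjoin k _ (by simp [y])))
  have htop : IntermediateField.adjoin k {x, y} = ⊤ := by
    rw [eq_top_iff]
    rintro z -
    obtain ⟨a, s, has⟩ := IsLocalization.exists_mk'_eq (nonZeroDivisors (CoordinateRing f)) (e z)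
    have hu : ψ s ≠ 0 := by
      have := (IsLocalization.map_units (EqnFunctionField f) s).map e.symm
      exact this.ne_zero
    have h1 := IsLocalization.mk'_spec (EqnFunctionField f) a s
    rw [has] at h1
    have h2 : z * ψ s = ψ a := by
      have := congrArg e.symm h1
      rw [map_mul, AlgEquiv.symm_apply_apply] at this
      exact this
    rw [eq_div_of_mul_eq hu h2]
    exact div_mem (hmem _) (hmem _)
  refine ⟨x, y, isModel_of_adjoin_eq_top ?_ hf hf0 hy htop⟩
  -- An algebraic `x` would be a constant, so `y` and then all of `K = k(x, y)` would be algebraic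
  -- over `k`.
  intro halg
  have hya : IsAlgebraic k y := IsAlgebraic.of_pow (n := 2) two_pos
    (by
      obtain ⟨c, hc⟩ := by_contra fun h => transcendental_of_notMem_range h halg
      rw [hy, ← hc, aeval_algebraMap_apply]
      exact isAlgebraic_algebraMap _)
  obtain ⟨t, ht, -⟩ := hK
  have h3 : t ∈ IntermediateField.adjoin k {x, y} := htop ▸ IntermediateField.mem_top
  have h4 : Algebra.IsAlgebraic k (IntermediateField.adjoin k {x, y}) := by
    apply IntermediateField.isAlgebraic_adjoin
    rintro z (rfl | rfl)
    exacts [halg.isIntegral, hya.isIntegral]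
  exact ht ((isAlgebraic_algebraMap_iff (algebraMap (IntermediateField.adjoin k {x, y}) K).injective).2 (h4.isAlgebraic ⟨t, h3⟩))

end Models

end Curve

namespace Curve

/-! ### Dimension counts on a model: the degrees of `x` and of `f`. -/

section Count

variable {k K : Type*} [Field k] [Field K] [Algebra k K]

lemma mem_degreeLT_succ_iff {a : k[X]} {n : ℕ} : a ∈ degreeLT k (n + 1) ↔ a.natDegree ≤ n := by
  rw [mem_degreeLT]
  rcases eq_or_ne a 0 with rfl | ha
  · simp
  · rw [← natDegree_lt_iff_degree_lt ha, Nat.lt_succ_iff]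

lemma finrank_degreeLT (n : ℕ) : Module.finrank k (degreeLT k n) = n := by
  rw [(degreeLTEquiv k n).finrank_eq, Module.finrank_fin_fun]

lemma finite_degreeLT (n : ℕ) : Module.Finite k (degreeLT k n) :=
  Module.Finite.equiv (degreeLTEquiv k n).symm

lemma pow_mem_riemannRochSpace {D : Divisor k K} {x : K} (hx : x ∈ riemannRochSpace D) (n : ℕ) :
    x ^ n ∈ riemannRochSpace (n • D) := by
  induction n with
  | zero => rw [pow_zero, zero_smul]; exact one_mem_riemannRochSpace le_rfl
  | succ n ih => rw [pow_succ, succ_nsmul]; exact mul_mem_riemannRochSpace ih hx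

lemma aeval_mem_riemannRochSpace {D : Divisor k K} (hD : 0 ≤ D) {x : K}
    (hx : x ∈ riemannRochSpace D) {q : k[X]} {n : ℕ} (hq : q.natDegree ≤ n) :
    aeval x q ∈ riemannRochSpace (n • D) := by
  rw [aeval_eq_sum_range]
  refine Submodule.sum_mem _ fun i hi => Submodule.smul_mem _ _ ?_
  refine riemannRochSpace_mono ?_ (pow_mem_riemannRochSpace hx i)
  exact nsmul_le_nsmul_left hD ((Nat.lt_succ_iff.1 (Finset.mem_range.1 hi)).trans hq)

/-- At a pole of `x` every linear factor `x - c` has the value of `x` itself. -/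
lemma Place.val_aeval [IsAlgClosed k] (P : Place k K) {x : K} (hx : 1 < P.val x) {q : k[X]}
    (hq : q ≠ 0) : P.val (aeval x q) = P.val x ^ q.natDegree := by
  have h1 : ∀ c : k, P.val (x - algebraMap k K c) = P.val x := fun c =>
    P.val.map_sub_eq_of_lt_left ((P.le_one c).trans_lt hx)
  conv_lhs => rw [(IsAlgClosed.splits q).eq_prod_roots]
  rw [map_mul, map_multiset_prod, Multiset.map_map, map_mul, map_multiset_prod, Multiset.map_map,
    aeval_C, P.map_algebraMap (leadingCoeff_ne_zero.2 hq), one_mul,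
    ← splits_iff_card_roots.1 (IsAlgClosed.splits q)]
  have : q.roots.map (P.val ∘ (aeval x) ∘ fun a => X - C a) = q.roots.map fun _ => P.val x := by
    apply Multiset.map_congr rfl
    intro a _
    simp [h1]
  rw [this, Multiset.map_const', Multiset.prod_replicate]

/-- `D` is the divisor of poles of `x`. -/
def IsPoleDivisor (x : K) (D : Divisor k K) : Prop := ∀ P, WithZero.exp (D P) = max 1 (P.val x)

lemma IsPoleDivisor.nonneg {x : K} {D : Divisor k K} (h : IsPoleDivisor x D) : 0 ≤ D := fun P => by
  have := (le_max_left 1 (P.val x)).trans (h P).ge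
  rwa [← WithZero.exp_zero, WithZero.exp_le_exp] at this

lemma IsPoleDivisor.mem {x : K} {D : Divisor k K} (h : IsPoleDivisor x D) :
    x ∈ riemannRochSpace D := fun P => (le_max_right _ _).trans (h P).ge

variable [IsAlgClosed k] [CharZero k]

lemma natDegree_le_of_aeval_mem (hK : IsFunctionField k K) {x : K} (hx : Transcendental k x)
    {D : Divisor k K} (hD : IsPoleDivisor x D) {q : k[X]} {n : ℕ}
    (hq : aeval x q ∈ riemannRochSpace (n • D)) : q.natDegree ≤ n := by
  rcases eq_or_ne q 0 with rfl | hq0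
  · simp
  obtain ⟨P, hP⟩ := exists_pole hK hx
  have h1 := hq P
  have h2 := hD P
  rw [max_eq_right hP.le] at h2
  have h3 : 0 < D P := by rwa [← h2, ← WithZero.exp_zero, WithZero.exp_lt_exp] at hP
  rw [P.val_aeval hP hq0, ← h2, ← WithZero.exp_nsmul, WithZero.exp_le_exp, Finsupp.smul_apply,
    nsmul_eq_mul, nsmul_eq_mul] at h1
  exact_mod_cast le_of_mul_le_mul_right h1 h3

lemma isIntegral_of_mem_riemannRochSpace (hK : IsFunctionField k K) {x : K}
    (hx : Transcendental k x) {D : Divisor k K} (hD : IsPoleDivisor x D) {n : ℕ} {z : K}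
    (hz : z ∈ riemannRochSpace (n • D)) : IsIntegral (Algebra.adjoin k {x}) z := by
  refine isIntegral_of_forall_le_one hK hx fun P hP => ?_
  have h1 := hz P
  have h2 := hD P
  rw [max_eq_left hP, ← WithZero.exp_zero, WithZero.exp_inj] at h2
  rwa [Finsupp.smul_apply, h2, smul_zero, WithZero.exp_zero] at h1

lemma exists_aeval_of_isIntegral {x : K} {u : K}
    (hu : u ∈ IntermediateField.adjoin k {x}) (hint : IsIntegral (Algebra.adjoin k {x}) u) :
    ∃ a : k[X], u = aeval x a := by
  have := isPrincipalIdealRing_adjoin (k := k) x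
  have hint' : IsIntegral (Algebra.adjoin k {x}) (⟨u, hu⟩ : IntermediateField.adjoin k {x}) :=
    (isIntegral_algebraMap_iff (algebraMap (IntermediateField.adjoin k {x}) K).injective).1 hint
  obtain ⟨⟨y, hyA⟩, hy⟩ := (IsIntegrallyClosed.isIntegral_iff).1 hint'
  have hyz : y = u := congrArg Subtype.val hy
  rw [Algebra.adjoin_singleton_eq_range_aeval] at hyA
  obtain ⟨q, hq⟩ := hyA
  exact ⟨q, hyz.symm.trans hq.symm⟩

/-- A curve of genus two is not rational. -/
lemma adjoin_ne_top (hK : IsFunctionField k K) (hg : HasGenus k K 2) {x : K}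
    (hx : Transcendental k x) : IntermediateField.adjoin k {x} ≠ ⊤ := by
  intro htop
  obtain ⟨D, hD : IsPoleDivisor x D⟩ := exists_poleDivisor hK x
  have hD0 : D ≠ 0 := by
    rintro rfl
    obtain ⟨P, hP⟩ := exists_pole hK hx
    have := hD.mem P
    simp only [Finsupp.coe_zero, Pi.zero_apply, WithZero.exp_zero] at this
    exact absurd hP (not_lt.2 this)
  -- If `K = k(x)`, then `L(nD)` consists of the polynomials in `x` of degree at most `n`. Two
  -- consecutive nonspecial multiples of `D` force `deg D = 1`, and then `n + 1 = n - 1`.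
  have hrank : ∀ n : ℕ, Module.finrank k (riemannRochSpace (n • D)) = n + 1 := by
    intro n
    have hmap : ∀ a : degreeLT k (n + 1), aeval x a.1 ∈ riemannRochSpace (n • D) := fun a =>
      aeval_mem_riemannRochSpace hD.nonneg hD.mem (mem_degreeLT_succ_iff.1 a.2)
    let φ : degreeLT k (n + 1) →ₗ[k] riemannRochSpace (n • D) :=
      (((aeval x : k[X] →ₐ[k] K).toLinearMap).comp (degreeLT k (n + 1)).subtype).codRestrict _ hmap
    have hφ : Function.Bijective φ := by
      refine ⟨fun a b hab => Subtype.ext (transcendental_iff_injective.1 hx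
        (congrArg Subtype.val hab)), fun z => ?_⟩
      obtain ⟨a, ha⟩ := exists_aeval_of_isIntegral (x := x) (u := z.1)
        (htop ▸ IntermediateField.mem_top) (isIntegral_of_mem_riemannRochSpace hK hx hD z.2)
      refine ⟨⟨a, mem_degreeLT_succ_iff.2 (natDegree_le_of_aeval_mem hK hx hD ?_)⟩,
        Subtype.ext ha.symm⟩
      rw [← ha]; exact z.2
    rw [← (LinearEquiv.ofBijective φ hφ).finrank_eq, finrank_degreeLT]
  obtain ⟨N, hN⟩ := exists_forall_speciality_nsmul_eq_zero hK hg hD.nonneg hD0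
  have h1 := hN N le_rfl
  have h2 := hN (N + 1) (Nat.le_succ N)
  unfold speciality at h1 h2
  rw [hrank, Divisor.degree_nsmul] at h1 h2
  push_cast at h1 h2
  have h3 : D.degree = 1 := by linarith
  rw [h3] at h1
  linarith

lemma IsModel.neg {x y : K} {f : k[X]} (h : IsModel x y f) : IsModel x (-y) f where
  transcendental := h.transcendental
  squarefree := h.squarefree
  sq := by rw [neg_sq, h.sq]
  notMem hy := h.notMem (by simpa using neg_mem hy)
  span z := by
    obtain ⟨u, hu, v, hv, rfl⟩ := h.span z
    exact ⟨u, hu, -v, neg_mem hv, by ring⟩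

/-- The hyperelliptic involution. -/
lemma IsModel.exists_involution {x y : K} {f : k[X]} (h : IsModel x y f) :
    ∃ ι : K ≃ₐ[k] K, ι x = x ∧ ι y = -y := h.exists_algEquiv h.neg

lemma apply_eq_of_mem_adjoin {σ τ : K ≃ₐ[k] K} {x u : K} (hσ : σ x = τ x)
    (hu : u ∈ IntermediateField.adjoin k {x}) : σ u = τ u := by
  obtain ⟨r, s, rfl⟩ := (IntermediateField.mem_adjoin_simple_iff k u).1 hu
  rw [map_div₀, map_div₀, ← aeval_algHom_apply, ← aeval_algHom_apply, ← aeval_algHom_apply,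
    ← aeval_algHom_apply, hσ]

lemma IsModel.algEquiv_ext {x y : K} {f : k[X]} (h : IsModel x y f) {σ τ : K ≃ₐ[k] K}
    (hx : σ x = τ x) (hy : σ y = τ y) : σ = τ := by
  ext z
  obtain ⟨u, hu, v, hv, rfl⟩ := h.span z
  rw [map_add, map_add, map_mul, map_mul, apply_eq_of_mem_adjoin hx hu,
    apply_eq_of_mem_adjoin hx hv, hy]

/-- In lowest terms the square of the denominator of `v` divides the squarefree `f`, so the
denominator is a unit. -/
lemma exists_aeval_of_sq_mul {x v : K} {f : k[X]} (hx : Transcendental k x) (hf : Squarefree f)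
    (hv : v ∈ IntermediateField.adjoin k {x}) {g : k[X]} (h : v ^ 2 * aeval x f = aeval x g) :
    ∃ b : k[X], v = aeval x b := by
  obtain ⟨r, s, hrs, hs, hv⟩ := exists_isCoprime_of_mem_adjoin hx hv
  have h1 : r ^ 2 * f = g * s ^ 2 := by
    apply transcendental_iff_injective.1 hx
    rw [map_mul, map_mul, map_pow, map_pow, ← hv, ← h]
    ring
  have h2 : s ^ 2 ∣ f := (hrs.symm.pow (m := 2) (n := 2)).dvd_of_dvd_mul_left ⟨g, by rw [h1]; ring⟩
  have h3 : IsUnit s := hf s (by rwa [← sq])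
  obtain ⟨c, hc, rfl⟩ := isUnit_iff.1 h3
  refine ⟨C c⁻¹ * r, ?_⟩
  rw [map_mul, ← hv, aeval_C, aeval_C, map_inv₀]
  have : algebraMap k K c ≠ 0 := by simpa using hc.ne_zero
  field_simp

lemma mem_riemannRochSpace_of_sq {D : Divisor k K} {z : K}
    (hz : z ^ 2 ∈ riemannRochSpace (2 • D)) : z ∈ riemannRochSpace D := fun P => by
  have h := hz P
  rw [map_pow, Finsupp.smul_apply, WithZero.exp_nsmul] at h
  exact (pow_le_pow_iff_left₀ zero_le zero_le two_ne_zero).1 h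

/-- The hyperelliptic involution preserves `L(nD)`, so both parts `u` and `v y` of `z` lie in it.
Then `u` is integral over `k[x]`, hence a polynomial, and so is `v` because `f` is squarefree. The
condition on `b` means `deg(b² f) ≤ 2n`: half of `deg f` is rounded up, and truncated subtraction
leaves only `b = 0` for small `n`. -/
lemma IsModel.mem_riemannRochSpace_iff (hK : IsFunctionField k K) {x y : K} {f : k[X]}
    (h : IsModel x y f) {D : Divisor k K} (hD : IsPoleDivisor x D) (n : ℕ) (z : K) :
    z ∈ riemannRochSpace (n • D) ↔ ∃ a ∈ degreeLT k (n + 1),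
      ∃ b ∈ degreeLT k (n + 1 - (f.natDegree + 1) / 2), z = aeval x a + aeval x b * y := by
  have hx := h.transcendental
  have hdeg : ∀ b : k[X], b ∈ degreeLT k (n + 1 - (f.natDegree + 1) / 2) ↔
      (b ^ 2 * f).natDegree ≤ 2 * n := by
    intro b
    rw [mem_degreeLT]
    rcases eq_or_ne b 0 with rfl | hb
    · simp
    · rw [← natDegree_lt_iff_degree_lt hb, natDegree_mul (pow_ne_zero 2 hb) h.squarefree.ne_zero,
        natDegree_pow]
      omega
  constructor
  · intro hz
    obtain ⟨ι, hιx, hιy⟩ := h.exists_involution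
    have hιz : ι z ∈ riemannRochSpace (n • D) := fun P => by
      have h1 := hz (P.pull ι)
      rw [Place.pull_val] at h1
      rw [Finsupp.smul_apply, WithZero.exp_nsmul] at h1 ⊢
      rwa [hD, Place.pull_val, hιx, ← hD] at h1
    obtain ⟨u, hu, v, hv, rfl⟩ := h.span z
    have hι : ι (u + v * y) = u - v * y := by
      rw [map_add, map_mul, hιy, apply_eq_of_mem_adjoin (τ := AlgEquiv.refl) hιx hu,
        apply_eq_of_mem_adjoin (τ := AlgEquiv.refl) hιx hv]
      simp [sub_eq_add_neg]
    rw [hι] at hιz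
    have h2 : (2 : K) ≠ 0 := by
      have : CharZero K := charZero_of_injective_algebraMap (algebraMap k K).injective
      exact two_ne_zero
    have hsmul : ∀ w : K, (2⁻¹ : k) • (2 * w) = w := fun w => by
      rw [Algebra.smul_def, map_inv₀, map_ofNat]; field_simp
    have huL : u ∈ riemannRochSpace (n • D) := by
      rw [← hsmul u]
      refine Submodule.smul_mem _ _ ?_
      convert add_mem hz hιz using 1; ring
    have hvL : v * y ∈ riemannRochSpace (n • D) := by
      rw [← hsmul (v * y)]
      refine Submodule.smul_mem _ _ ?_
      convert sub_mem hz hιz using 1; ring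
    obtain ⟨a, rfl⟩ := exists_aeval_of_isIntegral hu
      (isIntegral_of_mem_riemannRochSpace hK hx hD huL)
    have hv2 : v ^ 2 * aeval x f ∈ riemannRochSpace ((2 * n) • D) := by
      have := pow_mem_riemannRochSpace hvL 2
      rwa [mul_pow, h.sq, smul_smul] at this
    obtain ⟨g, hg⟩ := exists_aeval_of_isIntegral
      (mul_mem (pow_mem hv 2) (aeval_mem_adjoin x f))
      (isIntegral_of_mem_riemannRochSpace hK hx hD hv2)
    obtain ⟨b, rfl⟩ := exists_aeval_of_sq_mul hx h.squarefree hv hg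
    refine ⟨a, mem_degreeLT_succ_iff.2 (natDegree_le_of_aeval_mem hK hx hD huL), b, ?_, rfl⟩
    rw [hdeg]
    refine natDegree_le_of_aeval_mem hK hx hD ?_
    rwa [map_mul, map_pow]
  · rintro ⟨a, ha, b, hb, rfl⟩
    refine add_mem (aeval_mem_riemannRochSpace hD.nonneg hD.mem (mem_degreeLT_succ_iff.1 ha)) ?_
    apply mem_riemannRochSpace_of_sq
    rw [mul_pow, h.sq, ← map_pow, ← map_mul, smul_smul]
    exact aeval_mem_riemannRochSpace hD.nonneg hD.mem ((hdeg b).1 hb)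

lemma IsModel.finrank_riemannRochSpace (hK : IsFunctionField k K) {x y : K} {f : k[X]}
    (h : IsModel x y f) {D : Divisor k K} (hD : IsPoleDivisor x D) (n : ℕ) :
    Module.finrank k (riemannRochSpace (n • D)) =
      (n + 1) + (n + 1 - (f.natDegree + 1) / 2) := by
  set m := n + 1 - (f.natDegree + 1) / 2 with hm
  have := finite_degreeLT (k := k) (n + 1)
  have := finite_degreeLT (k := k) m
  let ψ : k[X] × k[X] →ₗ[k] K := LinearMap.coprod (aeval x : k[X] →ₐ[k] K).toLinearMap
    ((LinearMap.mulRight k y).comp (aeval x : k[X] →ₐ[k] K).toLinearMap)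
  have hψ : ∀ a b, ψ (a, b) = aeval x a + aeval x b * y := fun a b => rfl
  let φ : (degreeLT k (n + 1) × degreeLT k m) →ₗ[k] riemannRochSpace (n • D) :=
    (ψ.comp (LinearMap.prodMap (degreeLT k (n + 1)).subtype (degreeLT k m).subtype)).codRestrict _
      fun p => (h.mem_riemannRochSpace_iff hK hD n _).2 ⟨p.1, p.1.2, p.2, p.2.2, rfl⟩
  have hφ : Function.Bijective φ := by
    constructor
    · rw [injective_iff_map_eq_zero]
      rintro ⟨⟨a, ha⟩, ⟨b, hb⟩⟩ h0
      have h1 : aeval x a + aeval x b * y = 0 := congrArg Subtype.val h0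
      obtain ⟨h2, h3⟩ := h.eq_zero (aeval_mem_adjoin x a) (aeval_mem_adjoin x b) h1
      have h4 := transcendental_iff.1 h.transcendental a h2
      have h5 := transcendental_iff.1 h.transcendental b h3
      subst h4 h5
      rfl
    · rintro ⟨z, hz⟩
      obtain ⟨a, ha, b, hb, rfl⟩ := (h.mem_riemannRochSpace_iff hK hD n z).1 hz
      exact ⟨(⟨a, ha⟩, ⟨b, hb⟩), rfl⟩
  rw [← (LinearEquiv.ofBijective φ hφ).finrank_eq, Module.finrank_prod, finrank_degreeLT,
    finrank_degreeLT]

/-- For large `n` the number `2n + 2 - ⌈deg f / 2⌉` equals `n deg D - 1`. Two consecutive `n` give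
`deg D`, and then `⌈deg f / 2⌉ = 3`. -/
lemma IsModel.degree_eq (hK : IsFunctionField k K) (hg : HasGenus k K 2) {x y : K} {f : k[X]}
    (h : IsModel x y f) {D : Divisor k K} (hD : IsPoleDivisor x D) :
    D.degree = 2 ∧ (f.natDegree = 5 ∨ f.natDegree = 6) := by
  have hD0 : D ≠ 0 := by
    rintro rfl
    obtain ⟨P, hP⟩ := exists_pole hK h.transcendental
    have := hD.mem P
    simp only [Finsupp.coe_zero, Pi.zero_apply, WithZero.exp_zero] at this
    exact absurd hP (not_lt.2 this)
  obtain ⟨N, hN⟩ := exists_forall_speciality_nsmul_eq_zero hK hg hD.nonneg hD0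
  obtain ⟨n, hn, hn'⟩ : ∃ n, N ≤ n ∧ f.natDegree ≤ n := ⟨N + f.natDegree, by omega, by omega⟩
  have h1 := hN n hn
  have h2 := hN (n + 1) (by omega)
  unfold speciality at h1 h2
  rw [h.finrank_riemannRochSpace hK hD, Divisor.degree_nsmul] at h1 h2
  rw [Nat.cast_add, Nat.cast_sub (by omega)] at h1 h2
  push_cast at h1 h2
  have h3 : D.degree = 2 := by linarith
  refine ⟨h3, ?_⟩
  rw [h3] at h1
  omega

/-- Let `r` be the degree of `K` over `k(x)`. The products of `r` basis elements with polynomials of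
degree at most `n` in `x` give `r(n + 1)` dimensions inside `L(nD + E')`, whose dimension grows in
`n` with slope at most `deg D`. -/
lemma finrank_adjoin_le_two (hK : IsFunctionField k K) {x : K} (hx : Transcendental k x)
    {D : Divisor k K} (hD0 : 0 ≤ D) (hD : D.degree ≤ 2) (hxD : x ∈ riemannRochSpace D) :
    Module.finrank (IntermediateField.adjoin k {x}) K ≤ 2 := by
  have := finite_adjoin hK hx
  set F := IntermediateField.adjoin k {x}
  set r := Module.finrank F K
  let u := Module.finBasis F K
  choose E hE using fun i => exists_poleDivisor hK (u i)
  set E' : Divisor k K := ∑ i, E i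
  have hE0 : ∀ i, 0 ≤ E i := fun i => IsPoleDivisor.nonneg (hE i)
  have hu : ∀ i, u i ∈ riemannRochSpace E' := fun i =>
    riemannRochSpace_mono (Finset.single_le_sum (fun i _ => hE0 i) (Finset.mem_univ i))
      (IsPoleDivisor.mem (hE i))
  have hE'0 : 0 ≤ E' := Finset.sum_nonneg fun i _ => hE0 i
  have hle : ∀ n : ℕ, (r * (n + 1) : ℤ) ≤ n * D.degree + E'.degree + 1 := by
    intro n
    have := finite_degreeLT (k := k) (n + 1)
    let ψ : (Fin r → degreeLT k (n + 1)) →ₗ[k] K :=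
      ∑ i, (LinearMap.mulRight k (u i)).comp ((aeval x : k[X] →ₐ[k] K).toLinearMap.comp
        ((degreeLT k (n + 1)).subtype.comp (LinearMap.proj i)))
    have hψ : ∀ q, ψ q = ∑ i, aeval x (q i).1 * u i := fun q => by
      rw [LinearMap.sum_apply]; rfl
    have hmem : ∀ q, ψ q ∈ riemannRochSpace (n • D + E') := fun q => by
      rw [hψ]
      exact Submodule.sum_mem _ fun i _ => mul_mem_riemannRochSpace
        (aeval_mem_riemannRochSpace hD0 hxD (mem_degreeLT_succ_iff.1 (q i).2)) (hu i)
    have hinj : Function.Injective (ψ.codRestrict _ hmem) := by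
      rw [injective_iff_map_eq_zero]
      intro q hq
      have h1 : ∑ i, aeval x (q i).1 * u i = 0 := (hψ q).symm.trans (congrArg Subtype.val hq)
      have h2 := Fintype.linearIndependent_iff.1 u.linearIndependent
        (fun i => ⟨aeval x (q i).1, aeval_mem_adjoin x _⟩) h1
      funext i
      exact Subtype.ext (transcendental_iff.1 hx _ (congrArg Subtype.val (h2 i)))
    have := finite_riemannRochSpace hK (n • D + E')
    have h3 := LinearMap.finrank_le_finrank_of_injective hinj
    rw [Module.finrank_pi_fintype] at h3
    simp only [finrank_degreeLT, Finset.sum_const, Finset.card_univ, Fintype.card_fin,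
      smul_eq_mul] at h3
    have h4 := finrank_le_degree_add_one hK (D := n • D + E')
      (add_nonneg (nsmul_nonneg hD0 n) hE'0)
    rw [Divisor.degree_add, Divisor.degree_nsmul] at h4
    refine le_trans ?_ h4
    exact_mod_cast h3
  by_contra! hr
  -- For `n = deg E'`, a degree `r ≥ 3` would give `3(n + 1) ≤ 3n + 1`.
  have h1 := hle E'.degree.toNat
  rw [Int.toNat_of_nonneg (Divisor.degree_nonneg hE'0)] at h1
  have h2 := Divisor.degree_nonneg hE'0
  have h3 : (3 : ℤ) ≤ r := by exact_mod_cast hr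
  nlinarith

end Count

end Curve

namespace Curve

/-! ### Existence of models, and automorphisms as substitutions in a binary sextic. -/

section Existence

variable {k K : Type*} [Field k] [Field K] [Algebra k K]

lemma exists_eq_sq_mul_squarefree {g : k[X]} (hg : g ≠ 0) :
    ∃ q f : k[X], g = q ^ 2 * f ∧ Squarefree f := by
  induction h : g.natDegree using Nat.strong_induction_on generalizing g with
  | _ n ih =>
    by_cases hsq : Squarefree g
    · exact ⟨1, g, by ring, hsq⟩
    · unfold Squarefree at hsq
      push Not at hsq
      obtain ⟨p, ⟨g', rfl⟩, hp⟩ := hsq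
      have hp0 : p ≠ 0 := by rintro rfl; simp at hg
      have hg' : g' ≠ 0 := right_ne_zero_of_mul hg
      have hdeg : 0 < p.natDegree := by
        rw [Nat.pos_iff_ne_zero]
        intro h0
        obtain ⟨c, rfl⟩ := natDegree_eq_zero.1 h0
        exact hp (isUnit_C.2 (isUnit_iff_ne_zero.2 (by rintro rfl; simp at hp0)))
      rw [natDegree_mul (mul_ne_zero hp0 hp0) hg', natDegree_mul hp0 hp0] at h
      obtain ⟨q, f, rfl, hf⟩ := ih g'.natDegree (by omega) hg' rfl
      exact ⟨p * q, f, by ring, hf⟩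

/-- If `y² = r/s` and `rs = q² f` with `f` squarefree, then `y s / q` has square `f(x)`. -/
lemma exists_isModel_of_span {x y : K} (hx : Transcendental k x)
    (hy : y ∉ IntermediateField.adjoin k {x}) (hsq : y ^ 2 ∈ IntermediateField.adjoin k {x})
    (hspan : ∀ z : K, ∃ u ∈ IntermediateField.adjoin k {x}, ∃ v ∈ IntermediateField.adjoin k {x},
      z = u + v * y) : ∃ (y' : K) (f : k[X]), IsModel x y' f := by
  obtain ⟨r, s, -, hs, hrs⟩ := exists_isCoprime_of_mem_adjoin hx hsq
  have hne : ∀ {p : k[X]}, p ≠ 0 → aeval x p ≠ 0 := fun hp h => hp (transcendental_iff.1 hx _ h)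
  have hy0 : y ≠ 0 := by rintro rfl; exact hy (zero_mem _)
  have hr : r ≠ 0 := by
    rintro rfl
    rw [map_zero] at hrs
    exact mul_ne_zero (pow_ne_zero 2 hy0) (hne hs) hrs
  obtain ⟨q, f, hqf, hf⟩ := exists_eq_sq_mul_squarefree (mul_ne_zero hr hs)
  have hq : q ≠ 0 := by
    rintro rfl
    exact mul_ne_zero hr hs (by rw [hqf]; ring)
  have ht : aeval x s / aeval x q ≠ 0 := div_ne_zero (hne hs) (hne hq)
  have htm : aeval x s / aeval x q ∈ IntermediateField.adjoin k {x} :=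
    div_mem (aeval_mem_adjoin x s) (aeval_mem_adjoin x q)
  refine ⟨y * (aeval x s / aeval x q), f, hx, hf, ?_, fun h => hy ?_, fun z => ?_⟩
  · have h1 := congrArg (aeval x) hqf
    rw [map_mul, map_mul, map_pow] at h1
    have := hne hq
    field_simp
    linear_combination h1 + aeval x s * hrs
  · have := div_mem h htm
    rwa [mul_div_cancel_right₀ _ ht] at this
  · obtain ⟨u, hu, v, hv, rfl⟩ := hspan z
    refine ⟨u, hu, v / (aeval x s / aeval x q), div_mem hv htm, ?_⟩
    rw [mul_left_comm, div_mul_cancel₀ _ ht, mul_comm]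

/-- Completing the square in the quadratic equation of a generator. -/
lemma exists_isModel_of_finrank_le_two [CharZero k] {x : K} (hx : Transcendental k x)
    [Module.Finite (IntermediateField.adjoin k {x}) K]
    (h2 : Module.finrank (IntermediateField.adjoin k {x}) K ≤ 2)
    (htop : IntermediateField.adjoin k {x} ≠ ⊤) : ∃ (y : K) (f : k[X]), IsModel x y f := by
  obtain ⟨z, hz⟩ : ∃ z, z ∉ IntermediateField.adjoin k {x} := by
    by_contra! h
    exact htop (eq_top_iff.2 fun z _ => h z)
  set F := IntermediateField.adjoin k {x} with hF
  have hind : ∀ c : F, c • (1 : K) ≠ z := by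
    rintro c rfl
    apply hz
    rw [Algebra.smul_def, mul_one]
    exact c.2
  have hrank : Module.finrank F (⊤ : Submodule F K) = 2 := by
    rw [finrank_top]
    refine le_antisymm h2 ?_
    rw [← finrank_span_pair (k := F) (one_ne_zero (α := K)) hind]
    exact Submodule.finrank_le _
  have hspan : ∀ w : K, ∃ a b : F, w = a + b * z := fun w => by
    obtain ⟨a, b, h⟩ := span_pair_of_finrank_eq_two hrank (Submodule.mem_top (x := (1 : K)))
      (Submodule.mem_top (x := z)) one_ne_zero hind (Submodule.mem_top (x := w))
    refine ⟨a, b, ?_⟩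
    rw [← h, Algebra.smul_def, Algebra.smul_def, mul_one]
    rfl
  obtain ⟨a, b, hab⟩ := hspan (z ^ 2)
  have : CharZero K := charZero_of_injective_algebraMap (algebraMap k K).injective
  have hb : (b : K) / 2 ∈ F := div_mem b.2 (ofNat_mem F 2)
  refine exists_isModel_of_span (y := z - b / 2) hx (fun h => hz ?_) ?_ fun w => ?_
  · simpa using add_mem h hb
  · have : (z - (b : K) / 2) ^ 2 = a + (b / 2) ^ 2 := by linear_combination hab
    rw [this]
    exact add_mem a.2 (pow_mem hb 2)
  · obtain ⟨c, d, rfl⟩ := hspan w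
    exact ⟨c + d * (b / 2), add_mem c.2 (mul_mem d.2 hb), d, d.2, by ring⟩

variable [IsAlgClosed k] [CharZero k]

/-- Curves of genus two are hyperelliptic. -/
lemma exists_isModel (hK : IsFunctionField k K) (hg : HasGenus k K 2) :
    ∃ (x y : K) (f : k[X]), IsModel x y f := by
  obtain ⟨x, hx, D, hD0, hD, hxD⟩ := exists_degree_le_two hK hg
  have hx' := transcendental_of_notMem_range hx
  have := finite_adjoin hK hx'
  obtain ⟨y, f, h⟩ := exists_isModel_of_finrank_le_two hx' (finrank_adjoin_le_two hK hx' hD0 hD hxD)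
    (adjoin_ne_top hK hg hx')
  exact ⟨x, y, f, h⟩

lemma IsModel.natDegree_eq (hK : IsFunctionField k K) (hg : HasGenus k K 2) {x y : K} {f : k[X]}
    (h : IsModel x y f) : f.natDegree = 5 ∨ f.natDegree = 6 := by
  obtain ⟨D, hD⟩ := exists_poleDivisor hK x
  exact (h.degree_eq hK hg hD).2

lemma IsModel.exists_isModel_of_adjoin_eq {x y x' : K} {f : k[X]} (h : IsModel x y f)
    (hx' : Transcendental k x')
    (heq : IntermediateField.adjoin k {x'} = IntermediateField.adjoin k {x}) :
    ∃ (y' : K) (f' : k[X]), IsModel x' y' f' := by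
  refine exists_isModel_of_span (y := y) hx' (heq ▸ h.notMem) ?_ (heq ▸ h.span)
  rw [heq, h.sq]
  exact aeval_mem_adjoin x f

lemma linear_ne_zero {x : K} (hx : Transcendental k x) {c d : k} (hcd : c ≠ 0 ∨ d ≠ 0) :
    algebraMap k K c * x + algebraMap k K d ≠ 0 := by
  intro h0
  have h1 : aeval x (C c * X + C d : k[X]) = 0 := by simpa using h0
  have h2 := transcendental_iff.1 hx _ h1
  have hc : c = 0 := by simpa using congrArg (coeff · 1) h2
  have hd : d = 0 := by simpa using congrArg (coeff · 0) h2
  tauto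

lemma IsModel.exists_mobius (hK : IsFunctionField k K) (hg : HasGenus k K 2) {x y : K} {f : k[X]}
    (h : IsModel x y f) (σ : K ≃ₐ[k] K) : ∃ a b c d : k, a * d - b * c ≠ 0 ∧
      (algebraMap k K c * x + algebraMap k K d) * σ x = algebraMap k K a * x + algebraMap k K b := by
  obtain ⟨D, hD : IsPoleDivisor x D⟩ := exists_poleDivisor hK x
  obtain ⟨a, b, c, d, hcd, hσ⟩ := Curve.exists_mobius hK hg
    (notMem_range_of_transcendental h.transcendental) hD.nonneg (h.degree_eq hK hg hD).1.le hD.mem σ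
  refine ⟨a, b, c, d, fun hdet => ?_, hσ⟩
  have hx := h.transcendental
  have hσx : ∀ e : k, σ x ≠ algebraMap k K e := fun e he => by
    have : x = algebraMap k K e := σ.injective (by rw [he, AlgEquiv.commutes])
    exact notMem_range_of_transcendental hx ⟨e, this.symm⟩
  have hdet' : algebraMap k K a * algebraMap k K d = algebraMap k K b * algebraMap k K c := by
    rw [← map_mul, ← map_mul, sub_eq_zero.1 hdet]
  by_cases hc : c = 0
  · subst hc
    rw [map_zero, zero_mul, zero_add] at hcd hσ
    have ha : algebraMap k K a = 0 := by
      rw [map_zero, mul_zero] at hdet'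
      exact (mul_eq_zero.1 hdet').resolve_right hcd
    apply hσx (b / d)
    rw [ha, zero_mul, zero_add] at hσ
    rw [map_div₀, eq_div_iff hcd, mul_comm, hσ]
  · have hc' : algebraMap k K c ≠ 0 := by simpa using hc
    apply hσx (a / c)
    rw [map_div₀, eq_div_iff hc']
    apply mul_left_cancel₀ hcd
    linear_combination algebraMap k K c * hσ - hdet'

lemma IsModel.apply_mem_adjoin (hK : IsFunctionField k K) (hg : HasGenus k K 2) {x y : K}
    {f : k[X]} (h : IsModel x y f) (σ : K ≃ₐ[k] K) {u : K}
    (hu : u ∈ IntermediateField.adjoin k {x}) : σ u ∈ IntermediateField.adjoin k {x} := by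
  have hσx : σ x ∈ IntermediateField.adjoin k {x} := by
    obtain ⟨a, b, c, d, hdet, hσ⟩ := h.exists_mobius hK hg σ
    have hcd : c ≠ 0 ∨ d ≠ 0 := by
      by_contra! hcd
      apply hdet
      rw [hcd.1, hcd.2]; ring
    have hmem : ∀ a b : k, algebraMap k K a * x + algebraMap k K b ∈
        IntermediateField.adjoin k {x} := fun a b =>
      add_mem (mul_mem (IntermediateField.algebraMap_mem _ a)
        (IntermediateField.mem_adjoin_simple_self k x)) (IntermediateField.algebraMap_mem _ b)
    rw [eq_div_of_mul_eq (linear_ne_zero h.transcendental hcd) ((mul_comm _ _).trans hσ)]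
    exact div_mem (hmem _ _) (hmem _ _)
  obtain ⟨r, s, rfl⟩ := (IntermediateField.mem_adjoin_simple_iff k u).1 hu
  have hp : ∀ p : k[X], σ (aeval x p) ∈ IntermediateField.adjoin k {x} := fun p => by
    rw [← aeval_algHom_apply]
    have : IntermediateField.adjoin k {σ x} ≤ IntermediateField.adjoin k {x} := by
      rw [IntermediateField.adjoin_le_iff]
      rintro _ rfl
      exact hσx
    exact this (aeval_mem_adjoin (σ x) p)
  rw [map_div₀]
  exact div_mem (hp r) (hp s)

/-- The substitution of linear forms in the binary sextic form attached to `f`. -/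
noncomputable def sexticSubst (f : k[X]) (a b c d : k) : k[X] :=
  ∑ i ∈ Finset.range 7, C (f.coeff i) * (C a * X + C b) ^ i * (C c * X + C d) ^ (6 - i)

lemma natDegree_sexticSubst_le (f : k[X]) (a b c d : k) : (sexticSubst f a b c d).natDegree ≤ 6 := by
  refine natDegree_sum_le_of_forall_le _ _ fun i hi => ?_
  have hi' := Finset.mem_range.1 hi
  have h1 : ∀ a b : k, (C a * X + C b : k[X]).natDegree ≤ 1 := fun a b => natDegree_linear_le
  refine (natDegree_mul_le.trans (add_le_add (natDegree_C_mul_le _ _) le_rfl)).trans ?_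
  have h2 := (natDegree_pow_le (p := C a * X + C b) (n := i)).trans (Nat.mul_le_mul_left i (h1 a b))
  have h3 := (natDegree_pow_le (p := C c * X + C d) (n := 6 - i)).trans
    (Nat.mul_le_mul_left (6 - i) (h1 c d))
  omega

lemma aeval_sexticSubst {f : k[X]} (hf : f.natDegree ≤ 6) {x x' : K} {a b c d : k}
    (h : (algebraMap k K c * x + algebraMap k K d) * x' = algebraMap k K a * x + algebraMap k K b) :
    aeval x (sexticSubst f a b c d) =
      (algebraMap k K c * x + algebraMap k K d) ^ 6 * aeval x' f := by
  unfold sexticSubst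
  rw [aeval_eq_sum_range' (p := f) (n := 7) (by omega) x', map_sum, Finset.mul_sum]
  refine Finset.sum_congr rfl fun i hi => ?_
  simp only [map_mul, map_pow, map_add, aeval_C, aeval_X]
  rw [← h, mul_pow, Algebra.smul_def]
  have : 6 = i + (6 - i) := by have := Finset.mem_range.1 hi; omega
  conv_rhs => rw [this, pow_add]
  ring

/-- With `L = c x + d`, the square of `L³ σ y` is the transformed sextic in `x`. In `L³ σ y = u + v
y` the cross term vanishes, and `v ≠ 0` because `σ y` is not in `k(x)`; so `u = 0`. Now `v` is a
polynomial with `deg(v² f) ≤ 6` and `deg f ≥ 5`, hence a constant. -/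
lemma IsModel.exists_eigenvalue (hK : IsFunctionField k K) (hg : HasGenus k K 2) {x y : K}
    {f : k[X]} (h : IsModel x y f) (σ : K ≃ₐ[k] K) {a b c d : k}
    (hcd : c ≠ 0 ∨ d ≠ 0)
    (hσ : (algebraMap k K c * x + algebraMap k K d) * σ x =
      algebraMap k K a * x + algebraMap k K b) :
    ∃ l : k, l ≠ 0 ∧ (algebraMap k K c * x + algebraMap k K d) ^ 3 * σ y = algebraMap k K l * y ∧
      sexticSubst f a b c d = C (l ^ 2) * f := by
  have hdeg := h.natDegree_eq hK hg
  have hx := h.transcendental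
  set L := algebraMap k K c * x + algebraMap k K d with hL
  have hL0 : L ≠ 0 := linear_ne_zero hx hcd
  have hLm : L ∈ IntermediateField.adjoin k {x} :=
    add_mem (mul_mem (IntermediateField.algebraMap_mem _ c)
        (IntermediateField.mem_adjoin_simple_self k x)) (IntermediateField.algebraMap_mem _ d)
  have hsq : (L ^ 3 * σ y) ^ 2 = aeval x (sexticSubst f a b c d) := by
    rw [aeval_sexticSubst (by omega) hσ, mul_pow, ← map_pow, h.sq, ← aeval_algHom_apply, ← hL]
    ring
  obtain ⟨u, hu, v, hv, huv⟩ := h.span (L ^ 3 * σ y)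
  have hcross : (u ^ 2 + v ^ 2 * aeval x f - aeval x (sexticSubst f a b c d)) + (2 * u * v) * y = 0 := by
    rw [← hsq, huv, ← h.sq]; ring
  have hF := aeval_mem_adjoin (k := k) x
  have : CharZero K := charZero_of_injective_algebraMap (algebraMap k K).injective
  obtain ⟨h1, h2⟩ := h.eq_zero (sub_mem (add_mem (pow_mem hu 2) (mul_mem (pow_mem hv 2) (hF f)))
    (hF _)) (mul_mem (mul_mem (ofNat_mem _ 2) hu) hv) hcross
  have hv0 : v ≠ 0 := by
    rintro rfl
    apply h.notMem
    have h3 : σ y ∈ IntermediateField.adjoin k {x} := by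
      rw [zero_mul, add_zero] at huv
      rw [eq_div_of_mul_eq (pow_ne_zero 3 hL0) ((mul_comm _ _).trans huv)]
      exact div_mem hu (pow_mem hLm 3)
    have := h.apply_mem_adjoin hK hg σ.symm h3
    rwa [AlgEquiv.symm_apply_apply] at this
  have hu0 : u = 0 := by
    rcases mul_eq_zero.1 h2 with h2 | h2
    · exact (mul_eq_zero.1 h2).resolve_left two_ne_zero
    · exact absurd h2 hv0
  subst hu0
  have hvf : v ^ 2 * aeval x f = aeval x (sexticSubst f a b c d) := by
    linear_combination h1
  obtain ⟨q, rfl⟩ := exists_aeval_of_sq_mul hx h.squarefree hv hvf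
  have hqf : q ^ 2 * f = sexticSubst f a b c d := by
    apply transcendental_iff_injective.1 hx
    rw [← hvf, map_mul, map_pow]
  have hq0 : q ≠ 0 := by rintro rfl; exact hv0 (map_zero _)
  have hq : q.natDegree = 0 := by
    have h4 := natDegree_sexticSubst_le f a b c d
    rw [← hqf, natDegree_mul (pow_ne_zero 2 hq0) h.squarefree.ne_zero, natDegree_pow] at h4
    omega
  obtain ⟨l, rfl⟩ := natDegree_eq_zero.1 hq
  refine ⟨l, by rintro rfl; simp at hq0, ?_, ?_⟩
  · rw [huv, zero_add, aeval_C]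
  · rw [← hqf, C_pow]

/-- Converse to `IsModel.exists_eigenvalue`: the substitution gives another generating pair with the
same equation, and two such pairs differ by an automorphism. -/
lemma IsModel.exists_algEquiv_of_sexticSubst {x y : K} {f : k[X]} (h : IsModel x y f)
    (hf0 : 0 < f.natDegree) (hf6 : f.natDegree ≤ 6) {a b c d l : k} (hdet : a * d - b * c ≠ 0)
    (hl : l ≠ 0) (hsub : sexticSubst f a b c d = C (l ^ 2) * f) :
    ∃ σ : K ≃ₐ[k] K, (algebraMap k K c * x + algebraMap k K d) * σ x =
      algebraMap k K a * x + algebraMap k K b ∧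
      (algebraMap k K c * x + algebraMap k K d) ^ 3 * σ y = algebraMap k K l * y := by
  have hx := h.transcendental
  have hcd : c ≠ 0 ∨ d ≠ 0 := by
    by_contra! hcd
    apply hdet
    rw [hcd.1, hcd.2]; ring
  set A := algebraMap k K
  have hL0 := linear_ne_zero (K := K) hx hcd
  set x' := (A a * x + A b) / (A c * x + A d) with hx'
  set y' := A l * y / (A c * x + A d) ^ 3 with hy'
  have hx'e : (A c * x + A d) * x' = A a * x + A b := mul_div_cancel₀ _ hL0
  have hdet' : A a * A d - A b * A c ≠ 0 := by
    rw [← map_mul, ← map_mul, ← map_sub]; exact (map_ne_zero A).2 hdet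
  have hl' : A l ≠ 0 := by simpa [A] using hl
  have hden : (A a - A c * x') * (A c * x + A d) = A a * A d - A b * A c := by
    linear_combination -A c * hx'e
  have hden0 : A a - A c * x' ≠ 0 := fun h0 => hdet' (by rw [← hden, h0, zero_mul])
  have hxx' : x = (A d * x' - A b) / (A a - A c * x') := by
    rw [eq_div_iff hden0]
    linear_combination -hx'e
  set F := IntermediateField.adjoin k {x', y'}
  have hx'F : x' ∈ F := IntermediateField.subset_adjoin k _ (by simp)
  have hy'F : y' ∈ F := IntermediateField.subset_adjoin k _ (by simp)
  have hAF : ∀ e, A e ∈ F := fun e => IntermediateField.algebraMap_mem _ e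
  have hxF : x ∈ F := by
    rw [hxx']
    exact div_mem (sub_mem (mul_mem (hAF d) hx'F) (hAF b)) (sub_mem (hAF a) (mul_mem (hAF c) hx'F))
  have hyF : y ∈ F := by
    have : y = y' * (A c * x + A d) ^ 3 / A l := by
      rw [hy', div_mul_cancel₀ _ (pow_ne_zero 3 hL0), mul_div_cancel_left₀ _ hl']
    rw [this]
    exact div_mem (mul_mem hy'F (pow_mem (add_mem (mul_mem (hAF c) hxF) (hAF d)) 3)) (hAF l)
  have htop : F = ⊤ := by
    rw [eq_top_iff, ← h.adjoin_eq_top, IntermediateField.adjoin_le_iff]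
    rintro z (rfl | rfl)
    exacts [hxF, hyF]
  have hx't : Transcendental k x' := by
    apply transcendental_of_notMem_range
    rintro ⟨e, he⟩
    apply notMem_range_of_transcendental hx
    rw [hxx', ← he]
    exact ⟨(d * e - b) / (a - c * e), by simp [A]⟩
  have hm : IsModel x' y' f := by
    refine isModel_of_adjoin_eq_top hx't h.squarefree hf0 ?_ htop
    have h1 := aeval_sexticSubst hf6 hx'e
    rw [hsub, map_mul, aeval_C, ← h.sq, map_pow] at h1
    rw [hy', div_pow, div_eq_iff (pow_ne_zero 2 (pow_ne_zero 3 hL0))]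
    linear_combination h1
  obtain ⟨σ, hσx, hσy⟩ := h.exists_algEquiv hm
  refine ⟨σ, ?_, ?_⟩
  · rw [hσx, hx'e]
  · rw [hσy, hy', mul_div_cancel₀ _ (pow_ne_zero 3 hL0)]

end Existence

end Curve

namespace Curve

/-! ### The quadratic covariant of a sextic and the symmetries of the normal forms. -/

section Covariant

variable {k : Type*} [Field k] [CharZero k]

lemma coeff_eq_zero_of_forall {g₀ g₁ g₂ g₃ g₄ g₅ g₆ : k}
    (h : ∀ u : k, g₀ + g₁ * u + g₂ * u ^ 2 + g₃ * u ^ 3 + g₄ * u ^ 4 + g₅ * u ^ 5 + g₆ * u ^ 6 = 0) :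
    g₀ = 0 ∧ g₁ = 0 ∧ g₂ = 0 ∧ g₃ = 0 ∧ g₄ = 0 ∧ g₅ = 0 ∧ g₆ = 0 := by
  have h0 : (C g₀ + C g₁ * X + C g₂ * X ^ 2 + C g₃ * X ^ 3 + C g₄ * X ^ 4 + C g₅ * X ^ 5 +
      C g₆ * X ^ 6 : k[X]) = 0 := by
    apply Polynomial.funext
    intro u
    simpa using h u
  refine ⟨?_, ?_, ?_, ?_, ?_, ?_, ?_⟩
  · simpa [coeff_X, coeff_C] using congrArg (coeff · 0) h0
  · simpa [coeff_X, coeff_C] using congrArg (coeff · 1) h0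
  · simpa [coeff_X, coeff_C] using congrArg (coeff · 2) h0
  · simpa [coeff_X, coeff_C] using congrArg (coeff · 3) h0
  · simpa [coeff_X, coeff_C] using congrArg (coeff · 4) h0
  · simpa [coeff_X, coeff_C] using congrArg (coeff · 5) h0
  · simpa [coeff_X, coeff_C] using congrArg (coeff · 6) h0

/-- A coefficient of the quadratic covariant of degree three of the binary sextic with coefficients
`g₀, …, g₆`. -/
def covariantCoeff (g₀ g₁ g₂ g₃ g₄ g₅ g₆ : k) : k :=
  3 * g₂ * g₃ ^ 2 - 8 * g₂ ^ 2 * g₄ - 5 * g₁ * g₃ * g₄ + 50 * g₁ * g₂ * g₅ - 250 * g₁ ^ 2 * g₆ +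
    80 * g₀ * g₄ ^ 2 - 225 * g₀ * g₃ * g₅ + 600 * g₀ * g₂ * g₆

/-- Reversing the coefficients exchanges the two variables, so the second expression is the opposite
outer coefficient of the same covariant. -/
lemma covariantCoeff_congr {g₀ g₁ g₂ g₃ g₄ g₅ g₆ h₀ h₁ h₂ h₃ h₄ h₅ h₆ : k}
    (h : ∀ u : k, g₀ + g₁ * u + g₂ * u ^ 2 + g₃ * u ^ 3 + g₄ * u ^ 4 + g₅ * u ^ 5 + g₆ * u ^ 6 =
      h₀ + h₁ * u + h₂ * u ^ 2 + h₃ * u ^ 3 + h₄ * u ^ 4 + h₅ * u ^ 5 + h₆ * u ^ 6) :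
    covariantCoeff g₀ g₁ g₂ g₃ g₄ g₅ g₆ = covariantCoeff h₀ h₁ h₂ h₃ h₄ h₅ h₆ ∧
    covariantCoeff g₆ g₅ g₄ g₃ g₂ g₁ g₀ = covariantCoeff h₆ h₅ h₄ h₃ h₂ h₁ h₀ := by
  obtain ⟨e₀, e₁, e₂, e₃, e₄, e₅, e₆⟩ := coeff_eq_zero_of_forall
    (g₀ := g₀ - h₀) (g₁ := g₁ - h₁) (g₂ := g₂ - h₂) (g₃ := g₃ - h₃) (g₄ := g₄ - h₄)
    (g₅ := g₅ - h₅) (g₆ := g₆ - h₆) (fun u => by linear_combination h u)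
  rw [sub_eq_zero.1 e₀, sub_eq_zero.1 e₁, sub_eq_zero.1 e₂, sub_eq_zero.1 e₃, sub_eq_zero.1 e₄,
    sub_eq_zero.1 e₅, sub_eq_zero.1 e₆]
  exact ⟨rfl, rfl⟩

/-- Linear substitutions preserving a sextic form whose quadratic covariant is a nonzero multiple
of `x z` preserve `x z`. -/
lemma diagonal_or_antidiagonal_of_quintic {a b c d m t : k} (ht : t ≠ 9 / 100) (hm : m ≠ 0)
    (hdet : a * d - b * c ≠ 0)
    (h : ∀ u, (a * u + b) ^ 5 * (c * u + d) + (a * u + b) ^ 3 * (c * u + d) ^ 3 +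
      t * (a * u + b) * (c * u + d) ^ 5 = m * (u ^ 5 + u ^ 3 + t * u)) :
    (b = 0 ∧ c = 0) ∨ (a = 0 ∧ d = 0) := by
  -- The covariant of the quintic, read as a sextic form with a root at infinity, is `xz` times this
  -- factor.
  have hκ : (9 - 100 * t) ≠ 0 := fun h0 => ht (by linear_combination -h0 / 100)
  by_cases hc : c = 0
  · left
    subst hc
    have had : a ≠ 0 ∧ d ≠ 0 := by
      constructor <;> rintro rfl <;> simp at hdet
    obtain ⟨-, -, -, -, h4, -, -⟩ := coeff_eq_zero_of_forall
      (g₀ := b ^ 5 * d + b ^ 3 * d ^ 3 + t * b * d ^ 5)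
      (g₁ := 5 * a * b ^ 4 * d + 3 * a * b ^ 2 * d ^ 3 + t * a * d ^ 5 - m * t)
      (g₂ := 10 * a ^ 2 * b ^ 3 * d + 3 * a ^ 2 * b * d ^ 3)
      (g₃ := 10 * a ^ 3 * b ^ 2 * d + a ^ 3 * d ^ 3 - m) (g₄ := 5 * a ^ 4 * b * d)
      (g₅ := a ^ 5 * d - m) (g₆ := 0) (fun u => by linear_combination h u)
    simpa [had.1, had.2] using h4
  · right
    obtain ⟨p, rfl⟩ : ∃ p, a = p * c := ⟨a / c, by field_simp⟩
    obtain ⟨q, rfl⟩ : ∃ q, d = q * c := ⟨d / c, by field_simp⟩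
    -- Here `e = (b c - a d) / c²`, which is nonzero with the determinant.
    obtain ⟨e, rfl⟩ : ∃ e, b = (p * q + e) * c := ⟨b / c - p * q, by field_simp; ring⟩
    have he : e ≠ 0 := by rintro rfl; apply hdet; ring
    -- At `u - q` the left side is `c⁶` times the form in `p u + e` and `u`, the right side `m`
    -- times the form in `u - q` and 1. The covariants are multiples of `(p u + e) u` and of `u -
    -- q`; the constant terms give `q = 0`, the quadratic ones `p = 0`.
    obtain ⟨h1, h2⟩ := covariantCoeff_congr
      (g₀ := 0) (g₁ := c ^ 6 * e ^ 5) (g₂ := c ^ 6 * (5 * p * e ^ 4))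
      (g₃ := c ^ 6 * (10 * p ^ 2 * e ^ 3 + e ^ 3)) (g₄ := c ^ 6 * (10 * p ^ 3 * e ^ 2 + 3 * p * e ^ 2))
      (g₅ := c ^ 6 * (5 * p ^ 4 * e + 3 * p ^ 2 * e + t * e)) (g₆ := c ^ 6 * (p ^ 5 + p ^ 3 + t * p))
      (h₀ := -m * (q ^ 5 + q ^ 3 + t * q)) (h₁ := m * (5 * q ^ 4 + 3 * q ^ 2 + t))
      (h₂ := -m * (10 * q ^ 3 + 3 * q)) (h₃ := m * (10 * q ^ 2 + 1)) (h₄ := -m * (5 * q))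
      (h₅ := m) (h₆ := 0) (fun u => by linear_combination h (u - q))
    unfold covariantCoeff at h1 h2
    have hq : (9 - 100 * t) * m ^ 3 * q = 0 := by linear_combination h1
    have hp : (9 - 100 * t) * c ^ 18 * e ^ 8 * p = 0 := by linear_combination h2
    simp only [mul_eq_zero, pow_eq_zero_iff, ne_eq, OfNat.ofNat_ne_zero, not_false_eq_true, hκ, hm,
      hc, he, false_or] at hq hp
    rw [hp, hq]
    simp

/-- As for the quintic: the covariant is `9(1 + 50t)` times `xz`, so a symmetry permutes its roots,
zero and infinity. -/
lemma diagonal_or_antidiagonal_of_sextic {a b c d m t : k} (ht : t ≠ -1 / 50) (hm : m ≠ 0)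
    (hdet : a * d - b * c ≠ 0)
    (h : ∀ u, (a * u + b) ^ 6 + (a * u + b) ^ 3 * (c * u + d) ^ 3 + t * (c * u + d) ^ 6 =
      m * (u ^ 6 + u ^ 3 + t)) :
    (b = 0 ∧ c = 0) ∨ (a = 0 ∧ d = 0) := by
  have hκ : (1 + 50 * t) ≠ 0 := fun h0 => ht (by linear_combination h0 / 50)
  by_cases hc : c = 0
  · left
    subst hc
    have had : a ≠ 0 ∧ d ≠ 0 := by
      constructor <;> rintro rfl <;> simp at hdet
    obtain ⟨-, -, -, -, -, h5, -⟩ := coeff_eq_zero_of_forall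
      (g₀ := b ^ 6 + b ^ 3 * d ^ 3 + t * d ^ 6 - m * t)
      (g₁ := 6 * a * b ^ 5 + 3 * a * b ^ 2 * d ^ 3)
      (g₂ := 15 * a ^ 2 * b ^ 4 + 3 * a ^ 2 * b * d ^ 3)
      (g₃ := 20 * a ^ 3 * b ^ 3 + a ^ 3 * d ^ 3 - m) (g₄ := 15 * a ^ 4 * b ^ 2)
      (g₅ := 6 * a ^ 5 * b) (g₆ := a ^ 6 - m) (fun u => by linear_combination h u)
    simpa [had.1, had.2] using h5
  · right
    obtain ⟨p, rfl⟩ : ∃ p, a = p * c := ⟨a / c, by field_simp⟩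
    obtain ⟨q, rfl⟩ : ∃ q, d = q * c := ⟨d / c, by field_simp⟩
    obtain ⟨e, rfl⟩ : ∃ e, b = (p * q + e) * c := ⟨b / c - p * q, by field_simp; ring⟩
    have he : e ≠ 0 := by rintro rfl; apply hdet; ring
    obtain ⟨h1, h2⟩ := covariantCoeff_congr
      (g₀ := c ^ 6 * e ^ 6) (g₁ := c ^ 6 * (6 * p * e ^ 5)) (g₂ := c ^ 6 * (15 * p ^ 2 * e ^ 4))
      (g₃ := c ^ 6 * (20 * p ^ 3 * e ^ 3 + e ^ 3)) (g₄ := c ^ 6 * (15 * p ^ 4 * e ^ 2 + 3 * p * e ^ 2))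
      (g₅ := c ^ 6 * (6 * p ^ 5 * e + 3 * p ^ 2 * e)) (g₆ := c ^ 6 * (p ^ 6 + p ^ 3 + t))
      (h₀ := m * (q ^ 6 - q ^ 3 + t)) (h₁ := -m * (6 * q ^ 5 - 3 * q ^ 2))
      (h₂ := m * (15 * q ^ 4 - 3 * q)) (h₃ := -m * (20 * q ^ 3 - 1)) (h₄ := m * (15 * q ^ 2))
      (h₅ := -m * (6 * q)) (h₆ := m) (fun u => by linear_combination h (u - q))
    unfold covariantCoeff at h1 h2
    have hq : 9 * (1 + 50 * t) * m ^ 3 * q = 0 := by linear_combination h1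
    have hp : 9 * (1 + 50 * t) * c ^ 18 * e ^ 8 * p = 0 := by linear_combination h2
    simp only [mul_eq_zero, pow_eq_zero_iff, ne_eq, OfNat.ofNat_ne_zero, not_false_eq_true, hκ, hm,
      hc, he, false_or] at hq hp
    rw [hp, hq]
    simp

lemma squarefree_quintic {t : k} (h0 : t ≠ 0) (h1 : t ≠ 1 / 4) :
    Squarefree (X ^ 5 + X ^ 3 + C t * X : k[X]) := by
  apply Separable.squarefree
  have hD : 5 * t * (4 * t - 1) * t ≠ 0 := by
    refine mul_ne_zero (mul_ne_zero (mul_ne_zero (by norm_num) h0) fun h => h1 ?_) h0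
    linear_combination h / 4
  have hd : derivative (X ^ 5 + X ^ 3 + C t * X : k[X]) = 5 * X ^ 4 + 3 * X ^ 2 + C t := by
    simp only [derivative_add, derivative_X_pow, derivative_C_mul, derivative_X, map_natCast]
    push_cast
    ring
  unfold Separable
  rw [hd]
  set q : k[X] := 5 * X ^ 2 + 3 - 10 * C t
  set p : k[X] := 5 * X ^ 3 + 3 * X
  set D := C (5 * t * (4 * t - 1) * t)⁻¹
  have hhalf : (2 : k[X]) * C (1 / 2) = 1 := by
    rw [← C_ofNat, ← C_mul]; simp
  -- Writing `f` for the quintic, `(5f - X f')/2 = X(X² + 2t)`, `q(X² + 2t) = f' - 5t(4t - 1)` and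
  -- `X p = f' - t`. Multiplying the last two expresses `5t²(4t - 1)` through `f` and `f'`.
  refine ⟨D * (5 * C (1 / 2) * q * p), D * (-X * C (1 / 2) * q * p - (5 * X ^ 4 + 3 * X ^ 2 + C t) +
    (5 * C t * (4 * C t - 1) + C t)), ?_⟩
  have hDD : D * (5 * C t * (4 * C t - 1) * C t) = 1 := by
    have : (5 * C t * (4 * C t - 1) * C t : k[X]) = C (5 * t * (4 * t - 1) * t) := by
      simp only [C_mul, C_sub, C_1, map_ofNat]
    rw [this, ← C_mul, inv_mul_cancel₀ hD, C_1]
  linear_combination hDD + D * q * p * (X ^ 3 + 2 * C t * X) * hhalf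

lemma squarefree_sextic {t : k} (h0 : t ≠ 0) (h1 : t ≠ 1 / 4) :
    Squarefree (X ^ 6 + X ^ 3 + C t : k[X]) := by
  apply Separable.squarefree
  have hD : 6 * t * (1 - 4 * t) ≠ 0 := by
    refine mul_ne_zero (mul_ne_zero (by norm_num) h0) fun h => h1 ?_
    linear_combination -h / 4
  have hd : derivative (X ^ 6 + X ^ 3 + C t : k[X]) = 6 * X ^ 5 + 3 * X ^ 2 := by
    simp only [derivative_add, derivative_X_pow, derivative_C, map_natCast]
    push_cast
    ring
  unfold Separable
  rw [hd]
  set g : k[X] := X ^ 3 + 2 * C t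
  set D := C (6 * t * (1 - 4 * t))⁻¹
  -- Writing `f` for the sextic, `6f - X f' = 3g` and `X f' = 3g(2g + 1 - 8t) - 6t(1 - 4t)`.
  refine ⟨D * (6 * (2 * g + 1 - 8 * C t)), D * (-X * (2 * g + 1 - 8 * C t) - X), ?_⟩
  have hDD : D * (6 * C t * (1 - 4 * C t)) = 1 := by
    have : (6 * C t * (1 - 4 * C t) : k[X]) = C (6 * t * (1 - 4 * t)) := by
      simp only [C_mul, C_sub, C_1, map_ofNat]
    rw [this, ← C_mul, inv_mul_cancel₀ hD, C_1]
  linear_combination hDD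

lemma natDegree_quintic (t : k) : (X ^ 5 + X ^ 3 + C t * X : k[X]).natDegree = 5 := by
  compute_degree!

lemma natDegree_sextic (t : k) : (X ^ 6 + X ^ 3 + C t : k[X]).natDegree = 6 := by
  compute_degree!

lemma sexticSubst_quintic (t a b c d : k) : sexticSubst (X ^ 5 + X ^ 3 + C t * X) a b c d =
    (C a * X + C b) ^ 5 * (C c * X + C d) + (C a * X + C b) ^ 3 * (C c * X + C d) ^ 3 +
      C t * (C a * X + C b) * (C c * X + C d) ^ 5 := by
  simp [sexticSubst, Finset.sum_range_succ, coeff_X]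
  ring

lemma sexticSubst_sextic (t a b c d : k) : sexticSubst (X ^ 6 + X ^ 3 + C t) a b c d =
    (C a * X + C b) ^ 6 + (C a * X + C b) ^ 3 * (C c * X + C d) ^ 3 +
      C t * (C c * X + C d) ^ 6 := by
  simp [sexticSubst, Finset.sum_range_succ, coeff_C]
  ring

end Covariant

/-! ### Recognizing dihedral groups. -/

section Dihedral

/-- A group generated by a rotation and a reflection is dihedral. -/
lemma nonempty_mulEquiv_dihedralGroup {G : Type*} [Group G] {n : ℕ} [NeZero n] {r s : G}
    (hr : orderOf r = n) (hs : s * s = 1) (hrs : r * s * r = s) (hne : ∀ j : ℕ, s * r ^ j ≠ 1)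
    (hsurj : ∀ H : Subgroup G, r ∈ H → s ∈ H → H = ⊤) : Nonempty (G ≃* DihedralGroup n) := by
  let φ : ZMod n →+ Additive G := ZMod.lift n ⟨zmultiplesHom (Additive G) (Additive.ofMul r), by
    change (n : ℤ) • Additive.ofMul r = 0
    rw [← ofMul_zpow, zpow_natCast, ← hr, pow_orderOf_eq_one]; rfl⟩
  let ψ : ZMod n → G := fun i => (φ i).toMul
  have hadd : ∀ i j, ψ (i + j) = ψ i * ψ j := fun i j => congrArg Additive.toMul (map_add φ i j)
  have hsub : ∀ i j, ψ (i - j) = ψ i * (ψ j)⁻¹ := fun i j => by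
    rw [eq_mul_inv_iff_mul_eq, ← hadd, sub_add_cancel]
  have hnat : ∀ j : ℕ, ψ j = r ^ j := fun j => by
    have : ψ j = (φ ((j : ℤ) : ZMod n)).toMul := by rw [Int.cast_natCast]
    rw [this, ZMod.lift_coe]
    exact (zpow_natCast r j)
  have hψ : ∀ i, ψ i = r ^ i.val := fun i => by
    conv_lhs => rw [← ZMod.natCast_zmod_val i]
    exact hnat _
  have h1 : s * r * s = r⁻¹ := by
    rw [eq_inv_iff_mul_eq_one, mul_assoc, mul_assoc, ← mul_assoc r, hrs, hs]
  have h2 : ∀ j : ℕ, s * r ^ j * s = (r ^ j)⁻¹ := fun j => by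
    induction j with
    | zero => simp [hs]
    | succ j ih =>
      rw [pow_succ, mul_inv_rev, ← ih, ← h1]
      calc s * (r ^ j * r) * s = s * (r * r ^ j) * s := by rw [← pow_succ, ← pow_succ']
        _ = s * r * (s * s) * r ^ j * s := by rw [hs]; group
        _ = _ := by group
  have h3 : ∀ i, s * ψ i * s = (ψ i)⁻¹ := fun i => by rw [hψ, h2]
  have h4 : ∀ i, ψ i * s = s * (ψ i)⁻¹ := fun i => by
    rw [← h3, ← mul_assoc, ← mul_assoc, hs, one_mul]
  have hcomm : ∀ i j, ψ i * ψ j = ψ j * ψ i := fun i j => by rw [← hadd, add_comm, hadd]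
  let f : DihedralGroup n →* G := MonoidHom.mk' (fun g => match g with
    | .r i => ψ i
    | .sr i => s * ψ i) (by
      rintro (i | i) (j | j)
      · exact hadd i j
      · change s * ψ (j - i) = ψ i * (s * ψ j)
        rw [← mul_assoc, h4, hsub, mul_assoc]
        congr 1
        rw [mul_inv_eq_iff_eq_mul, mul_assoc, hcomm j, inv_mul_cancel_left]
      · change s * ψ (i + j) = s * ψ i * ψ j
        rw [hadd, mul_assoc]
      · change ψ (j - i) = s * ψ i * (s * ψ j)
        rw [← mul_assoc, h3, hsub, mul_inv_eq_iff_eq_mul, mul_assoc, hcomm j, inv_mul_cancel_left])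
  refine ⟨(MulEquiv.ofBijective f ⟨?_, ?_⟩).symm⟩
  · rw [injective_iff_map_eq_one]
    rintro (i | i) hi
    · change ψ i = 1 at hi
      rw [hψ, ← orderOf_dvd_iff_pow_eq_one, hr] at hi
      have : i.val = 0 := Nat.eq_zero_of_dvd_of_lt hi (ZMod.val_lt i)
      rw [(ZMod.val_eq_zero i).1 this]; rfl
    · change s * ψ i = 1 at hi
      rw [hψ] at hi
      exact absurd hi (hne _)
  · rw [← MonoidHom.range_eq_top]
    apply hsurj
    · exact ⟨.r 1, by
        change ψ 1 = r
        have := hnat 1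
        rwa [Nat.cast_one, pow_one] at this⟩
    · exact ⟨.sr 0, by
        change s * ψ 0 = s
        have := hnat 0
        rw [Nat.cast_zero, pow_zero] at this
        rw [this, mul_one]⟩

end Dihedral

end Curve

namespace Curve

/-! ### Automorphism groups of the normal forms. -/

section DihedralAut

variable {k K : Type*} [Field k] [Field K] [Algebra k K]

lemma IsModel.apply_sq {x y : K} {f : k[X]} (h : IsModel x y f) {σ : K ≃ₐ[k] K} (hσ : σ x = x) :
    σ y = y ∨ σ y = -y := by
  apply sq_eq_sq_iff_eq_or_eq_neg.1
  rw [← map_pow, h.sq, ← aeval_algHom_apply]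
  exact congrArg (aeval · f) hσ

variable [IsAlgClosed k] [CharZero k]

/-- An automorphism group generated by a diagonal automorphism and an antidiagonal involution is
dihedral. -/
lemma IsModel.nonempty_mulEquiv_dihedralGroup {x y : K} {f : k[X]} (h : IsModel x y f)
    {n j₀ : ℕ} [NeZero n] {α l s m : k} {ρ τ : K ≃ₐ[k] K}
    (hρx : ρ x = algebraMap k K α * x) (hρy : ρ y = algebraMap k K l * y)
    (hτx : x * τ x = algebraMap k K s) (hτy : x ^ 3 * τ y = algebraMap k K m * y)
    (hs : s ≠ 0) (hm : m ^ 2 = s ^ 3) (hαl : l ^ 2 = α ^ 3)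
    (hα : α ^ n = 1) (hl : l ^ n = 1) (hn : ∀ j, α ^ j = 1 → l ^ j = 1 → n ∣ j)
    (hα₀ : α ^ j₀ = 1) (hl₀ : l ^ j₀ = -1)
    (hσ : ∀ σ : K ≃ₐ[k] K, ∃ j : ℕ, σ x = algebraMap k K (α ^ j) * x ∨
      x * σ x = algebraMap k K (α ^ j * s)) :
    Nonempty (Aut k K ≃* DihedralGroup n) := by
  have hx0 : x ≠ 0 := by
    rintro rfl
    exact notMem_range_of_transcendental h.transcendental ⟨0, map_zero _⟩
  have hy0 : y ≠ 0 := by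
    rintro rfl
    exact h.notMem (zero_mem _)
  have hinj := (algebraMap k K).injective
  have hs' : algebraMap k K s ≠ 0 := by simpa using hs
  have hαz : α ≠ 0 := by
    rintro rfl
    simp [NeZero.ne n] at hα
  have hαz' : algebraMap k K α ≠ 0 := by simpa using hαz
  have hpx : ∀ j : ℕ, (ρ ^ j) x = algebraMap k K (α ^ j) * x := fun j => by
    induction j with
    | zero => simp
    | succ j ih =>
      rw [pow_succ', AlgEquiv.mul_apply, ih, map_mul, AlgEquiv.commutes, hρx, pow_succ, map_mul]
      ring
  have hpy : ∀ j : ℕ, (ρ ^ j) y = algebraMap k K (l ^ j) * y := fun j => by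
    induction j with
    | zero => simp
    | succ j ih =>
      rw [pow_succ', AlgEquiv.mul_apply, ih, map_mul, AlgEquiv.commutes, hρy, pow_succ, map_mul]
      ring
  have hτρ : ∀ j : ℕ, x * (τ * ρ ^ j) x = algebraMap k K (α ^ j * s) := fun j => by
    rw [AlgEquiv.mul_apply, hpx, map_mul, AlgEquiv.commutes, mul_left_comm, hτx, map_mul]
  refine Curve.nonempty_mulEquiv_dihedralGroup (r := ρ) (s := τ) ?_ ?_ ?_ ?_ ?_
  · apply Nat.dvd_antisymm
    · apply orderOf_dvd_of_pow_eq_one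
      apply h.algEquiv_ext
      · rw [hpx, hα]; simp
      · rw [hpy, hl]; simp
    · have h1 := pow_orderOf_eq_one ρ
      apply hn
      · have h2 := hpx (orderOf ρ)
        rw [h1, AlgEquiv.one_apply] at h2
        apply hinj
        rw [map_one]
        exact (mul_eq_right₀ hx0).1 h2.symm
      · have h2 := hpy (orderOf ρ)
        rw [h1, AlgEquiv.one_apply] at h2
        apply hinj
        rw [map_one]
        exact (mul_eq_right₀ hy0).1 h2.symm
  · have hτxe : τ x = algebraMap k K s / x := by rw [eq_div_iff hx0, mul_comm, hτx]
    have hτye : τ y = algebraMap k K m * y / x ^ 3 := by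
      rw [eq_div_iff (pow_ne_zero 3 hx0), mul_comm, hτy]
    apply h.algEquiv_ext
    · rw [AlgEquiv.mul_apply, hτxe, map_div₀, AlgEquiv.commutes, hτxe]
      simp only [AlgEquiv.one_apply]
      field_simp
    · rw [AlgEquiv.mul_apply, hτye, map_div₀, map_mul, map_pow, AlgEquiv.commutes, hτxe, hτye]
      simp only [AlgEquiv.one_apply]
      field_simp
      rw [← map_pow, ← map_pow, hm]
  · have hτxe : τ x = algebraMap k K s / x := by rw [eq_div_iff hx0, mul_comm, hτx]
    have hτye : τ y = algebraMap k K m * y / x ^ 3 := by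
      rw [eq_div_iff (pow_ne_zero 3 hx0), mul_comm, hτy]
    apply h.algEquiv_ext
    · simp only [AlgEquiv.mul_apply, hρx, map_mul, AlgEquiv.commutes, hτxe, map_div₀]
      field_simp
    · simp only [AlgEquiv.mul_apply, hρx, hρy, map_mul, AlgEquiv.commutes, hτye, map_div₀, map_pow]
      field_simp
      rw [← map_pow, ← map_pow, hαl, mul_comm]
  -- If `τ ρ ^ j` were trivial, `x²` would be a constant.
  · intro j hj
    have h1 := hτρ j
    rw [hj, AlgEquiv.one_apply] at h1
    have h2 : aeval x (X ^ 2 - C (α ^ j * s)) = 0 := by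
      rw [map_sub, map_pow, aeval_X, aeval_C, ← h1]; ring
    have h3 := transcendental_iff.1 h.transcendental _ h2
    exact X_pow_sub_C_ne_zero two_pos _ h3
  · intro H hρ hτ
    -- `ρ ^ j₀` is the hyperelliptic involution, so `H` contains every automorphism fixing `x`, and
    -- membership in `H` depends only on the action on `x`.
    have hfix : ∀ σ : K ≃ₐ[k] K, σ x = x → σ ∈ H := fun σ hx => by
      rcases h.apply_sq hx with hy | hy
      · have : σ = 1 := h.algEquiv_ext (by simpa using hx) (by simpa using hy)
        exact this ▸ one_mem H
      · have : σ = ρ ^ j₀ := h.algEquiv_ext (by rw [hpx, hα₀]; simpa using hx)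
          (by rw [hpy, hl₀]; simpa using hy)
        exact this ▸ pow_mem hρ j₀
    have hagree : ∀ σ g : K ≃ₐ[k] K, g ∈ H → g x = σ x → σ ∈ H := fun σ g hg hgx => by
      have := hfix (g⁻¹ * σ) (by
        rw [AlgEquiv.mul_apply, ← hgx, ← AlgEquiv.mul_apply, inv_mul_cancel, AlgEquiv.one_apply])
      have h2 := mul_mem hg this
      rwa [mul_inv_cancel_left] at h2
    refine eq_top_iff.2 fun σ _ => ?_
    obtain ⟨j, hj | hj⟩ := hσ σ
    · exact hagree σ _ (pow_mem hρ j) ((hpx j).trans hj.symm)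
    · refine hagree σ _ (mul_mem hτ (pow_mem hρ j)) ?_
      exact mul_left_cancel₀ hx0 ((hτρ j).trans hj.symm)

lemma IsModel.nonempty_mulEquiv_dihedralGroup_four (hK : IsFunctionField k K)
    (hg : HasGenus k K 2) {x y : K} {t : k} (h0 : t ≠ 0) (h9 : t ≠ 9 / 100)
    (h : IsModel x y (X ^ 5 + X ^ 3 + C t * X)) : Nonempty (Aut k K ≃* DihedralGroup 4) := by
  obtain ⟨i, hi⟩ := IsAlgClosed.exists_pow_nat_eq (-1 : k) two_pos
  obtain ⟨s, hs⟩ := IsAlgClosed.exists_pow_nat_eq t two_pos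
  obtain ⟨m, hm⟩ := IsAlgClosed.exists_pow_nat_eq (s ^ 3) two_pos
  have hs0 : s ≠ 0 := by rintro rfl; apply h0; rw [← hs]; simp
  have hi0 : i ≠ 0 := by rintro rfl; simp at hi
  have hm0 : m ≠ 0 := by
    rintro rfl
    exact hs0 (by simpa using hm.symm)
  have hdeg := natDegree_quintic t
  -- `ρ` is `(x, y) ↦ (-x, i y)`, of order four, with square the hyperelliptic involution; `τ` is
  -- `(x, y) ↦ (s/x, m y/x³)`.
  obtain ⟨ρ, hρx, hρy⟩ := h.exists_algEquiv_of_sexticSubst (a := -1) (b := 0) (c := 0) (d := 1)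
    (l := i) (by omega) (by omega) (by simp) hi0 (by
      rw [sexticSubst_quintic, hi]
      simp only [map_neg, map_one, map_zero]
      ring)
  obtain ⟨τ, hτx, hτy⟩ := h.exists_algEquiv_of_sexticSubst (a := 0) (b := s) (c := 1) (d := 0)
    (l := m) (by omega) (by omega) (by simpa) hm0 (by
      rw [sexticSubst_quintic, hm, ← hs]
      simp only [map_pow, map_one, map_zero]
      ring)
  simp only [map_zero, map_one, zero_mul, zero_add, one_mul, add_zero, one_pow] at hρx hρy hτx hτy
  have hi4 : i ^ 4 = 1 := by linear_combination (i ^ 2 - 1) * hi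
  refine h.nonempty_mulEquiv_dihedralGroup (j₀ := 2) (α := -1) hρx hρy hτx hτy hs0 hm
    (by rw [hi]; ring) (by norm_num) hi4 (fun j _ hj => ?_) (by norm_num) hi fun σ => ?_
  · have : orderOf i = 2 ^ (1 + 1) := orderOf_eq_prime_pow (by
      rw [pow_one, hi]; norm_num) (by simpa using hi4)
    exact (show 4 = 2 ^ (1 + 1) by norm_num) ▸ this ▸ orderOf_dvd_of_pow_eq_one hj
  · obtain ⟨a, b, c, d, hdet, hσ⟩ := h.exists_mobius hK hg σ
    have hcd : c ≠ 0 ∨ d ≠ 0 := by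
      by_contra! hcd
      apply hdet
      rw [hcd.1, hcd.2]; ring
    obtain ⟨l, hl, -, hsub⟩ := h.exists_eigenvalue hK hg σ hcd hσ
    rw [sexticSubst_quintic] at hsub
    have hu : ∀ u, (a * u + b) ^ 5 * (c * u + d) + (a * u + b) ^ 3 * (c * u + d) ^ 3 +
        t * (a * u + b) * (c * u + d) ^ 5 = l ^ 2 * (u ^ 5 + u ^ 3 + t * u) := fun u => by
      simpa using congrArg (eval u) hsub
    -- The coefficients of `u³` and `u⁵` leave only `x ↦ ±x` and `x ↦ ±s/x`, the actions of the `ρ ^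
    -- j` and `τ ρ ^ j`.
    rcases diagonal_or_antidiagonal_of_quintic h9 (pow_ne_zero 2 hl) hdet hu with
      ⟨rfl, rfl⟩ | ⟨rfl, rfl⟩
    · have ha : a ≠ 0 := by rintro rfl; simp at hdet
      have hd : d ≠ 0 := by rintro rfl; simp at hdet
      obtain ⟨-, -, -, h3, -, h5, -⟩ := coeff_eq_zero_of_forall (g₀ := 0)
        (g₁ := t * a * d ^ 5 - l ^ 2 * t) (g₂ := 0) (g₃ := a ^ 3 * d ^ 3 - l ^ 2) (g₄ := 0)
        (g₅ := a ^ 5 * d - l ^ 2) (g₆ := 0) (fun u => by linear_combination hu u)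
      have : a ^ 3 * d * (a ^ 2 - d ^ 2) = 0 := by linear_combination h5 - h3
      have := sub_eq_zero.1 ((mul_eq_zero.1 this).resolve_left (mul_ne_zero (pow_ne_zero 3 ha) hd))
      have hd' : algebraMap k K d ≠ 0 := by simpa using hd
      rcases sq_eq_sq_iff_eq_or_eq_neg.1 this with rfl | rfl
      · refine ⟨0, Or.inl (mul_left_cancel₀ hd' ?_)⟩
        simpa using hσ
      · refine ⟨1, Or.inl (mul_left_cancel₀ hd' ?_)⟩
        simpa using hσ
    · have hb : b ≠ 0 := by rintro rfl; simp at hdet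
      have hc : c ≠ 0 := by rintro rfl; simp at hdet
      obtain ⟨-, -, -, h3, -, h5, -⟩ := coeff_eq_zero_of_forall (g₀ := 0)
        (g₁ := b ^ 5 * c - l ^ 2 * t) (g₂ := 0) (g₃ := b ^ 3 * c ^ 3 - l ^ 2) (g₄ := 0)
        (g₅ := t * b * c ^ 5 - l ^ 2) (g₆ := 0) (fun u => by linear_combination hu u)
      have : b * c ^ 3 * (b ^ 2 - (c * s) ^ 2) = 0 := by
        linear_combination h3 - h5 - b * c ^ 5 * hs
      have := sub_eq_zero.1 ((mul_eq_zero.1 this).resolve_left (mul_ne_zero hb (pow_ne_zero 3 hc)))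
      have hc' : algebraMap k K c ≠ 0 := by simpa using hc
      rcases sq_eq_sq_iff_eq_or_eq_neg.1 this with rfl | rfl
      · refine ⟨0, Or.inr (mul_left_cancel₀ hc' ?_)⟩
        simpa [mul_assoc] using hσ
      · refine ⟨1, Or.inr (mul_left_cancel₀ hc' ?_)⟩
        simpa [mul_assoc] using hσ

lemma exists_isPrimitiveRoot_three : ∃ ω : k, IsPrimitiveRoot ω 3 := by
  have : NeZero ((3 : ℕ) : k) := ⟨by norm_num⟩
  exact HasEnoughRootsOfUnity.exists_primitiveRoot k 3

lemma IsModel.nonempty_mulEquiv_dihedralGroup_six (hK : IsFunctionField k K)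
    (hg : HasGenus k K 2) {x y : K} {t : k} (h0 : t ≠ 0) (h50 : t ≠ -1 / 50)
    (h : IsModel x y (X ^ 6 + X ^ 3 + C t)) : Nonempty (Aut k K ≃* DihedralGroup 6) := by
  obtain ⟨ω, hω⟩ := exists_isPrimitiveRoot_three (k := k)
  obtain ⟨s, hs⟩ := IsAlgClosed.exists_pow_nat_eq t three_pos
  obtain ⟨m, hm⟩ := IsAlgClosed.exists_pow_nat_eq (s ^ 3) two_pos
  have hs0 : s ≠ 0 := by rintro rfl; apply h0; rw [← hs]; simp
  have hω0 : ω ≠ 0 := hω.ne_zero (by norm_num)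
  have hω3 := hω.pow_eq_one
  have hm0 : m ≠ 0 := by
    rintro rfl
    exact hs0 (by simpa using hm.symm)
  have hdeg := natDegree_sextic t
  have hω3' : (C ω : k[X]) ^ 3 = 1 := by rw [← C_pow, hω3, C_1]
  -- `ρ` is `(x, y) ↦ (ωx, -y)`, of order six, with cube the hyperelliptic involution.
  obtain ⟨ρ, hρx, hρy⟩ := h.exists_algEquiv_of_sexticSubst (a := ω) (b := 0) (c := 0) (d := 1)
    (l := -1) (by omega) (by omega) (by simpa) (by simp) (by
      rw [sexticSubst_sextic]
      simp only [map_neg, map_one, map_zero, map_pow]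
      linear_combination (X ^ 6 * ((C ω) ^ 3 + 1) + X ^ 3) * hω3')
  obtain ⟨τ, hτx, hτy⟩ := h.exists_algEquiv_of_sexticSubst (a := 0) (b := s) (c := 1) (d := 0)
    (l := m) (by omega) (by omega) (by simpa) hm0 (by
      rw [sexticSubst_sextic, hm, ← hs]
      simp only [map_pow, map_one, map_zero]
      ring)
  simp only [map_zero, map_one, zero_mul, zero_add, one_mul, add_zero, one_pow] at hρx hρy hτx hτy
  refine h.nonempty_mulEquiv_dihedralGroup (j₀ := 3) (α := ω) (l := -1) hρx hρy hτx hτy hs0 hm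
    (by rw [hω3]; ring) (by linear_combination (ω ^ 3 + 1) * hω3) (by norm_num)
    (fun j hj hj' => ?_) hω3 (by norm_num) fun σ => ?_
  · have h3 := hω.dvd_of_pow_eq_one j hj
    have h2 : 2 ∣ j := by
      rw [← even_iff_two_dvd]
      by_contra hodd
      rw [Nat.not_even_iff_odd] at hodd
      rw [hodd.neg_one_pow] at hj'
      norm_num at hj'
    omega
  · obtain ⟨a, b, c, d, hdet, hσ⟩ := h.exists_mobius hK hg σ
    have hcd : c ≠ 0 ∨ d ≠ 0 := by
      by_contra! hcd
      apply hdet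
      rw [hcd.1, hcd.2]; ring
    obtain ⟨l, hl, -, hsub⟩ := h.exists_eigenvalue hK hg σ hcd hσ
    rw [sexticSubst_sextic] at hsub
    have hu : ∀ u, (a * u + b) ^ 6 + (a * u + b) ^ 3 * (c * u + d) ^ 3 +
        t * (c * u + d) ^ 6 = l ^ 2 * (u ^ 6 + u ^ 3 + t) := fun u => by
      simpa using congrArg (eval u) hsub
    rcases diagonal_or_antidiagonal_of_sextic h50 (pow_ne_zero 2 hl) hdet hu with
      ⟨rfl, rfl⟩ | ⟨rfl, rfl⟩
    · have ha : a ≠ 0 := by rintro rfl; simp at hdet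
      have hd : d ≠ 0 := by rintro rfl; simp at hdet
      obtain ⟨-, -, -, h3, -, -, h6⟩ := coeff_eq_zero_of_forall (g₀ := t * d ^ 6 - l ^ 2 * t)
        (g₁ := 0) (g₂ := 0) (g₃ := a ^ 3 * d ^ 3 - l ^ 2) (g₄ := 0)
        (g₅ := 0) (g₆ := a ^ 6 - l ^ 2) (fun u => by linear_combination hu u)
      have : a ^ 3 * (a ^ 3 - d ^ 3) = 0 := by linear_combination h6 - h3
      have := sub_eq_zero.1 ((mul_eq_zero.1 this).resolve_left (pow_ne_zero 3 ha))
      have hd' : algebraMap k K d ≠ 0 := by simpa using hd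
      obtain ⟨j, -, hj⟩ := hω.eq_pow_of_pow_eq_one (ξ := a / d) (by
        rw [div_pow, this, div_self (pow_ne_zero 3 hd)])
      refine ⟨j, Or.inl ?_⟩
      rw [hj, map_div₀]
      simp only [map_zero, zero_mul, zero_add, add_zero] at hσ
      field_simp
      linear_combination hσ
    · have hb : b ≠ 0 := by rintro rfl; simp at hdet
      have hc : c ≠ 0 := by rintro rfl; simp at hdet
      obtain ⟨-, -, -, h3, -, -, h6⟩ := coeff_eq_zero_of_forall (g₀ := b ^ 6 - l ^ 2 * t)
        (g₁ := 0) (g₂ := 0) (g₃ := b ^ 3 * c ^ 3 - l ^ 2) (g₄ := 0)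
        (g₅ := 0) (g₆ := t * c ^ 6 - l ^ 2) (fun u => by linear_combination hu u)
      have : c ^ 3 * (b ^ 3 - (c * s) ^ 3) = 0 := by
        linear_combination h3 - h6 - c ^ 6 * hs
      have := sub_eq_zero.1 ((mul_eq_zero.1 this).resolve_left (pow_ne_zero 3 hc))
      have hc' : algebraMap k K c ≠ 0 := by simpa using hc
      have hcs := mul_ne_zero hc hs0
      obtain ⟨j, -, hj⟩ := hω.eq_pow_of_pow_eq_one (ξ := b / (c * s)) (by
        rw [div_pow, this, div_self (pow_ne_zero 3 hcs)])
      refine ⟨j, Or.inr ?_⟩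
      have hbs : b / (c * s) * s = b / c := by field_simp
      rw [hj, hbs, map_div₀]
      simp only [map_zero, zero_mul, zero_add, add_zero] at hσ
      rw [eq_div_iff hc']
      linear_combination hσ

end DihedralAut

end Curve

namespace Curve

/-! ### Möbius maps of finite order and diagonal coordinates. -/

section Diagonal

variable {k K : Type*} [Field k] [Field K] [Algebra k K]

lemma adjoin_simple_eq {x x' : K} (h : x' ∈ IntermediateField.adjoin k {x})
    (h' : x ∈ IntermediateField.adjoin k {x'}) :
    IntermediateField.adjoin k {x'} = IntermediateField.adjoin k {x} :=
  le_antisymm (IntermediateField.adjoin_simple_le_iff.2 h)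
    (IntermediateField.adjoin_simple_le_iff.2 h')

lemma affine_mem_adjoin (x : K) (a b : k) :
    algebraMap k K a * x + algebraMap k K b ∈ IntermediateField.adjoin k {x} :=
  add_mem (mul_mem (IntermediateField.algebraMap_mem _ a)
    (IntermediateField.mem_adjoin_simple_self k x)) (IntermediateField.algebraMap_mem _ b)

variable [IsAlgClosed k]

lemma transcendental_of_adjoin_eq {x x' : K} (hx : Transcendental k x)
    (h : IntermediateField.adjoin k {x'} = IntermediateField.adjoin k {x}) :
    Transcendental k x' := by
  apply transcendental_of_notMem_range
  rintro ⟨e, rfl⟩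
  apply notMem_range_of_transcendental hx
  have h1 := IntermediateField.mem_adjoin_simple_self k x
  rw [← h, IntermediateField.adjoin_simple_eq_bot_iff.2 (IntermediateField.algebraMap_mem _ e)] at h1
  exact h1

/-- By Cayley-Hamilton the square of the matrix `M` is `tr M · M - det M`. It must be scalar, and
`M` is not since `c ≠ 0`. -/
lemma sq_trace_eq_zero {x : K} (hx : Transcendental k x) {σ : K ≃ₐ[k] K} {a b c d : k} (hc : c ≠ 0)
    (hσ : (algebraMap k K c * x + algebraMap k K d) * σ x = algebraMap k K a * x + algebraMap k K b)
    (h : σ (σ x) = x) : a + d = 0 := by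
  have h2 := congrArg σ hσ
  simp only [map_mul, map_add, AlgEquiv.commutes, h] at h2
  have h3 : aeval x (C (c * (a + d)) * X ^ 2 + C (b * c + d ^ 2 - a ^ 2 - b * c) * X -
      C (b * (a + d))) = 0 := by
    simp only [map_mul, map_add, map_sub, map_pow, aeval_C, aeval_X]
    linear_combination (algebraMap k K c * x + algebraMap k K d) * h2 +
      (algebraMap k K a - algebraMap k K c * x) * hσ
  have h4 := congrArg (coeff · 2) (transcendental_iff.1 hx _ h3)
  simp only [coeff_sub, coeff_add, coeff_C_mul, coeff_X_pow, coeff_X, coeff_C, coeff_zero] at h4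
  norm_num [hc] at h4
  exact h4

/-- By Cayley-Hamilton `M³ = (tr² - det) M - tr · det`, which must be scalar although `M` is not. -/
lemma sq_trace_eq_det {x : K} (hx : Transcendental k x) {σ : K ≃ₐ[k] K} {a b c d : k} (hc : c ≠ 0)
    (hσ : (algebraMap k K c * x + algebraMap k K d) * σ x = algebraMap k K a * x + algebraMap k K b)
    (h : σ (σ (σ x)) = x) : (a + d) ^ 2 = a * d - b * c := by
  have h2 := congrArg σ hσ
  have h3 := congrArg (fun z => σ (σ z)) hσ
  simp only [map_mul, map_add, AlgEquiv.commutes, h] at h2 h3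
  have h5 : aeval x (C (c * ((a + d) ^ 2 - (a * d - b * c))) * X ^ 2 +
      C ((d - a) * ((a + d) ^ 2 - (a * d - b * c))) * X -
      C (b * ((a + d) ^ 2 - (a * d - b * c)))) = 0 := by
    simp only [map_mul, map_add, map_sub, map_pow, aeval_C, aeval_X]
    set A := algebraMap k K
    have h6 : (A c * σ x + A d) * (A b - A d * x) = (A a * σ x + A b) * (A c * x - A a) := by
      linear_combination (A c * x - A a) * h2 - (A c * σ x + A d) * h3
    linear_combination -(A c * x + A d) * h6 + (A c * (A b - A d * x) - A a * (A c * x - A a)) * hσ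
  have h4 := congrArg (coeff · 2) (transcendental_iff.1 hx _ h5)
  simp only [coeff_sub, coeff_add, coeff_C_mul, coeff_X_pow, coeff_X, coeff_C, coeff_zero] at h4
  norm_num [hc] at h4
  exact sub_eq_zero.1 h4

variable [CharZero k]

/-- A Möbius map over an algebraically closed field has a fixed point; if it is a finite point `z`,
the coordinate `1/(x - z)` moves it to infinity. -/
lemma IsModel.exists_affine (hK : IsFunctionField k K) (hg : HasGenus k K 2) {x y : K} {f : k[X]}
    (h : IsModel x y f) (σ : K ≃ₐ[k] K) : ∃ (x' : K) (α β : k), Transcendental k x' ∧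
      IntermediateField.adjoin k {x'} = IntermediateField.adjoin k {x} ∧
      σ x' = algebraMap k K α * x' + algebraMap k K β := by
  have hx := h.transcendental
  obtain ⟨a, b, c, d, hdet, hσ⟩ := h.exists_mobius hK hg σ
  set A := algebraMap k K
  by_cases hc : c = 0
  · subst hc
    have hd : d ≠ 0 := by rintro rfl; simp at hdet
    refine ⟨x, a / d, b / d, hx, rfl, ?_⟩
    have hd' : A d ≠ 0 := by simpa [A] using hd
    rw [map_div₀, map_div₀]
    simp only [map_zero, zero_mul, zero_add] at hσ
    field_simp
    linear_combination hσ
  · obtain ⟨z, hz⟩ : ∃ z, c * z ^ 2 + (d - a) * z - b = 0 := by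
      obtain ⟨z, hz⟩ := IsAlgClosed.exists_root (C c * X ^ 2 + C (d - a) * X + C (-b))
        (by rw [degree_quadratic hc]; decide)
      refine ⟨z, ?_⟩
      simp only [IsRoot.def, eval_add, eval_mul, eval_C, eval_pow, eval_X] at hz
      linear_combination hz
    have hacz : a - c * z ≠ 0 := fun h0 => hdet (by
      obtain rfl := sub_eq_zero.1 h0
      linear_combination c * hz)
    have hacz' : A a - A c * A z ≠ 0 := by
      rw [← map_mul, ← map_sub]
      exact (map_ne_zero A).2 hacz
    have hxz : x - A z ≠ 0 := by
      have := linear_ne_zero hx (c := 1) (d := -z) (by simp)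
      rwa [map_one, one_mul, map_neg, ← sub_eq_add_neg] at this
    have hL := linear_ne_zero (K := K) hx (c := c) (d := d) (Or.inl hc)
    have heq : IntermediateField.adjoin k {(x - A z)⁻¹} = IntermediateField.adjoin k {x} := by
      apply adjoin_simple_eq
      · exact inv_mem (sub_mem (IntermediateField.mem_adjoin_simple_self k x)
          (IntermediateField.algebraMap_mem _ z))
      · have h1 := add_mem (inv_mem (IntermediateField.mem_adjoin_simple_self k (x - A z)⁻¹))
          (IntermediateField.algebraMap_mem _ z)
        rwa [inv_inv, sub_add_cancel] at h1
    refine ⟨(x - A z)⁻¹, (c * z + d) / (a - c * z), c / (a - c * z),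
      transcendental_of_adjoin_eq hx heq, heq, ?_⟩
    have hz' : A c * A z ^ 2 + (A d - A a) * A z - A b = 0 := by
      simpa only [map_add, map_sub, map_mul, map_pow, map_zero] using congrArg A hz
    have h1 : (A c * x + A d) * (σ x - A z) = (A a - A c * A z) * (x - A z) := by
      linear_combination hσ - hz'
    have h2 : σ x - A z = (A a - A c * A z) * (x - A z) / (A c * x + A d) := by
      rw [eq_div_iff hL, mul_comm, h1]
    rw [map_inv₀, map_sub, AlgEquiv.commutes, h2, map_div₀, map_div₀, map_sub, map_add, map_mul]
    field_simp
    ring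

/-- Automorphisms whose action on the projective line is nontrivial of finite order can be
diagonalized. -/
lemma IsModel.exists_diagonal (hK : IsFunctionField k K) (hg : HasGenus k K 2) {x y : K} {f : k[X]}
    (h : IsModel x y f) {σ : K ≃ₐ[k] K} {n : ℕ} (hn : n ≠ 0) (hσ : σ x ≠ x) (hσn : (σ ^ n) x = x) :
    ∃ (x' y' : K) (f' : k[X]) (α : k), IsModel x' y' f' ∧ σ x' = algebraMap k K α * x' ∧ α ≠ 1 ∧
      IntermediateField.adjoin k {x'} = IntermediateField.adjoin k {x} := by
  obtain ⟨x₁, α, β, hx₁, heq, hα⟩ := h.exists_affine hK hg σ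
  have : CharZero K := charZero_of_injective_algebraMap (algebraMap k K).injective
  -- For `α = 1` the map is a translation by `β`, of finite order in characteristic zero only when
  -- `β = 0`.
  have hα1 : α ≠ 1 := by
    rintro rfl
    have hpow : ∀ j : ℕ, (σ ^ j) x₁ = x₁ + j * algebraMap k K β := fun j => by
      induction j with
      | zero => simp
      | succ j ih =>
        rw [pow_succ', AlgEquiv.mul_apply, ih, map_add, map_mul, map_natCast, AlgEquiv.commutes, hα,
          map_one]
        push_cast
        ring
    have h1 : (σ ^ n) x₁ = (1 : K ≃ₐ[k] K) x₁ :=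
      apply_eq_of_mem_adjoin (x := x) (by simpa using hσn)
        (heq ▸ IntermediateField.mem_adjoin_simple_self k x₁)
    rw [hpow, AlgEquiv.one_apply, add_eq_left, mul_eq_zero] at h1
    have h2 := h1.resolve_left (Nat.cast_ne_zero.2 hn)
    apply hσ
    exact apply_eq_of_mem_adjoin (x := x₁) (τ := 1) (by simp [hα, h2])
      (heq ▸ IntermediateField.mem_adjoin_simple_self k x)
  have hα1' : algebraMap k K α - 1 ≠ 0 := by
    rw [sub_ne_zero, ← map_one (algebraMap k K)]
    exact fun h => hα1 ((algebraMap k K).injective h)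
  -- This moves the finite fixed point `-β/(α - 1)` to the origin.
  set x' := algebraMap k K 1 * x₁ + algebraMap k K (β / (α - 1)) with hx'
  have heq' : IntermediateField.adjoin k {x'} = IntermediateField.adjoin k {x₁} := by
    apply adjoin_simple_eq (affine_mem_adjoin _ _ _)
    have h1 := affine_mem_adjoin (k := k) x' 1 (-(β / (α - 1)))
    have h2 : algebraMap k K 1 * x' + algebraMap k K (-(β / (α - 1))) = x₁ := by
      rw [map_neg, hx', map_one, one_mul, one_mul, add_neg_cancel_right]
    rwa [h2] at h1
  have hx't := transcendental_of_adjoin_eq hx₁ heq'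
  obtain ⟨y', f', h'⟩ := h.exists_isModel_of_adjoin_eq hx't (heq'.trans heq)
  refine ⟨x', y', f', α, h', ?_, hα1, heq'.trans heq⟩
  rw [hx', map_add, map_mul, AlgEquiv.commutes, AlgEquiv.commutes, hα, map_one, map_div₀, map_sub,
    map_one]
  field_simp
  ring

/-- Consequently only the exponents `i` with `α ^ i = l ^ 2` can occur in `f`. -/
lemma IsModel.exists_eigenvalue_of_diagonal (hK : IsFunctionField k K) (hg : HasGenus k K 2)
    {x y : K} {f : k[X]} (h : IsModel x y f) {σ : K ≃ₐ[k] K} {α : k}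
    (hσ : σ x = algebraMap k K α * x) : ∃ l : k, l ≠ 0 ∧ σ y = algebraMap k K l * y ∧
      ∀ i < 7, f.coeff i * α ^ i = l ^ 2 * f.coeff i := by
  obtain ⟨l, hl, hy, hsub⟩ := h.exists_eigenvalue hK hg σ (a := α) (b := 0) (c := 0) (d := 1)
    (by simp) (by simpa using hσ)
  refine ⟨l, hl, by simpa using hy, fun i hi => ?_⟩
  have h1 := congrArg (coeff · i) hsub
  simp only [coeff_C_mul] at h1
  rw [← h1]
  simp only [sexticSubst, map_zero, zero_mul, zero_add, add_zero, map_one, one_pow, mul_one,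
    mul_pow, ← C_pow, ← mul_assoc, ← C_mul, finsetSum_coeff, coeff_C_mul_X_pow]
  rw [Finset.sum_ite_eq, if_pos (Finset.mem_range.2 hi)]

lemma IsModel.scale {x y : K} {f g : k[X]} (h : IsModel x y f) {μ ν : k} (hμ : μ ≠ 0) (hν : ν ≠ 0)
    (hg : Squarefree g) (hg0 : 0 < g.natDegree) (hfg : f.comp (C μ * X) = C (ν ^ 2) * g) :
    IsModel (algebraMap k K μ⁻¹ * x) (algebraMap k K ν⁻¹ * y) g := by
  have hμ' : algebraMap k K μ ≠ 0 := by simpa using hμ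
  have hν' : algebraMap k K ν ≠ 0 := by simpa using hν
  set x' := algebraMap k K μ⁻¹ * x with hx'
  set y' := algebraMap k K ν⁻¹ * y with hy'
  have hxx' : x = algebraMap k K μ * x' := by
    rw [hx', map_inv₀, mul_inv_cancel_left₀ hμ']
  have hyy' : y = algebraMap k K ν * y' := by
    rw [hy', map_inv₀, mul_inv_cancel_left₀ hν']
  have heq : IntermediateField.adjoin k {x'} = IntermediateField.adjoin k {x} := by
    apply adjoin_simple_eq
    · exact mul_mem (IntermediateField.algebraMap_mem _ _)
        (IntermediateField.mem_adjoin_simple_self k x)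
    · rw [hxx']
      exact mul_mem (IntermediateField.algebraMap_mem _ _)
        (IntermediateField.mem_adjoin_simple_self k x')
  refine isModel_of_adjoin_eq_top (transcendental_of_adjoin_eq h.transcendental heq) hg hg0 ?_ ?_
  · have h1 := congrArg (aeval x') hfg
    rw [aeval_comp, map_mul, map_mul, aeval_C, aeval_C, aeval_X, ← hxx', ← h.sq, hyy', map_pow,
      mul_pow] at h1
    exact mul_left_cancel₀ (pow_ne_zero 2 hν') h1
  · rw [eq_top_iff, ← h.adjoin_eq_top, IntermediateField.adjoin_le_iff]
    rintro z (hz | hz)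
    · rw [hz, hxx']
      exact mul_mem (IntermediateField.algebraMap_mem _ _)
        (IntermediateField.subset_adjoin k _ (by simp))
    · rw [Set.mem_singleton_iff.1 hz, hyy']
      exact mul_mem (IntermediateField.algebraMap_mem _ _)
        (IntermediateField.subset_adjoin k _ (by simp))

end Diagonal

/-! ### The hyperelliptic involution inside a dihedral automorphism group. -/

section CentralInvolution

variable {k K : Type*} [Field k] [IsAlgClosed k] [CharZero k] [Field K] [Algebra k K]

/-- The hyperelliptic involution is central, and generates the group of automorphisms acting
trivially on the projective line. -/
lemma IsModel.exists_central_involution (hK : IsFunctionField k K) (hg : HasGenus k K 2) {x y : K}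
    {f : k[X]} (h : IsModel x y f) : ∃ ι : K ≃ₐ[k] K, ι ≠ 1 ∧ ι x = x ∧ (∀ σ, σ * ι = ι * σ) ∧
      ∀ σ : K ≃ₐ[k] K, σ x = x → σ = 1 ∨ σ = ι := by
  obtain ⟨ι, hιx, hιy⟩ := h.exists_involution
  have : CharZero K := charZero_of_injective_algebraMap (algebraMap k K).injective
  have hy0 : y ≠ 0 := by
    rintro rfl
    exact h.notMem (zero_mem _)
  have hι1 : ι ≠ 1 := by
    rintro rfl
    rw [AlgEquiv.one_apply] at hιy
    exact hy0 (self_eq_neg.1 hιy)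
  have hfix : ∀ σ : K ≃ₐ[k] K, σ x = x → σ = 1 ∨ σ = ι := fun σ hσ => by
    rcases h.apply_sq hσ with hy | hy
    · exact Or.inl (h.algEquiv_ext (by simpa using hσ) (by simpa using hy))
    · exact Or.inr (h.algEquiv_ext (by rw [hσ, hιx]) (by rw [hy, hιy]))
  refine ⟨ι, hι1, hιx, fun σ => ?_, hfix⟩
  -- A conjugate of `ι` fixes `x`, because `σ⁻¹` preserves `k(x)`, on which `ι` is trivial.
  rcases hfix (σ * ι * σ⁻¹) (by
    rw [AlgEquiv.mul_apply, AlgEquiv.mul_apply]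
    have h1 : ι (σ⁻¹ x) = (1 : K ≃ₐ[k] K) (σ⁻¹ x) := apply_eq_of_mem_adjoin (x := x) hιx
      (h.apply_mem_adjoin hK hg σ⁻¹ (IntermediateField.mem_adjoin_simple_self k x))
    rw [h1, AlgEquiv.one_apply, ← AlgEquiv.mul_apply, mul_inv_cancel, AlgEquiv.one_apply]) with h1 | h1
  · exact absurd (conj_eq_one_iff.1 h1) hι1
  · exact mul_inv_eq_iff_eq_mul.1 h1

/-- The hyperelliptic involution is the only nontrivial central element, and every square in the
dihedral group of order eight is trivial or equal to it. -/
lemma IsModel.apply_apply_of_dihedralGroup_four (hK : IsFunctionField k K) (hg : HasGenus k K 2)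
    {x y : K} {f : k[X]} (h : IsModel x y f) (e : Aut k K ≃* DihedralGroup 4) (σ : K ≃ₐ[k] K) :
    σ (σ x) = x := by
  obtain ⟨ι, hι1, hιx, hιc, -⟩ := h.exists_central_involution hK hg
  have key : ∀ z : DihedralGroup 4, (∀ g, g * z = z * g) → z ≠ 1 →
      ∀ g : DihedralGroup 4, g * g = 1 ∨ g * g = z := by decide
  have h1 := key (e ι) (fun g => by
    obtain ⟨τ, rfl⟩ := e.surjective g
    rw [← map_mul, hιc, map_mul]) (by simpa using hι1) (e σ)
  rw [← map_mul, EmbeddingLike.map_eq_one_iff, e.injective.eq_iff] at h1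
  rw [← AlgEquiv.mul_apply]
  rcases h1 with h1 | h1 <;> simp [h1, hιx]

/-- In the dihedral group of order twelve each element has trivial square, or a cube that is trivial
or equal to the nontrivial central element, here the hyperelliptic involution. -/
lemma IsModel.apply_apply_of_dihedralGroup_six (hK : IsFunctionField k K) (hg : HasGenus k K 2)
    {x y : K} {f : k[X]} (h : IsModel x y f) (e : Aut k K ≃* DihedralGroup 6) (σ : K ≃ₐ[k] K) :
    σ (σ x) = x ∨ σ (σ (σ x)) = x := by
  obtain ⟨ι, hι1, hιx, hιc, -⟩ := h.exists_central_involution hK hg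
  have key : ∀ z : DihedralGroup 6, (∀ g, g * z = z * g) → z ≠ 1 →
      ∀ g : DihedralGroup 6, g * g = 1 ∨ g * (g * g) = 1 ∨ g * (g * g) = z := by decide
  have h1 := key (e ι) (fun g => by
    obtain ⟨τ, rfl⟩ := e.surjective g
    rw [← map_mul, hιc, map_mul]) (by simpa using hι1) (e σ)
  rw [← map_mul, ← map_mul, EmbeddingLike.map_eq_one_iff, EmbeddingLike.map_eq_one_iff,
    e.injective.eq_iff] at h1
  rw [← AlgEquiv.mul_apply, ← AlgEquiv.mul_apply]
  rcases h1 with h1 | h1 | h1 <;> simp [h1, hιx]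

end CentralInvolution

end Curve

namespace Curve

/-! ### From a dihedral automorphism group to the normal form. -/

section Classification

variable {k K : Type*} [Field k] [IsAlgClosed k] [CharZero k] [Field K] [Algebra k K]

lemma not_squarefree_of_dvd_of_natDegree {p f : k[X]} (hp : p.natDegree ≠ 0) (h : p ^ 2 ∣ f) :
    ¬ Squarefree f := fun hf => hp (natDegree_eq_zero_of_isUnit (hf p (by rwa [← sq])))

/-- At `t = 9/100` the covariant vanishes and there is a further symmetry, with matrix rows `(-κ,
3/10)` and `(1, -κ)`. Its squared trace equals its determinant `-4/10`, so it has order three on the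
line, and its nonzero trace contradicts `hx`. -/
lemma IsModel.quintic_ne (hx : ∀ σ : K ≃ₐ[k] K, ∀ z w : K, ∀ g : k[X], IsModel z w g → σ (σ z) = z)
    {x y : K} {t : k} (h : IsModel x y (X ^ 5 + X ^ 3 + C t * X)) : t ≠ 9 / 100 := by
  rintro rfl
  obtain ⟨κ, hκ⟩ := IsAlgClosed.exists_pow_nat_eq (-1 / 10 : k) two_pos
  have hκ0 : κ ≠ 0 := by
    rintro rfl
    norm_num at hκ
  have hdeg := natDegree_quintic (9 / 100 : k)
  obtain ⟨σ, hσ, -⟩ := h.exists_algEquiv_of_sexticSubst (a := -κ) (b := 3 / 10) (c := 1) (d := -κ)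
    (l := 8 * κ ^ 3) (by omega) (by omega) (fun h0 => by
      have : (-4 / 10 : k) = 0 := by linear_combination h0 - hκ
      norm_num at this) (by simpa) (by
      rw [sexticSubst_quintic]
      apply Polynomial.funext
      intro u
      simp only [eval_add, eval_mul, eval_pow, eval_C, eval_X]
      linear_combination (243/10000*u + 27/100*u^3 + 27/100*u^5 - 243/10000*κ - 243/200*κ*u^2
        - 81/20*κ*u^4 - 9/10*κ*u^6 + 243/250*κ^2*u + 54/5*κ^2*u^3 + 54/5*κ^2*u^5 - 27/1000*κ^3
        - 27/20*κ^3*u^2 - 9/2*κ^3*u^4 - κ^3*u^6 - 567/100*κ^4*u - 63*κ^4*u^3 - 63*κ^4*u^5) * hκ)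
  have h1 := sq_trace_eq_zero h.transcendental one_ne_zero hσ (hx σ _ _ _ h)
  apply hκ0
  linear_combination -h1 / 2

/-- At `t = -1/50` the covariant vanishes and the traceless matrix with rows `(2κ, κ²)` and `(2,
-2κ)` gives a further symmetry. Its product with `diag(ω, 1)` has squared trace twice the
determinant, hence order four on the line, so neither its square nor its cube acts trivially. -/
lemma IsModel.sextic_ne (hx : ∀ σ : K ≃ₐ[k] K, ∀ z w : K, ∀ g : k[X], IsModel z w g →
    σ (σ z) = z ∨ σ (σ (σ z)) = z)
    {x y : K} {t : k} (h : IsModel x y (X ^ 6 + X ^ 3 + C t)) : t ≠ -1 / 50 := by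
  rintro rfl
  obtain ⟨κ, hκ⟩ := IsAlgClosed.exists_pow_nat_eq (2 / 5 : k) three_pos
  obtain ⟨ω, hω⟩ := exists_isPrimitiveRoot_three (k := k)
  have hκ0 : κ ≠ 0 := by
    rintro rfl
    norm_num at hκ
  have hω0 : ω ≠ 0 := hω.ne_zero (by norm_num)
  have hω1 : ω ≠ 1 := hω.ne_one (by norm_num)
  have hω3 := hω.pow_eq_one
  have hω2 : ω ^ 2 + ω + 1 = 0 := by
    apply mul_left_cancel₀ (sub_ne_zero.2 hω1)
    linear_combination hω3
  have hdeg := natDegree_sextic (-1 / 50 : k)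
  obtain ⟨l, hl⟩ := IsAlgClosed.exists_pow_nat_eq (216 * κ ^ 6) two_pos
  obtain ⟨σ, hσ, -⟩ := h.exists_algEquiv_of_sexticSubst (a := 2 * κ * ω) (b := κ ^ 2) (c := 2 * ω)
    (d := -2 * κ) (l := l) (by omega) (by omega) (fun h0 => by
      have : -6 * κ ^ 2 * ω = 0 := by linear_combination h0
      simp [hκ0, hω0] at this) (by
      rintro rfl
      exact hκ0 (by simpa using hl.symm)) (by
      rw [sexticSubst_sextic, hl]
      apply Polynomial.funext
      intro u
      simp only [eval_add, eval_mul, eval_pow, eval_C, eval_X]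
      linear_combination (16/5*(ω*u)^6 - 96/5*κ*(ω*u)^5 + 48*κ^2*(ω*u)^4 - 64*κ^3*(ω*u)^3
        - 152*κ^3*(ω*u)^6 + 48*κ^4*(ω*u)^2 + 192*κ^4*(ω*u)^5 - 96/5*κ^5*(ω*u) + 240*κ^5*(ω*u)^4
        - 38/5*κ^6 + 160*κ^6*(ω*u)^3 + 60*κ^7*(ω*u)^2 + 12*κ^8*(ω*u) + κ^9) * hκ +
        216 * κ ^ 6 * (u ^ 6 * (ω ^ 3 + 1) + u ^ 3) * hω3)
  have hc : 2 * ω ≠ 0 := mul_ne_zero two_ne_zero hω0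
  rcases hx σ _ _ _ h with h1 | h1
  · have h2 := sq_trace_eq_zero h.transcendental hc hσ h1
    have h3 : 2 * κ * (ω - 1) = 0 := by linear_combination h2
    simp [hκ0, sub_ne_zero.2 hω1] at h3
  · have h2 := sq_trace_eq_det h.transcendental hc hσ h1
    have h3 : -6 * κ ^ 2 * ω = 0 := by linear_combination h2 - 4 * κ ^ 2 * hω2
    simp [hκ0, hω0] at h3

lemma not_X_sq_dvd_of_squarefree {f : k[X]} (hf : Squarefree f) : ¬ X ^ 2 ∣ f := fun h =>
  not_squarefree_of_dvd_of_natDegree (by simp) h hf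

/-- A curve with automorphism group of order eight is given by an equation in the normal form. -/
theorem exists_quintic_of_dihedralGroup (hK : IsFunctionField k K) (hg : HasGenus k K 2)
    (e : Aut k K ≃* DihedralGroup 4) : ∃ t : k, t ≠ 0 ∧ t ≠ 1 / 4 ∧ t ≠ 9 / 100 ∧
      IsIsoToEqn k K (X ^ 5 + X ^ 3 + C t * X) := by
  have hinv : ∀ σ : K ≃ₐ[k] K, ∀ z w : K, ∀ g : k[X], IsModel z w g → σ (σ z) = z :=
    fun σ z w g h => h.apply_apply_of_dihedralGroup_four hK hg e σ
  obtain ⟨φ, hφ⟩ : ∃ φ : K ≃ₐ[k] K, φ * φ ≠ 1 := by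
    refine ⟨e.symm (DihedralGroup.r 1), fun h => ?_⟩
    rw [← map_mul, EmbeddingLike.map_eq_one_iff] at h
    revert h
    decide
  obtain ⟨x₀, y₀, f₀, h₀⟩ := exists_isModel hK hg
  have hφx₀ : φ x₀ ≠ x₀ := fun h => hφ (by
    apply h₀.algEquiv_ext
    · simp [h]
    · rcases h₀.apply_sq h with h | h <;> simp [h])
  obtain ⟨x, y, f, α, h, hα, hα1, -⟩ := h₀.exists_diagonal hK hg two_ne_zero hφx₀ (by
    rw [sq, AlgEquiv.mul_apply, hinv φ _ _ _ h₀])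
  obtain ⟨l, hl0, hl, hcoeff⟩ := h.exists_eigenvalue_of_diagonal hK hg hα
  have hx0 : x ≠ 0 := by
    rintro rfl
    exact notMem_range_of_transcendental h.transcendental ⟨0, map_zero _⟩
  have hy0 : y ≠ 0 := by
    rintro rfl
    exact h.notMem (zero_mem _)
  have hinj := (algebraMap k K).injective
  have hα2 : α ^ 2 = 1 := by
    have h1 := hinv φ _ _ _ h
    rw [hα, map_mul, AlgEquiv.commutes, hα, ← mul_assoc, ← map_mul, mul_eq_right₀ hx0] at h1
    apply hinj
    rw [sq, h1, map_one]
  obtain rfl : α = -1 := (sq_eq_sq_iff_eq_or_eq_neg.1 (hα2.trans (one_pow 2).symm)).resolve_left hα1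
  -- `φ * φ` fixes `x` and is not the identity, so it negates `y`.
  have hl2 : l ^ 2 = -1 := by
    have h1 : φ (φ y) = algebraMap k K (l ^ 2) * y := by
      rw [hl, map_mul, AlgEquiv.commutes, hl, sq, map_mul]
      ring
    rcases h.apply_sq (σ := φ * φ) (by simp [hinv φ _ _ _ h]) with h2 | h2
    · exact absurd (h.algEquiv_ext (τ := 1) (by simp [hinv φ _ _ _ h]) (by simpa using h2)) hφ
    · rw [AlgEquiv.mul_apply, h1, ← neg_one_mul, mul_left_inj' hy0] at h2
      apply hinj
      rw [h2]; simp
  have heven : ∀ i < 7, Even i → f.coeff i = 0 := fun i hi hi' => by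
    have h1 := hcoeff i hi
    rw [hi'.neg_one_pow, hl2] at h1
    apply mul_left_cancel₀ (two_ne_zero (α := k))
    linear_combination h1
  have hdeg := h.natDegree_eq hK hg
  have h5 : f.natDegree = 5 := by
    refine hdeg.resolve_right fun h6 => ?_
    have := heven 6 (by norm_num) (by decide)
    rw [← h6, coeff_natDegree, leadingCoeff_eq_zero] at this
    exact h.squarefree.ne_zero this
  have ha5 : f.coeff 5 ≠ 0 := by
    rw [← h5, coeff_natDegree, Ne, leadingCoeff_eq_zero]
    exact h.squarefree.ne_zero
  have hf : f = C (f.coeff 5) * X ^ 5 + C (f.coeff 3) * X ^ 3 + C (f.coeff 1) * X := by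
    conv_lhs => rw [as_sum_range_C_mul_X_pow' f (n := 7) (by omega)]
    simp only [Finset.sum_range_succ, Finset.sum_range_zero, heven 0 (by norm_num) (by decide),
      heven 2 (by norm_num) (by decide), heven 4 (by norm_num) (by decide),
      heven 6 (by norm_num) (by decide)]
    simp only [map_zero]
    ring
  generalize f.coeff 5 = a at *
  generalize f.coeff 3 = b at *
  generalize f.coeff 1 = c at *
  have hc : c ≠ 0 := by
    rintro rfl
    apply not_X_sq_dvd_of_squarefree h.squarefree
    rw [hf]
    exact ⟨C a * X ^ 3 + C b * X, by simp only [map_zero]; ring⟩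
  -- Without the middle term `x ↦ l x`, with `l² = -1`, would lift to an automorphism of order four
  -- on the line, whereas all automorphisms act there as involutions or trivially.
  have hb : b ≠ 0 := by
    rintro rfl
    obtain ⟨m, hm⟩ := IsAlgClosed.exists_pow_nat_eq l two_pos
    obtain ⟨σ, hσ, -⟩ := h.exists_algEquiv_of_sexticSubst (a := l) (b := 0) (c := 0) (d := 1)
      (l := m) (by omega) (by omega) (by simpa) (by rintro rfl; simp [hl0.symm] at hm) (by
        rw [hf, hm]
        have : (C l : k[X]) ^ 2 = -1 := by rw [← C_pow, hl2]; simp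
        simp [sexticSubst, Finset.sum_range_succ, coeff_X]
        linear_combination C a * X ^ 5 * (C l ^ 3 - C l) * this)
    have h1 := hinv σ _ _ _ h
    simp only [map_zero, map_one, zero_mul, zero_add, one_mul, add_zero] at hσ
    rw [hσ, map_mul, AlgEquiv.commutes, hσ, ← mul_assoc, ← map_mul, mul_eq_right₀ hx0, ← sq, hl2,
      ← map_one (algebraMap k K), hinj.eq_iff] at h1
    norm_num at h1
  -- If `b² = 4ac`, then `f = X (2aX² + b)² / (4a)`.
  have hdisc : b ^ 2 ≠ 4 * a * c := fun h0 => by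
    refine not_squarefree_of_dvd_of_natDegree (p := C (2 * a) * X ^ 2 + C b) ?_ ?_ h.squarefree
    · have : (C (2 * a) * X ^ 2 + C b).natDegree = 2 := by
        compute_degree!
      omega
    · refine ⟨C (4 * a)⁻¹ * X, ?_⟩
      rw [hf]
      apply Polynomial.funext
      intro u
      simp only [eval_add, eval_mul, eval_pow, eval_C, eval_X]
      field_simp
      linear_combination -u * h0
  -- Substituting `μX` and dividing by `ν²` makes the first two coefficients 1 exactly when `a μ² =
  -- b` and `ν² = b μ³`.
  obtain ⟨μ, hμ⟩ := IsAlgClosed.exists_pow_nat_eq (b / a) two_pos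
  obtain ⟨ν, hν⟩ := IsAlgClosed.exists_pow_nat_eq (b * μ ^ 3) two_pos
  have hμ0 : μ ≠ 0 := by
    rintro rfl
    exact div_ne_zero hb ha5 (by simpa using hμ.symm)
  have hν0 : ν ≠ 0 := by
    rintro rfl
    exact hμ0 (by simpa [hb] using hν.symm)
  have hμ' : a * μ ^ 2 = b := by rw [hμ]; field_simp
  set t := c / (b * μ ^ 2) with ht
  have ht0 : t ≠ 0 := div_ne_zero hc (mul_ne_zero hb (pow_ne_zero 2 hμ0))
  have ht1 : t ≠ 1 / 4 := fun h0 => hdisc (by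
    rw [ht, div_eq_div_iff (mul_ne_zero hb (pow_ne_zero 2 hμ0)) (by norm_num)] at h0
    linear_combination -a * h0 - b * hμ')
  have hmod := h.scale (g := X ^ 5 + X ^ 3 + C t * X) hμ0 hν0 (squarefree_quintic ht0 ht1)
    (by rw [natDegree_quintic]; norm_num) (by
      rw [hf, hν, ht]
      apply Polynomial.funext
      intro u
      simp only [eval_comp, eval_add, eval_mul, eval_pow, eval_C, eval_X]
      rw [← hμ']
      field_simp)
  exact ⟨t, ht0, ht1, hmod.quintic_ne hinv, hmod.isIsoToEqn⟩

/-- A curve with automorphism group of order twelve is given by an equation in the normal form. -/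
theorem exists_sextic_of_dihedralGroup (hK : IsFunctionField k K) (hg : HasGenus k K 2)
    (e : Aut k K ≃* DihedralGroup 6) : ∃ t : k, t ≠ 0 ∧ t ≠ 1 / 4 ∧ t ≠ -1 / 50 ∧
      IsIsoToEqn k K (X ^ 6 + X ^ 3 + C t) := by
  have hinv : ∀ σ : K ≃ₐ[k] K, ∀ z w : K, ∀ g : k[X], IsModel z w g →
      σ (σ z) = z ∨ σ (σ (σ z)) = z :=
    fun σ z w g h => h.apply_apply_of_dihedralGroup_six hK hg e σ
  obtain ⟨φ, hφ1, hφ3⟩ : ∃ φ : K ≃ₐ[k] K, φ ≠ 1 ∧ φ ^ 3 = 1 := by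
    refine ⟨e.symm (DihedralGroup.r 2), fun h => ?_, ?_⟩
    · rw [EmbeddingLike.map_eq_one_iff] at h
      revert h
      decide
    · rw [← map_pow, EmbeddingLike.map_eq_one_iff]
      decide
  obtain ⟨x₀, y₀, f₀, h₀⟩ := exists_isModel hK hg
  -- An automorphism fixing `z` squares to the identity, while `φ` has order three.
  have hfix : ∀ z w : K, ∀ g : k[X], IsModel z w g → φ z ≠ z := fun z w g h hz => by
    rcases h.apply_sq hz with hw | hw
    · exact hφ1 (h.algEquiv_ext (by simpa using hz) (by simpa using hw))
    · have h1 := congrArg (fun σ : K ≃ₐ[k] K => σ w) hφ3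
      simp only [pow_succ, pow_zero, one_mul, AlgEquiv.mul_apply, AlgEquiv.one_apply, hw, map_neg,
        neg_neg] at h1
      apply hφ1
      apply h.algEquiv_ext
      · simpa using hz
      · rw [hw, h1]; rfl
  obtain ⟨x, y, f, α, h, hα, hα1, -⟩ := h₀.exists_diagonal hK hg three_ne_zero (hfix _ _ _ h₀)
    (by rw [hφ3, AlgEquiv.one_apply])
  obtain ⟨l, hl0, -, hcoeff⟩ := h.exists_eigenvalue_of_diagonal hK hg hα
  have hx0 : x ≠ 0 := by
    rintro rfl
    exact notMem_range_of_transcendental h.transcendental ⟨0, map_zero _⟩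
  have hinj := (algebraMap k K).injective
  have hα3 : α ^ 3 = 1 := by
    have h1 := congrArg (fun σ : K ≃ₐ[k] K => σ x) hφ3
    simp only [pow_succ, pow_zero, one_mul, AlgEquiv.mul_apply, AlgEquiv.one_apply, hα, map_mul,
      AlgEquiv.commutes, ← mul_assoc] at h1
    rw [mul_eq_right₀ hx0] at h1
    apply hinj
    rw [map_pow, map_one, ← h1]
    ring
  have hα0 : α ≠ 0 := by
    rintro rfl
    simp at hα3
  have hα2 : α ^ 2 + α + 1 = 0 := by
    apply mul_left_cancel₀ (sub_ne_zero.2 hα1)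
    linear_combination hα3
  have hα21 : α ^ 2 ≠ 1 := fun h0 => hα1 (by linear_combination hα3 - α * h0)
  have hα2α : α ^ 2 ≠ α := fun h0 => hα1 (by
    apply mul_left_cancel₀ hα0
    linear_combination h0)
  have hdeg := h.natDegree_eq hK hg
  have hlead : f.coeff f.natDegree ≠ 0 := by
    rw [coeff_natDegree, Ne, leadingCoeff_eq_zero]
    exact h.squarefree.ne_zero
  have hlα : l ^ 2 = α ^ f.natDegree := by
    have := hcoeff f.natDegree (by omega)
    rw [mul_comm] at this
    exact (mul_right_cancel₀ hlead this).symm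
  have hzero : ∀ i < 7, α ^ i ≠ l ^ 2 → f.coeff i = 0 := fun i hi hne => by
    have h1 : (α ^ i - l ^ 2) * f.coeff i = 0 := by linear_combination hcoeff i hi
    exact (mul_eq_zero.1 h1).resolve_left (sub_ne_zero.2 hne)
  -- In degree five the eigenvalue is `α⁵ = α²`, which kills the coefficients of 1 and `X`, so `X²`
  -- would divide `f`.
  have h6 : f.natDegree = 6 := by
    refine hdeg.resolve_left fun h5 => ?_
    apply not_X_sq_dvd_of_squarefree h.squarefree
    rw [X_pow_dvd_iff]
    have hl2 : l ^ 2 = α ^ 2 := by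
      rw [hlα, h5]
      linear_combination α ^ 2 * hα3
    intro d hd
    interval_cases d
    · exact hzero 0 (by norm_num) (by rw [hl2, pow_zero]; exact hα21.symm)
    · exact hzero 1 (by norm_num) (by rw [hl2, pow_one]; exact hα2α.symm)
  have hl2 : l ^ 2 = 1 := by
    rw [hlα, h6]
    linear_combination (α ^ 3 + 1) * hα3
  rw [h6] at hlead
  have hf : f = C (f.coeff 6) * X ^ 6 + C (f.coeff 3) * X ^ 3 + C (f.coeff 0) := by
    have h4 : α ^ 4 = α := by linear_combination α * hα3
    have h5 : α ^ 5 = α ^ 2 := by linear_combination α ^ 2 * hα3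
    conv_lhs => rw [as_sum_range_C_mul_X_pow' f (n := 7) (by omega)]
    simp only [Finset.sum_range_succ, Finset.sum_range_zero,
      hzero 1 (by norm_num) (by rwa [hl2, pow_one]), hzero 2 (by norm_num) (by rwa [hl2]),
      hzero 4 (by norm_num) (by rwa [hl2, h4]), hzero 5 (by norm_num) (by rwa [hl2, h5])]
    simp only [map_zero]
    ring
  generalize f.coeff 6 = a at *
  generalize f.coeff 3 = b at *
  generalize f.coeff 0 = c at *
  have hc : c ≠ 0 := by
    rintro rfl
    apply not_X_sq_dvd_of_squarefree h.squarefree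
    rw [hf]
    exact ⟨C a * X ^ 4 + C b * X, by simp only [map_zero]; ring⟩
  -- Without the middle term `x ↦ -αx` would lift to an automorphism of order six on the line, where
  -- only orders one, two and three occur.
  have hb : b ≠ 0 := by
    rintro rfl
    obtain ⟨σ, hσ, -⟩ := h.exists_algEquiv_of_sexticSubst (a := -α) (b := 0) (c := 0) (d := 1)
      (l := 1) (by omega) (by omega) (by simpa) one_ne_zero (by
        rw [hf]
        have : (C α : k[X]) ^ 3 = 1 := by rw [← C_pow, hα3]; simp
        simp [sexticSubst, Finset.sum_range_succ, coeff_C]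
        linear_combination C a * X ^ 6 * (C α ^ 3 + 1) * this)
    simp only [map_zero, map_one, zero_mul, zero_add, one_mul, add_zero] at hσ
    rcases hinv σ _ _ _ h with h1 | h1
    · simp only [hσ, map_mul, AlgEquiv.commutes, ← mul_assoc] at h1
      rw [mul_eq_right₀ hx0, ← map_mul, ← map_one (algebraMap k K), hinj.eq_iff] at h1
      exact hα21 (by linear_combination h1)
    · simp only [hσ, map_mul, AlgEquiv.commutes, ← mul_assoc] at h1
      rw [mul_eq_right₀ hx0, ← map_mul, ← map_mul, ← map_one (algebraMap k K), hinj.eq_iff] at h1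
      have : (2 : k) = 0 := by linear_combination -h1 - hα3
      norm_num at this
  -- If `b² = 4ac`, then `f = (2aX³ + b)² / (4a)`.
  have hdisc : b ^ 2 ≠ 4 * a * c := fun h0 => by
    refine not_squarefree_of_dvd_of_natDegree (p := C (2 * a) * X ^ 3 + C b) ?_ ?_ h.squarefree
    · have : (C (2 * a) * X ^ 3 + C b).natDegree = 3 := by
        compute_degree!
      omega
    · refine ⟨C (4 * a)⁻¹, ?_⟩
      rw [hf]
      apply Polynomial.funext
      intro u
      simp only [eval_add, eval_mul, eval_pow, eval_C, eval_X]
      field_simp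
      linear_combination -h0
  -- The conditions for two unit coefficients after rescaling are `a μ³ = b` and `ν² = b μ³`.
  obtain ⟨μ, hμ⟩ := IsAlgClosed.exists_pow_nat_eq (b / a) three_pos
  obtain ⟨ν, hν⟩ := IsAlgClosed.exists_pow_nat_eq (b * μ ^ 3) two_pos
  have hμ0 : μ ≠ 0 := by
    rintro rfl
    exact div_ne_zero hb hlead (by simpa using hμ.symm)
  have hν0 : ν ≠ 0 := by
    rintro rfl
    exact hμ0 (by simpa [hb] using hν.symm)
  have hμ' : a * μ ^ 3 = b := by rw [hμ]; field_simp
  set t := c / (b * μ ^ 3) with ht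
  have ht0 : t ≠ 0 := div_ne_zero hc (mul_ne_zero hb (pow_ne_zero 3 hμ0))
  have ht1 : t ≠ 1 / 4 := fun h0 => hdisc (by
    rw [ht, div_eq_div_iff (mul_ne_zero hb (pow_ne_zero 3 hμ0)) (by norm_num)] at h0
    linear_combination -a * h0 - b * hμ')
  have hmod := h.scale (g := X ^ 6 + X ^ 3 + C t) hμ0 hν0 (squarefree_sextic ht0 ht1)
    (by rw [natDegree_sextic]; norm_num) (by
      rw [hf, hν, ht]
      apply Polynomial.funext
      intro u
      simp only [eval_comp, eval_add, eval_mul, eval_pow, eval_C, eval_X]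
      rw [← hμ']
      field_simp)
  exact ⟨t, ht0, ht1, hmod.sextic_ne hinv, hmod.isIsoToEqn⟩

end Classification

end Curve

theorem lemma3 {k : Type*} [Field k] [IsAlgClosed k] [CharZero k]
    {K : Type*} [Field K] [Algebra k K]
    (hK : Curve.IsFunctionField k K) (hg : Curve.HasGenus k K 2) :
    (Nonempty (Curve.Aut k K ≃* DihedralGroup 4) ↔
      ∃ t : k, t ≠ 0 ∧ t ≠ 1 / 4 ∧ t ≠ 9 / 100 ∧
        Curve.IsIsoToEqn k K (X ^ 5 + X ^ 3 + C t * X)) ∧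
    (Nonempty (Curve.Aut k K ≃* DihedralGroup 6) ↔
      ∃ t : k, t ≠ 0 ∧ t ≠ 1 / 4 ∧ t ≠ -1 / 50 ∧
        Curve.IsIsoToEqn k K (X ^ 6 + X ^ 3 + C t)) := by
  refine ⟨⟨fun ⟨e⟩ => Curve.exists_quintic_of_dihedralGroup hK hg e, ?_⟩,
    ⟨fun ⟨e⟩ => Curve.exists_sextic_of_dihedralGroup hK hg e, ?_⟩⟩
  · rintro ⟨t, h0, h1, h9, h⟩
    obtain ⟨x, y, hxy⟩ := Curve.exists_isModel_of_isIsoToEqn hK (Curve.squarefree_quintic h0 h1)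
      (by rw [Curve.natDegree_quintic]; norm_num) h
    exact hxy.nonempty_mulEquiv_dihedralGroup_four hK hg h0 h9
  · rintro ⟨t, h0, h1, h50, h⟩
    obtain ⟨x, y, hxy⟩ := Curve.exists_isModel_of_isIsoToEqn hK (Curve.squarefree_sextic h0 h1)
      (by rw [Curve.natDegree_sextic]; norm_num) h
    exact hxy.nonempty_mulEquiv_dihedralGroup_six hK hg h0 h50
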